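/- Let $n\ge 2$, let $\mathbb k$ be an algebraically closed field of characteristic zero, and let $q\in\mathbb k$ be a primitive $n$th root of unity. Let $D_n$ be the Drinfeld double of the Taft algebra, that is, the Hopf algebra over $\mathbb k$ generated by $a,b,c,d$ subject to $$ba=q\,ab,\quad db=q\,bd,\quad bc=cb,\quad ca=q\,ac,\quad dc=q\,cd,\quad da-q\,ad=1-bc,\quad a^n=0=d^n,\quad b^n=1=c^n,$$ with coproduct $\Delta(a)=a\otimes b+1\otimes a$, $\Delta(d)=d\otimes c+1\otimes d$, $\Delta(b)=b\otimes b$, $\Delta(c)=c\otimes c$. For $\ell\in\{1,\dots,n\}$ and $s\in\mathbb Z/n\mathbb Z$ let $V(\ell,s)$ be the simple $D_n$-module with basis $v_1,\dots,v_\ell$ and action $$a v_j=v_{j+1},\qquad b v_j=q^{s+j-1}v_j,\qquad c v_j=q^{j-(s+\ell)}v_j,\qquad d v_j=\frac{(q^{j-1}-1)(1-q^{j-1-\ell})}{q-1}\,v_{j-1},$$ where $v_0=v_{\ell+1}=0$, and let $P(\ell,s)$ be a projective cover of $V(\ell,s)$ (projective covers of all the $V(\ell,s)$ exist). **Theorem.**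 Let $V$ be any two-dimensional simple $D_n$-module and let $k\ge 1$. There are unique families of natural numbers $s_{i}$, $p_{i}$, indexed by the pairs $i=(\ell,s)\in\{1,\dots,n\}\times\mathbb Z/n\mathbb Z$ and with $p_{(n,s)}=0$ for all $s$, such that $$V^{\otimes k}\;\cong\;\bigoplus_{i}V(i)^{\oplus s_i}\;\oplus\;\bigoplus_{i}P(i)^{\oplus p_i}$$ as $D_n$-modules. (Thus $s_i$ and $p_i$ are the multiplicities of $V(i)$ and $P(i)$ in $V^{\otimes k}$; the module $V(n,s)$, which is both simple and projective, is counted only in $s_{(n,s)}$.) Let $\mathrm I_k$ be the set of all $i$ with $s_i\ne0$ or $p_i\ne0$, and for $i=(\ell,s)$ with $\ell<n$ let $p_i'=p_{(n-\ell,\,s+\ell)}$ (for $\ell=n$, where $p_i=0$, put $p_i'=0$). Then $$\dim_{\mathbb k}\operatorname{End}_{D_n}\!\left(V^{\otimes k}\right)=\sum_{i\in \mathrm I_k}p_i^2+\sum_{i\in \mathrm I_k}(s_i+p_i)^2+2\sum_{i\in \mathrm I_k}p_i\,p_i'.$$ -/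

import Mathlib

open scoped TensorProduct

universe u v w

noncomputable section

namespace TaftDouble

/-! ## The algebra -/

/-- The four generators of the Drinfeld double of the Taft algebra. -/
inductive Gen
  | a | b | c | d

section Algebra

variable (𝕜 : Type u) [Field 𝕜] (n : ℕ) (q : 𝕜)

/-- The free generator attached to `g`. -/
abbrev gen (g : Gen) : FreeAlgebra 𝕜 Gen := FreeAlgebra.ι 𝕜 g

open Gen in
/-- The defining relations: `ba = q ab`, `db = q bd`, `bc = cb`, `ca = q ac`, `dc = q cd`,
`da - q ad = 1 - bc`, `a ^ n = 0 = d ^ n`, `b ^ n = 1 = c ^ n`. -/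
inductive Rel : FreeAlgebra 𝕜 Gen → FreeAlgebra 𝕜 Gen → Prop
  | ba : Rel (gen 𝕜 b * gen 𝕜 a) (q • (gen 𝕜 a * gen 𝕜 b))
  | db : Rel (gen 𝕜 d * gen 𝕜 b) (q • (gen 𝕜 b * gen 𝕜 d))
  | bc : Rel (gen 𝕜 b * gen 𝕜 c) (gen 𝕜 c * gen 𝕜 b)
  | ca : Rel (gen 𝕜 c * gen 𝕜 a) (q • (gen 𝕜 a * gen 𝕜 c))
  | dc : Rel (gen 𝕜 d * gen 𝕜 c) (q • (gen 𝕜 c * gen 𝕜 d))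
  | da : Rel (gen 𝕜 d * gen 𝕜 a - q • (gen 𝕜 a * gen 𝕜 d)) (1 - gen 𝕜 b * gen 𝕜 c)
  | a_pow : Rel (gen 𝕜 a ^ n) 0
  | d_pow : Rel (gen 𝕜 d ^ n) 0
  | b_pow : Rel (gen 𝕜 b ^ n) 1
  | c_pow : Rel (gen 𝕜 c ^ n) 1

/-- The Drinfeld double `D_n` of the Taft algebra at the root of unity `q`, given by generators
and relations. -/
def D : Type u := RingQuot (Rel 𝕜 n q)

instance : Ring (D 𝕜 n q) := inferInstanceAs (Ring (RingQuot (Rel 𝕜 n q)))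

instance : Algebra 𝕜 (D 𝕜 n q) := inferInstanceAs (Algebra 𝕜 (RingQuot (Rel 𝕜 n q)))

/-- The image in `D_n` of a generator. -/
def D.of (g : Gen) : D 𝕜 n q := RingQuot.mkAlgHom 𝕜 (Rel 𝕜 n q) (gen 𝕜 g)

variable {𝕜 n q}

/-- Elements `f a, f b, f c, f d` of a `𝕜`-algebra that satisfy the defining relations of
`D_n`. -/
structure Satisfies (n : ℕ) (q : 𝕜) {A : Type*} [Ring A] [Algebra 𝕜 A] (f : Gen → A) : Prop where
  ba : f .b * f .a = q • (f .a * f .b)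
  db : f .d * f .b = q • (f .b * f .d)
  bc : f .b * f .c = f .c * f .b
  ca : f .c * f .a = q • (f .a * f .c)
  dc : f .d * f .c = q • (f .c * f .d)
  da : f .d * f .a - q • (f .a * f .d) = 1 - f .b * f .c
  a_pow : f .a ^ n = 0
  d_pow : f .d ^ n = 0
  b_pow : f .b ^ n = 1
  c_pow : f .c ^ n = 1

/-- The algebra homomorphism out of `D_n` with prescribed values on the generators. -/
def D.lift {A : Type*} [Ring A] [Algebra 𝕜 A] (f : Gen → A) (hf : Satisfies n q f) :
    D 𝕜 n q →ₐ[𝕜] A :=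
  RingQuot.liftAlgHom 𝕜 ⟨FreeAlgebra.lift 𝕜 f, by
    intro x y h
    cases h <;> simp only [map_mul, map_smul, map_sub, map_pow, map_one, map_zero,
      FreeAlgebra.lift_ι_apply]
    exacts [hf.ba, hf.db, hf.bc, hf.ca, hf.dc, hf.da, hf.a_pow, hf.d_pow, hf.b_pow, hf.c_pow]⟩

theorem D.lift_of {A : Type*} [Ring A] [Algebra 𝕜 A] (f : Gen → A) (hf : Satisfies n q f)
    (g : Gen) : D.lift f hf (D.of 𝕜 n q g) = f g := by
  unfold D.lift D.of
  erw [RingQuot.liftAlgHom_mkAlgHom_apply]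
  simp

theorem D.satisfies_of : Satisfies n q (D.of 𝕜 n q) := by
  have key : ∀ {x y}, Rel 𝕜 n q x y →
      (RingQuot.mkAlgHom 𝕜 (Rel 𝕜 n q) x : RingQuot (Rel 𝕜 n q)) =
        RingQuot.mkAlgHom 𝕜 (Rel 𝕜 n q) y := fun h => RingQuot.mkAlgHom_rel 𝕜 h
  have h1 := key Rel.ba
  have h2 := key Rel.db
  have h3 := key Rel.bc
  have h4 := key Rel.ca
  have h5 := key Rel.dc
  have h6 := key Rel.da
  have h7 := key Rel.a_pow
  have h8 := key Rel.d_pow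
  have h9 := key Rel.b_pow
  have h10 := key Rel.c_pow
  simp only [map_mul, map_smul, map_sub, map_pow, map_one, map_zero] at h1 h2 h3 h4 h5 h6 h7 h8 h9 h10
  exact ⟨h1, h2, h3, h4, h5, h6, h7, h8, h9, h10⟩

end Algebra

/-! ## The coproduct -/

section Coproduct

variable {𝕜 : Type u} [Field 𝕜] {n : ℕ} {q : 𝕜}

/-- Gaussian binomial coefficients. -/
def gauss (q : 𝕜) : ℕ → ℕ → 𝕜
  | _, 0 => 1
  | 0, _ + 1 => 0
  | m + 1, j + 1 => gauss q m j + q ^ (j + 1) * gauss q m (j + 1)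

theorem gauss_eq_zero (q : 𝕜) : ∀ m j, m < j → gauss q m j = 0
  | 0, 0, h => by omega
  | 0, _ + 1, _ => by simp [gauss]
  | _ + 1, 0, h => by omega
  | m + 1, j + 1, h => by
    rw [gauss, gauss_eq_zero q m j (by omega), gauss_eq_zero q m (j + 1) (by omega)]; simp

theorem gauss_self (q : 𝕜) : ∀ m, gauss q m m = 1
  | 0 => by simp [gauss]
  | m + 1 => by rw [gauss, gauss_self q m, gauss_eq_zero q m (m + 1) (by omega)]; simp

theorem gauss_absorb (q : 𝕜) : ∀ m j, j ≤ m →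
    (q ^ (j + 1) - 1) * gauss q m (j + 1) = (q ^ (m - j) - 1) * gauss q m j ∧
    (q ^ (j + 1) - 1) * gauss q (m + 1) (j + 1) = (q ^ (m + 1) - 1) * gauss q m j := by
  have step : ∀ m j, j ≤ m →
      (q ^ (j + 1) - 1) * gauss q m (j + 1) = (q ^ (m - j) - 1) * gauss q m j →
      (q ^ (j + 1) - 1) * gauss q (m + 1) (j + 1) = (q ^ (m + 1) - 1) * gauss q m j := by
    intro m j hj h
    have e : q ^ (m + 1) = q ^ (j + 1) * q ^ (m - j) := by rw [← pow_add]; congr 1; omega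
    rw [gauss, e]
    linear_combination q ^ (j + 1) * h
  intro m
  induction m with
  | zero =>
    intro j hj
    obtain rfl : j = 0 := by omega
    exact ⟨by simp [gauss], by simp [gauss]⟩
  | succ m ih =>
    intro j hj
    have main : (q ^ (j + 1) - 1) * gauss q (m + 1) (j + 1)
        = (q ^ (m + 1 - j) - 1) * gauss q (m + 1) j := by
      rcases Nat.lt_or_ge m j with hlt | hle
      · obtain rfl : j = m + 1 := by omega
        rw [gauss_eq_zero q (m + 1) (m + 1 + 1) (by omega)]; simp
      · rw [(ih j hle).2]
        cases j with
        | zero => simp [gauss]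
        | succ j =>
          have h1 := (ih j (by omega)).1
          have e : q ^ (m + 1) = q ^ (j + 1) * q ^ (m + 1 - (j + 1)) := by
            rw [← pow_add]; congr 1; omega
          have e2 : m + 1 - (j + 1) = m - j := by omega
          rw [e, e2]
          rw [gauss]
          linear_combination h1
    exact ⟨main, step (m + 1) j hj main⟩

theorem qcomm_pow {A : Type*} [Ring A] [Algebra 𝕜 A] {x y : A} (h : y * x = q • (x * y)) (j : ℕ) :
    y * x ^ j = q ^ j • (x ^ j * y) := by
  induction j with
  | zero => simp
  | succ j ih =>
    rw [pow_succ, ← mul_assoc, ih, smul_mul_assoc, mul_assoc, h, mul_smul_comm, smul_smul,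
      ← mul_assoc, pow_succ]

theorem qbinomial {A : Type*} [Ring A] [Algebra 𝕜 A] {x y : A} (h : y * x = q • (x * y)) (m : ℕ) :
    (x + y) ^ m = ∑ j ∈ Finset.range (m + 1), gauss q m j • (x ^ j * y ^ (m - j)) := by
  induction m with
  | zero => simp [gauss]
  | succ m ih =>
    rw [pow_succ', ih, Finset.mul_sum]
    have e1 : ∀ j ∈ Finset.range (m + 1),
        (x + y) * gauss q m j • (x ^ j * y ^ (m - j)) =
          gauss q m j • (x ^ (j + 1) * y ^ (m + 1 - (j + 1))) +
          (q ^ j * gauss q m j) • (x ^ j * y ^ (m + 1 - j)) := by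
      intro j hj
      have hj' : j ≤ m := by simpa [Nat.lt_succ_iff] using hj
      have e : m + 1 - j = m - j + 1 := by omega
      rw [mul_smul_comm, add_mul, smul_add, ← mul_assoc, ← mul_assoc, ← pow_succ', qcomm_pow h,
        smul_mul_assoc, mul_assoc (x ^ j), ← pow_succ', smul_smul, e, mul_comm (q ^ j)]
      simp
    rw [Finset.sum_congr rfl e1, Finset.sum_add_distrib]
    rw [Finset.sum_range_succ' (fun j => gauss q (m + 1) j • (x ^ j * y ^ (m + 1 - j))) (m + 1)]
    have e2 : ∑ j ∈ Finset.range (m + 1), (q ^ j * gauss q m j) • (x ^ j * y ^ (m + 1 - j)) =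
        ∑ j ∈ Finset.range (m + 1),
          (q ^ (j + 1) * gauss q m (j + 1)) • (x ^ (j + 1) * y ^ (m + 1 - (j + 1))) +
        gauss q (m + 1) 0 • (x ^ 0 * y ^ (m + 1 - 0)) := by
      have := Finset.sum_range_succ'
        (fun j => (q ^ j * gauss q m j) • (x ^ j * y ^ (m + 1 - j))) (m + 1)
      rw [Finset.sum_range_succ, gauss_eq_zero q m (m + 1) (by omega)] at this
      simp only [mul_zero, zero_smul, add_zero] at this
      rw [this]
      simp [gauss]
    rw [e2, ← add_assoc, ← Finset.sum_add_distrib]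
    congr 1
    refine Finset.sum_congr rfl fun j _ => ?_
    rw [← add_smul, gauss]

/-- If `y x = q x y` for a primitive `n`th root of unity `q` and `x ^ n = y ^ n = 0`, then
`(x + y) ^ n = 0`. -/
theorem add_pow_eq_zero {A : Type*} [Ring A] [Algebra 𝕜 A] (hq : IsPrimitiveRoot q n) {x y : A}
    (h : y * x = q • (x * y)) (hx : x ^ n = 0) (hy : y ^ n = 0) : (x + y) ^ n = 0 := by
  rw [qbinomial h]
  refine Finset.sum_eq_zero fun j hj => ?_
  have hj' : j ≤ n := by simpa [Nat.lt_succ_iff] using hj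
  rcases Nat.eq_zero_or_pos j with rfl | hpos
  · simp [hy]
  rcases hj'.eq_or_lt with rfl | hlt
  · simp [hx]
  · obtain ⟨i, rfl⟩ : ∃ i, j = i + 1 := ⟨j - 1, by omega⟩
    obtain ⟨m, rfl⟩ : ∃ m, n = m + 1 := ⟨n - 1, by omega⟩
    have h1 := (gauss_absorb q m i (by omega)).2
    rw [hq.pow_eq_one, sub_self, zero_mul] at h1
    have h2 : q ^ (i + 1) - 1 ≠ 0 := sub_ne_zero.2 (hq.pow_ne_one_of_pos_of_lt (by omega) hlt)
    rw [(mul_eq_zero.1 h1).resolve_left h2, zero_smul]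

/-- The coproduct on generators: `Δ a = a ⊗ b + 1 ⊗ a`, `Δ b = b ⊗ b`, `Δ c = c ⊗ c`,
`Δ d = d ⊗ c + 1 ⊗ d`. -/
def comulGen (𝕜 : Type u) [Field 𝕜] (n : ℕ) (q : 𝕜) : Gen → D 𝕜 n q ⊗[𝕜] D 𝕜 n q
  | .a => D.of 𝕜 n q .a ⊗ₜ D.of 𝕜 n q .b + 1 ⊗ₜ D.of 𝕜 n q .a
  | .b => D.of 𝕜 n q .b ⊗ₜ D.of 𝕜 n q .b
  | .c => D.of 𝕜 n q .c ⊗ₜ D.of 𝕜 n q .c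
  | .d => D.of 𝕜 n q .d ⊗ₜ D.of 𝕜 n q .c + 1 ⊗ₜ D.of 𝕜 n q .d

theorem satisfies_comulGen (hq : IsPrimitiveRoot q n) : Satisfies n q (comulGen 𝕜 n q) := by
  have H := D.satisfies_of (𝕜 := 𝕜) (n := n) (q := q)
  constructor
  · simp [comulGen, mul_add, add_mul, H.ba, TensorProduct.smul_tmul', TensorProduct.tmul_smul]
  · simp [comulGen, mul_add, add_mul, H.db, H.bc, TensorProduct.smul_tmul',
      TensorProduct.tmul_smul]
  · simp [comulGen, H.bc]
  · simp [comulGen, mul_add, add_mul, H.ca, H.bc, TensorProduct.smul_tmul',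
      TensorProduct.tmul_smul]
  · simp [comulGen, mul_add, add_mul, H.dc, TensorProduct.smul_tmul', TensorProduct.tmul_smul]
  · have e : D.of 𝕜 n q .d * D.of 𝕜 n q .a =
        q • (D.of 𝕜 n q .a * D.of 𝕜 n q .d) + (1 - D.of 𝕜 n q .b * D.of 𝕜 n q .c) := by
      rw [← H.da]; abel
    simp only [comulGen, mul_add, add_mul, Algebra.TensorProduct.tmul_mul_tmul, e, H.db, H.ca,
      ← H.bc, one_mul, mul_one, TensorProduct.add_tmul, TensorProduct.sub_tmul,
      TensorProduct.tmul_add, TensorProduct.tmul_sub, TensorProduct.smul_tmul',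
      TensorProduct.tmul_smul, smul_add, Algebra.TensorProduct.one_def]
    abel
  · rw [comulGen, add_comm]
    refine add_pow_eq_zero hq ?_ ?_ ?_
    · simp only [Algebra.TensorProduct.tmul_mul_tmul, H.ba, one_mul, mul_one,
        TensorProduct.tmul_smul]
    · simp [Algebra.TensorProduct.tmul_pow, H.a_pow]
    · simp [Algebra.TensorProduct.tmul_pow, H.a_pow]
  · rw [comulGen]
    refine add_pow_eq_zero hq ?_ ?_ ?_
    · simp only [Algebra.TensorProduct.tmul_mul_tmul, H.dc, one_mul, mul_one,
        TensorProduct.tmul_smul]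
    · simp [Algebra.TensorProduct.tmul_pow, H.d_pow]
    · simp [Algebra.TensorProduct.tmul_pow, H.d_pow]
  · simp [comulGen, Algebra.TensorProduct.tmul_pow, H.b_pow, Algebra.TensorProduct.one_def]
  · simp [comulGen, Algebra.TensorProduct.tmul_pow, H.c_pow, Algebra.TensorProduct.one_def]

/-- The coproduct `Δ : D_n → D_n ⊗ D_n`. -/
def comul (hq : IsPrimitiveRoot q n) : D 𝕜 n q →ₐ[𝕜] D 𝕜 n q ⊗[𝕜] D 𝕜 n q :=
  D.lift (comulGen 𝕜 n q) (satisfies_comulGen hq)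

end Coproduct

/-! ## Modules -/

/-- A left `D_n`-module, with its underlying `𝕜`-vector space. -/
structure DMod (𝕜 : Type u) [Field 𝕜] (n : ℕ) (q : 𝕜) where
  carrier : Type w
  [addCommGroup : AddCommGroup carrier]
  [module : Module 𝕜 carrier]
  [moduleD : Module (D 𝕜 n q) carrier]
  [isScalarTower : IsScalarTower 𝕜 (D 𝕜 n q) carrier]

section Modules

variable {𝕜 : Type u} [Field 𝕜] {n : ℕ} {q : 𝕜}

instance : CoeSort (DMod.{u, w} 𝕜 n q) (Type w) := ⟨DMod.carrier⟩

attribute [instance] DMod.addCommGroup DMod.module DMod.moduleD DMod.isScalarTower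

/-- The module attached to an algebra homomorphism `ρ : D_n → End_𝕜(M)`: `x • m = ρ x m`. -/
def DMod.ofRep {M : Type w} [AddCommGroup M] [Module 𝕜 M]
    (ρ : D 𝕜 n q →ₐ[𝕜] Module.End 𝕜 M) : DMod.{u, w} 𝕜 n q :=
  letI : Module (D 𝕜 n q) M := Module.compHom M ρ.toRingHom
  { carrier := M
    isScalarTower := ⟨fun r x m => by
      change ρ (r • x) m = r • ρ x m
      rw [map_smul, LinearMap.smul_apply]⟩ }

/-- The algebra homomorphism `D_n → End_𝕜(M)` given by the action on `M`. -/
def DMod.rep (M : DMod.{u, w} 𝕜 n q) : D 𝕜 n q →ₐ[𝕜] Module.End 𝕜 M :=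
  Algebra.lsmul 𝕜 𝕜 M

/-- The tensor product `M ⊗_𝕜 N`, on which `x` acts as `Δ x`. -/
def DMod.tensor (hq : IsPrimitiveRoot q n) (M : DMod.{u, v} 𝕜 n q) (N : DMod.{u, w} 𝕜 n q) :
    DMod.{u, max v w} 𝕜 n q :=
  DMod.ofRep (M := M ⊗[𝕜] N) <|
    (Module.endTensorEndAlgHom (R := 𝕜) (S := 𝕜) (A := 𝕜) (M := M) (N := N)).comp <|
      (Algebra.TensorProduct.map M.rep N.rep).comp (comul hq)

/-- The tensor power `M^{⊗(m+1)} = (⋯((M ⊗ M) ⊗ M) ⊗ ⋯) ⊗ M`. -/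
def DMod.tensorPowSucc (hq : IsPrimitiveRoot q n) (M : DMod.{u, w} 𝕜 n q) : ℕ → DMod.{u, w} 𝕜 n q
  | 0 => M
  | m + 1 => DMod.tensor hq (DMod.tensorPowSucc hq M m) M

/-- The tensor power `M^{⊗k}`, for `k ≥ 1`. -/
def DMod.tensorPow (hq : IsPrimitiveRoot q n) (M : DMod.{u, w} 𝕜 n q) (k : ℕ) : DMod.{u, w} 𝕜 n q :=
  DMod.tensorPowSucc hq M (k - 1)

/-- `P` is a projective cover of `S`: `P` is projective and there is a surjection `P → S` with
superfluous kernel. -/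
def IsProjectiveCover (P : DMod.{u, v} 𝕜 n q) (S : DMod.{u, w} 𝕜 n q) : Prop :=
  Module.Projective (D 𝕜 n q) P ∧
    ∃ f : P →ₗ[D 𝕜 n q] S, Function.Surjective f ∧
      ∀ N : Submodule (D 𝕜 n q) P, N ⊔ LinearMap.ker f = ⊤ → N = ⊤

end Modules

/-! ## The simple modules -/

/-- Pairs `(ℓ, s)` with `1 ≤ ℓ ≤ n` and `s ∈ ℤ/n`. -/
abbrev Idx (n : ℕ) : Type := Set.Icc 1 n × ZMod n

/-- The complementary pair `(n - ℓ, s + ℓ)` of a pair `(ℓ, s)` with `ℓ < n`; pairs with `ℓ = n`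
have no complement and are left fixed. -/
def Idx.compl {n : ℕ} (i : Idx n) : Idx n :=
  if h : (i.1 : ℕ) < n then (⟨n - i.1, by have := i.1.2; simp at this ⊢; omega⟩, i.2 + (i.1 : ℕ))
  else i

section Simple

variable {𝕜 : Type u} [Field 𝕜] {n : ℕ} {q : 𝕜}

/-- `α_i(ℓ) = (q ^ i - 1) (1 - q ^ (i - ℓ)) / (q - 1)`. -/
def alpha (q : 𝕜) (ℓ i : ℕ) : 𝕜 :=
  (q ^ i - 1) * (1 - q ^ ((i : ℤ) - (ℓ : ℤ))) / (q - 1)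

/-- The vector `v_j` of `𝕜 ^ ℓ` for `1 ≤ j ≤ ℓ`, and `0` for all other `j`. -/
def vec (𝕜 : Type u) [Field 𝕜] (ℓ j : ℕ) : Fin ℓ → 𝕜 :=
  fun t => if (t : ℕ) + 1 = j then 1 else 0

/-- The endomorphism of `𝕜 ^ ℓ` with prescribed values on `v_1, …, v_ℓ`. -/
def ofValues (ℓ : ℕ) (f : ℕ → Fin ℓ → 𝕜) : Module.End 𝕜 (Fin ℓ → 𝕜) :=
  (Pi.basisFun 𝕜 (Fin ℓ)).constr 𝕜 fun t => f (t + 1)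

/-- The action of the generators on `V(ℓ, s)`: `a v_j = v_{j+1}`, `b v_j = q ^ (s + j - 1) v_j`,
`c v_j = q ^ (j - (s + ℓ)) v_j`, `d v_j = α_{j-1}(ℓ) v_{j-1}`, with `v_0 = v_{ℓ+1} = 0`. -/
def simpleGen (q : 𝕜) (ℓ s : ℕ) : Gen → Module.End 𝕜 (Fin ℓ → 𝕜)
  | .a => ofValues ℓ fun j => vec 𝕜 ℓ (j + 1)
  | .b => ofValues ℓ fun j => q ^ ((s : ℤ) + j - 1) • vec 𝕜 ℓ j
  | .c => ofValues ℓ fun j => q ^ ((j : ℤ) - (s + ℓ)) • vec 𝕜 ℓ j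
  | .d => ofValues ℓ fun j => alpha q ℓ (j - 1) • vec 𝕜 ℓ (j - 1)

theorem basisFun_eq_vec (ℓ : ℕ) (t : Fin ℓ) : Pi.basisFun 𝕜 (Fin ℓ) t = vec 𝕜 ℓ (t + 1) := by
  ext x
  simp [vec, Pi.single_apply, Fin.ext_iff]

theorem ofValues_vec (ℓ : ℕ) (f : ℕ → Fin ℓ → 𝕜) (j : ℕ) (h1 : 1 ≤ j) (h2 : j ≤ ℓ) :
    ofValues ℓ f (vec 𝕜 ℓ j) = f j := by
  obtain ⟨t, rfl⟩ : ∃ t : Fin ℓ, j = t + 1 := ⟨⟨j - 1, by omega⟩, by simp; omega⟩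
  rw [← basisFun_eq_vec, ofValues, Module.Basis.constr_basis]

theorem vec_zero (ℓ : ℕ) : vec 𝕜 ℓ 0 = 0 := by
  ext x; simp [vec]

theorem vec_of_lt (ℓ j : ℕ) (h : ℓ < j) : vec 𝕜 ℓ j = 0 := by
  ext x; have := x.2; simp [vec]; omega

theorem end_ext_vec {ℓ : ℕ} {f g : Module.End 𝕜 (Fin ℓ → 𝕜)}
    (h : ∀ j, 1 ≤ j → j ≤ ℓ → f (vec 𝕜 ℓ j) = g (vec 𝕜 ℓ j)) : f = g := by
  refine (Pi.basisFun 𝕜 (Fin ℓ)).ext fun t => ?_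
  rw [basisFun_eq_vec]
  exact h _ (by omega) t.2

theorem simpleGen_a (ℓ s j : ℕ) (h : 1 ≤ j) :
    simpleGen q ℓ s .a (vec 𝕜 ℓ j) = vec 𝕜 ℓ (j + 1) := by
  rcases Nat.lt_or_ge ℓ j with hlt | hle
  · rw [vec_of_lt _ _ hlt, vec_of_lt _ _ (by omega), map_zero]
  · rw [simpleGen, ofValues_vec _ _ j h hle]

theorem simpleGen_b (ℓ s j : ℕ) :
    simpleGen q ℓ s .b (vec 𝕜 ℓ j) = q ^ ((s : ℤ) + j - 1) • vec 𝕜 ℓ j := by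
  rcases Nat.lt_or_ge ℓ j with hlt | hle
  · rw [vec_of_lt _ _ hlt, map_zero, smul_zero]
  rcases Nat.eq_zero_or_pos j with rfl | h
  · rw [vec_zero, map_zero, smul_zero]
  · rw [simpleGen, ofValues_vec _ _ j h hle]

theorem simpleGen_c (ℓ s j : ℕ) :
    simpleGen q ℓ s .c (vec 𝕜 ℓ j) = q ^ ((j : ℤ) - (s + ℓ)) • vec 𝕜 ℓ j := by
  rcases Nat.lt_or_ge ℓ j with hlt | hle
  · rw [vec_of_lt _ _ hlt, map_zero, smul_zero]
  rcases Nat.eq_zero_or_pos j with rfl | h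
  · rw [vec_zero, map_zero, smul_zero]
  · rw [simpleGen, ofValues_vec _ _ j h hle]

theorem simpleGen_d (ℓ s j : ℕ) (hle : j ≤ ℓ) :
    simpleGen q ℓ s .d (vec 𝕜 ℓ j) = alpha q ℓ (j - 1) • vec 𝕜 ℓ (j - 1) := by
  rcases Nat.eq_zero_or_pos j with rfl | h
  · simp [vec_zero]
  · rw [simpleGen, ofValues_vec _ _ j h hle]

theorem satisfies_simpleGen (hn : 2 ≤ n) (hq : IsPrimitiveRoot q n) (ℓ s : ℕ) (hl : ℓ ≤ n) :
    Satisfies n q (simpleGen q ℓ s) := by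
  have hq0 : q ≠ 0 := hq.ne_zero (by omega)
  have hq1 : q - 1 ≠ 0 := sub_ne_zero.2 (hq.ne_one (by omega))
  have hpow : ∀ z : ℤ, (q ^ z) ^ n = 1 := fun z => by
    rw [← zpow_natCast, ← zpow_mul, mul_comm, zpow_mul, zpow_natCast, hq.pow_eq_one, one_zpow]
  have hsucc : ∀ z : ℤ, q ^ (z + 1) = q * q ^ z := fun z => by rw [zpow_add_one₀ hq0, mul_comm]
  constructor
  · refine end_ext_vec fun j h1 h2 => ?_
    simp only [Module.End.mul_apply, LinearMap.smul_apply, simpleGen_a ℓ s j h1, simpleGen_b,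
      map_smul, smul_smul]
    congr 1
    rw [← hsucc]; congr 1; push_cast; ring
  · refine end_ext_vec fun j h1 h2 => ?_
    simp only [Module.End.mul_apply, LinearMap.smul_apply, simpleGen_d ℓ s j h2, simpleGen_b,
      map_smul, smul_smul]
    congr 1
    rw [mul_comm (alpha _ _ _), ← mul_assoc, ← hsucc]; congr 2; push_cast [h1]; ring
  · refine end_ext_vec fun j h1 h2 => ?_
    simp only [Module.End.mul_apply, simpleGen_b, simpleGen_c, map_smul, smul_smul]
    rw [mul_comm]
  · refine end_ext_vec fun j h1 h2 => ?_
    simp only [Module.End.mul_apply, LinearMap.smul_apply, simpleGen_a ℓ s j h1, simpleGen_c,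
      map_smul, smul_smul]
    congr 1
    rw [← hsucc]; congr 1; push_cast; ring
  · refine end_ext_vec fun j h1 h2 => ?_
    simp only [Module.End.mul_apply, LinearMap.smul_apply, simpleGen_d ℓ s j h2, simpleGen_c,
      map_smul, smul_smul]
    congr 1
    rw [mul_comm (alpha _ _ _), ← mul_assoc, ← hsucc]; congr 2; push_cast [h1]; ring
  · refine end_ext_vec fun j h1 h2 => ?_
    have hda : simpleGen q ℓ s .d (vec 𝕜 ℓ (j + 1)) = alpha q ℓ j • vec 𝕜 ℓ j := by
      rcases h2.lt_or_eq with hlt | heq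
      · exact simpleGen_d ℓ s (j + 1) hlt
      · rw [vec_of_lt _ _ (by omega), map_zero, heq]; simp [alpha]
    have had : simpleGen q ℓ s .a (alpha q ℓ (j - 1) • vec 𝕜 ℓ (j - 1)) =
        alpha q ℓ (j - 1) • vec 𝕜 ℓ j := by
      rw [map_smul]
      rcases h1.lt_or_eq with hlt | heq
      · rw [simpleGen_a ℓ s (j - 1) (by omega)]; congr 2; omega
      · rw [← heq]; simp [alpha]
    simp only [Module.End.mul_apply, LinearMap.smul_apply, LinearMap.sub_apply, simpleGen_a ℓ s j h1,
      hda, simpleGen_d ℓ s j h2, had, simpleGen_b, simpleGen_c, map_smul, smul_smul,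
      Module.End.one_apply]
    rw [← sub_smul]
    nth_rewrite 2 [← one_smul 𝕜 (vec 𝕜 ℓ j)]
    rw [← sub_smul]
    congr 1
    obtain ⟨j, rfl⟩ : ∃ j', j = j' + 1 := ⟨j - 1, by omega⟩
    rw [← zpow_add₀ hq0]
    have e1 : q ^ (((j + 1 : ℕ) : ℤ) - (ℓ : ℤ)) = q * (q ^ j * q ^ (-(ℓ : ℤ))) := by
      rw [← zpow_natCast q j, ← zpow_add₀ hq0, ← hsucc]; congr 1; push_cast; ring
    have e2 : q ^ ((j : ℤ) - (ℓ : ℤ)) = q ^ j * q ^ (-(ℓ : ℤ)) := by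
      rw [← zpow_natCast q j, ← zpow_add₀ hq0]; congr 1
    have e3 : q ^ (((j + 1 : ℕ) : ℤ) - ((s : ℤ) + (ℓ : ℤ)) +
        ((s : ℤ) + ((j + 1 : ℕ) : ℤ) - 1)) =
        q * (q ^ j * q ^ j * q ^ (-(ℓ : ℤ))) := by
      rw [← zpow_natCast q j, ← zpow_add₀ hq0, ← zpow_add₀ hq0, ← hsucc]; congr 1; push_cast; ring
    rw [e3]
    simp only [alpha, Nat.add_sub_cancel, e1, e2]
    field_simp
    ring
  · have key : ∀ m j, 1 ≤ j → (simpleGen q ℓ s .a ^ m) (vec 𝕜 ℓ j) = vec 𝕜 ℓ (j + m) := by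
      intro m
      induction m with
      | zero => intro j _; simp
      | succ m ih =>
        intro j h
        rw [pow_succ', Module.End.mul_apply, ih j h, simpleGen_a ℓ s _ (by omega)]; rfl
    refine end_ext_vec fun j h1 h2 => ?_
    rw [key n j h1, vec_of_lt _ _ (by omega)]; simp
  · have key : ∀ m j, j ≤ ℓ → j ≤ m → (simpleGen q ℓ s .d ^ m) (vec 𝕜 ℓ j) = 0 := by
      intro m
      induction m with
      | zero => intro j _ hm; rw [Nat.le_zero.1 hm, vec_zero, map_zero]
      | succ m ih =>
        intro j h hm
        rw [pow_succ, Module.End.mul_apply, simpleGen_d ℓ s j h, map_smul,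
          ih (j - 1) (by omega) (by omega), smul_zero]
    refine end_ext_vec fun j h1 h2 => ?_
    rw [key n j h2 (by omega)]; simp
  · have key : ∀ m j, (simpleGen q ℓ s .b ^ m) (vec 𝕜 ℓ j) =
        (q ^ ((s : ℤ) + j - 1)) ^ m • vec 𝕜 ℓ j := by
      intro m j
      induction m with
      | zero => simp
      | succ m ih =>
        rw [pow_succ', Module.End.mul_apply, ih, map_smul, simpleGen_b, smul_smul, pow_succ]
    refine end_ext_vec fun j h1 h2 => ?_
    rw [key, hpow]; simp
  · have key : ∀ m j, (simpleGen q ℓ s .c ^ m) (vec 𝕜 ℓ j) =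
        (q ^ ((j : ℤ) - (s + ℓ))) ^ m • vec 𝕜 ℓ j := by
      intro m j
      induction m with
      | zero => simp
      | succ m ih =>
        rw [pow_succ', Module.End.mul_apply, ih, map_smul, simpleGen_c, smul_smul, pow_succ]
    refine end_ext_vec fun j h1 h2 => ?_
    rw [key, hpow]; simp

/-- The simple module `V(ℓ, s)`. -/
def simple (hn : 2 ≤ n) (hq : IsPrimitiveRoot q n) (i : Idx n) : DMod.{u, u} 𝕜 n q :=
  DMod.ofRep (D.lift (simpleGen q i.1 i.2.val) (satisfies_simpleGen hn hq i.1 i.2.val i.1.2.2))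

end Simple

/-! ## Multiplicities -/

section Multiplicities

variable {𝕜 : Type u} [Field 𝕜] {n : ℕ} {q : 𝕜}

/-- `s` and `p` are the multiplicities of the modules `S i` and `P i` in `M`: `M` is isomorphic to
`⨁ i, S i ^ (s i) ⊕ ⨁ i, P i ^ (p i)`. For `i = (n, r)` the module `S i` is also projective, and
by convention it is counted in `s i` only. -/
def AreMultiplicities (S : Idx n → DMod.{u, u} 𝕜 n q) (P : Idx n → DMod.{u, w} 𝕜 n q)
    (M : DMod.{u, v} 𝕜 n q) (s p : Idx n → ℕ) : Prop :=
  (∀ i : Idx n, (i.1 : ℕ) = n → p i = 0) ∧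
    Nonempty (M ≃ₗ[D 𝕜 n q] ((i : Idx n) → Fin (s i) → S i) × ((i : Idx n) → Fin (p i) → P i))

end Multiplicities

end TaftDouble

end

set_option linter.unusedSectionVars false

noncomputable section

namespace TaftDouble

/-! ### Generators suffice to test submodules and linear maps -/

section Generators

variable {𝕜 : Type u} [Field 𝕜] {n : ℕ} {q : 𝕜}

/-! Everything is measured by two functors on D_n-modules X. For a pair (ℓ, s) consider the vectors
with b = q^s and c = q^(1-s-ℓ). Those killed by d and a^ℓ (`primSpace`) are the possible images of
v_1 under maps V(ℓ,s) → X; those killed by (ad)² (`genSpace`) are the possible images of a generator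
under maps P(ℓ,s) → X. The square appears for the following reason. On such weight vectors a^n d^n =
0 acts as a product of n linear polynomials in ad, and at most two of them vanish at 0. Hence the
generalized 0-eigenspace of ad is the kernel of (ad)², and a Bezout identity yields an element of
D_n projecting onto it (`exists_genProj`). For ℓ < n an explicit 2n-dimensional module with basis
x_t, y_t represents `genSpace` (`exists_hom_qmod`); for ℓ = n the module V(n,s) does. The projecting
element makes the representing module a summand of D_n, so it is projective, and it is a projective
cover of V(ℓ,s).

A two-dimensional simple module is some V(2,r) (`exists_equiv_simple`). Tensoring V(ℓ,s) with V(2,r)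
gives a module V(2,·) for ℓ = 1 and V(ℓ+1,·) ⊕ V(ℓ-1,·) for 1 < ℓ < n. The summands V(n,s) and
P(ℓ,s) are projective and stay so after tensoring, because D_n ⊗ V is free; finite-dimensional
projectives are sums of projective covers (`isSum_of_projective`). Induction on k gives the
decomposition.

The multiplicities come from Hom dimensions, found in coordinates. Hom(V(i),V(j)), Hom(P(i),V(j))
and, for P(j) with first index below n, Hom(V(i),P(j)) have dimension 1 if i = j and 0 otherwise;
Hom(P(i),P(j)) has dimension 2 if i is j or its complement, and 0 otherwise. So Hom(V(i),M) has
dimension s_i + p_i and, for ℓ < n, Hom(P(i),M) has dimension s_i + 2p_i + 2p_i'. These numbers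
determine s and p, and the formula for End(M) is the identity s(s+p) + p(s+2p+2p') = p² + (s+p)² +
2pp', summed over i. -/

theorem adjoin_range_of : Algebra.adjoin 𝕜 (Set.range (D.of 𝕜 n q)) = ⊤ := by
  have h := congrArg (Subalgebra.map (RingQuot.mkAlgHom 𝕜 (Rel 𝕜 n q)))
    (FreeAlgebra.adjoin_range_ι (R := 𝕜) (X := Gen))
  rw [AlgHom.map_adjoin, Algebra.map_top, ← Set.range_comp] at h
  have h2 : (RingQuot.mkAlgHom 𝕜 (Rel 𝕜 n q)).range = ⊤ :=
    AlgHom.range_eq_top _ |>.2 (RingQuot.mkAlgHom_surjective 𝕜 _)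
  rw [h2] at h
  exact h

/-- A subset of `D_n` that contains `1` and is closed under linear combinations and left
multiplication by generators is everything. -/
theorem D.mem_of_closed (W : Submodule 𝕜 (D 𝕜 n q)) (h1 : 1 ∈ W)
    (h : ∀ g, ∀ x ∈ W, D.of 𝕜 n q g * x ∈ W) (x : D 𝕜 n q) : x ∈ W := by
  have key : ∀ y ∈ Algebra.adjoin 𝕜 (Set.range (D.of 𝕜 n q)), ∀ x ∈ W, y * x ∈ W := by
    intro y hy
    induction hy using Algebra.adjoin_induction with
    | mem y hy => obtain ⟨g, rfl⟩ := hy; exact h g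
    | algebraMap r => intro x hx; rw [← Algebra.smul_def]; exact W.smul_mem r hx
    | add y z _ _ h1 h2 => intro x hx; rw [add_mul]; exact W.add_mem (h1 x hx) (h2 x hx)
    | mul y z _ _ h1 h2 => intro x hx; rw [mul_assoc]; exact h1 _ (h2 x hx)
  have := key x (by rw [adjoin_range_of]; trivial) 1 h1
  rwa [mul_one] at this

variable {X Y : Type*} [AddCommGroup X] [Module 𝕜 X] [Module (D 𝕜 n q) X]
  [IsScalarTower 𝕜 (D 𝕜 n q) X] [AddCommGroup Y] [Module 𝕜 Y] [Module (D 𝕜 n q) Y]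
  [IsScalarTower 𝕜 (D 𝕜 n q) Y]

/-- A `𝕜`-linear map that commutes with the generators is `D_n`-linear. -/
def homOfComm (f : X →ₗ[𝕜] Y) (h : ∀ g x, f (D.of 𝕜 n q g • x) = D.of 𝕜 n q g • f x) :
    X →ₗ[D 𝕜 n q] Y where
  toFun := f
  map_add' := map_add f
  map_smul' := by
    intro y x
    have := D.mem_of_closed (n := n) (q := q)
      { carrier := {y | ∀ x, f (y • x) = y • f x}
        add_mem' := fun {a b} ha hb x => by simp only [add_smul, map_add, ha x, hb x]
        zero_mem' := fun x => by simp
        smul_mem' := fun r y hy x => by simp only [smul_assoc, map_smul, hy x] }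
      (fun x => by simp) (fun g y hy x => by simp only [mul_smul, h, hy x]) y
    exact this x

@[simp] theorem homOfComm_apply (f : X →ₗ[𝕜] Y)
    (h : ∀ g x, f (D.of 𝕜 n q g • x) = D.of 𝕜 n q g • f x) (x : X) : homOfComm f h x = f x := rfl

end Generators

/-! ### Weight vectors and the commutation of d with powers of a -/

section Weights

variable {𝕜 : Type u} [Field 𝕜] {n : ℕ} {q : 𝕜}

local notation "𝐚" => D.of 𝕜 n q Gen.a
local notation "𝐛" => D.of 𝕜 n q Gen.b
local notation "𝐜" => D.of 𝕜 n q Gen.c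
local notation "𝐝" => D.of 𝕜 n q Gen.d

variable {X Y : Type*} [AddCommGroup X] [Module 𝕜 X] [Module (D 𝕜 n q) X]
  [IsScalarTower 𝕜 (D 𝕜 n q) X] [AddCommGroup Y] [Module 𝕜 Y] [Module (D 𝕜 n q) Y]
  [IsScalarTower 𝕜 (D 𝕜 n q) Y]

theorem ba_smul (x : X) : 𝐛 • 𝐚 • x = q • 𝐚 • 𝐛 • x := by
  rw [← mul_smul, D.satisfies_of.ba, smul_assoc, mul_smul]

theorem db_smul (x : X) : 𝐝 • 𝐛 • x = q • 𝐛 • 𝐝 • x := by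
  rw [← mul_smul, D.satisfies_of.db, smul_assoc, mul_smul]

theorem bc_smul (x : X) : 𝐛 • 𝐜 • x = 𝐜 • 𝐛 • x := by
  rw [← mul_smul, D.satisfies_of.bc, mul_smul]

theorem ca_smul (x : X) : 𝐜 • 𝐚 • x = q • 𝐚 • 𝐜 • x := by
  rw [← mul_smul, D.satisfies_of.ca, smul_assoc, mul_smul]

theorem dc_smul (x : X) : 𝐝 • 𝐜 • x = q • 𝐜 • 𝐝 • x := by
  rw [← mul_smul, D.satisfies_of.dc, smul_assoc, mul_smul]

theorem da_smul (x : X) : 𝐝 • 𝐚 • x = q • 𝐚 • 𝐝 • x + (x - 𝐛 • 𝐜 • x) := by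
  have h : 𝐝 * 𝐚 = q • (𝐚 * 𝐝) + (1 - 𝐛 * 𝐜) := by
    rw [← D.satisfies_of.da]; abel
  rw [← mul_smul, h, add_smul, smul_assoc, mul_smul, sub_smul, one_smul, mul_smul]

/-- `x` is a weight vector: `b x = q ^ s x` and `c x = q ^ t x`. -/
def IsWt (n : ℕ) (q : 𝕜) [Module (D 𝕜 n q) X] (s t : ℤ) (x : X) : Prop :=
  D.of 𝕜 n q .b • x = q ^ s • x ∧ D.of 𝕜 n q .c • x = q ^ t • x

theorem IsWt.zero (s t : ℤ) : IsWt n q s t (0 : X) := ⟨by simp, by simp⟩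

theorem IsWt.add {s t : ℤ} {x y : X} (hx : IsWt n q s t x) (hy : IsWt n q s t y) :
    IsWt n q s t (x + y) :=
  ⟨by rw [smul_add, smul_add, hx.1, hy.1], by rw [smul_add, smul_add, hx.2, hy.2]⟩

theorem IsWt.smul {s t : ℤ} {x : X} (r : 𝕜) (hx : IsWt n q s t x) : IsWt n q s t (r • x) :=
  ⟨by rw [smul_comm, hx.1, smul_comm], by rw [smul_comm, hx.2, smul_comm]⟩

theorem IsWt.map {s t : ℤ} {x : X} (f : X →ₗ[D 𝕜 n q] Y) (hx : IsWt n q s t x) :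
    IsWt n q s t (f x) := by
  constructor
  · rw [← map_smul, hx.1, LinearMap.map_smul_of_tower]
  · rw [← map_smul, hx.2, LinearMap.map_smul_of_tower]

theorem IsWt.a (hq0 : q ≠ 0) {s t : ℤ} {x : X} (hx : IsWt n q s t x) :
    IsWt n q (s + 1) (t + 1) (𝐚 • x) := by
  constructor
  · rw [ba_smul, hx.1, smul_comm _ (q ^ s), smul_smul, zpow_add_one₀ hq0, mul_comm]
  · rw [ca_smul, hx.2, smul_comm _ (q ^ t), smul_smul, zpow_add_one₀ hq0, mul_comm]

theorem IsWt.d (hq0 : q ≠ 0) {s t : ℤ} {x : X} (hx : IsWt n q s t x) :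
    IsWt n q (s - 1) (t - 1) (𝐝 • x) := by
  constructor
  · have := db_smul (n := n) (q := q) x
    rw [hx.1, smul_comm, eq_comm, ← eq_inv_smul_iff₀ hq0, smul_smul q⁻¹] at this
    rw [this, zpow_sub_one₀ hq0, mul_comm]
  · have := dc_smul (n := n) (q := q) x
    rw [hx.2, smul_comm, eq_comm, ← eq_inv_smul_iff₀ hq0, smul_smul q⁻¹] at this
    rw [this, zpow_sub_one₀ hq0, mul_comm]

theorem IsWt.a_pow (hq0 : q ≠ 0) {s t : ℤ} {x : X} (hx : IsWt n q s t x) (m : ℕ) :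
    IsWt n q (s + m) (t + m) (𝐚 ^ m • x) := by
  induction m with
  | zero => simpa using hx
  | succ m ih =>
    rw [pow_succ', mul_smul]
    convert ih.a hq0 using 1 <;> push_cast <;> ring

theorem IsWt.d_pow (hq0 : q ≠ 0) {s t : ℤ} {x : X} (hx : IsWt n q s t x) (m : ℕ) :
    IsWt n q (s - m) (t - m) (𝐝 ^ m • x) := by
  induction m with
  | zero => simpa using hx
  | succ m ih =>
    rw [pow_succ', mul_smul]
    convert ih.d hq0 using 1 <;> push_cast <;> ring

theorem IsWt.z (hq0 : q ≠ 0) {s t : ℤ} {x : X} (hx : IsWt n q s t x) :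
    IsWt n q s t (𝐚 • 𝐝 • x) := by
  convert (hx.d hq0).a hq0 using 1 <;> ring

theorem IsWt.bc (hq0 : q ≠ 0) {s t : ℤ} {x : X} (hx : IsWt n q s t x) :
    𝐛 • 𝐜 • x = q ^ (s + t) • x := by
  rw [hx.2, smul_comm, hx.1, smul_smul, zpow_add₀ hq0, mul_comm]

theorem IsWt.da (hq0 : q ≠ 0) {s t : ℤ} {x : X} (hx : IsWt n q s t x) :
    𝐝 • 𝐚 • x = q • 𝐚 • 𝐝 • x + (1 - q ^ (s + t)) • x := by
  rw [da_smul, hx.bc hq0, sub_smul, one_smul]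

theorem a_pow_smul (x : X) : 𝐚 ^ n • x = 0 := by rw [D.satisfies_of.a_pow, zero_smul]

theorem d_pow_smul (x : X) : 𝐝 ^ n • x = 0 := by rw [D.satisfies_of.d_pow, zero_smul]

theorem a_pow_smul_of_le {m : ℕ} (h : n ≤ m) (x : X) : 𝐚 ^ m • x = 0 := by
  rw [pow_eq_zero_of_le h D.satisfies_of.a_pow, zero_smul]

/-- The extension of `alpha` to integer arguments. -/
def al (q : 𝕜) (l t : ℤ) : 𝕜 := (q ^ t - 1) * (1 - q ^ (t - l)) / (q - 1)

theorem alpha_eq_al (l t : ℕ) : alpha q l t = al q l t := by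
  simp [alpha, al]

theorem al_zero (l : ℤ) : al q l 0 = 0 := by simp [al]

theorem al_self (l : ℤ) : al q l l = 0 := by simp [al]

/-- The recursion produced by commuting d past one more factor a: if bc = q^(1-l) on x, then bc =
q^(2t+1-l) on a^t x, and `IsWt.da` contributes one minus this scalar. -/
theorem al_succ (hq0 : q ≠ 0) (hq1 : q ≠ 1) (l t : ℤ) :
    al q l (t + 1) = q * al q l t + (1 - q ^ (2 * t + 1 - l)) := by
  have h1 : q - 1 ≠ 0 := sub_ne_zero.2 hq1
  have e1 : q ^ (t + 1) = q * q ^ t := by rw [zpow_add_one₀ hq0, mul_comm]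
  have e2 : q ^ (t + 1 - l) = q * (q ^ t * q ^ (-l)) := by
    rw [← zpow_add₀ hq0, ← zpow_one_add₀ hq0]; congr 1; ring
  have e3 : q ^ (t - l) = q ^ t * q ^ (-l) := by
    rw [← zpow_add₀ hq0]; congr 1
  have e4 : q ^ (2 * t + 1 - l) = q * (q ^ t * q ^ t * q ^ (-l)) := by
    rw [← zpow_add₀ hq0, ← zpow_add₀ hq0, ← zpow_one_add₀ hq0]; congr 1; ring
  simp only [al, e1, e2, e3, e4]
  field_simp
  ring

theorem zpow_eq_zpow_iff (hn : 2 ≤ n) (hq : IsPrimitiveRoot q n) (s t : ℤ) :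
    q ^ s = q ^ t ↔ (s : ZMod n) = (t : ZMod n) := by
  have hq0 : q ≠ 0 := hq.ne_zero (by omega)
  rw [← div_eq_one_iff_eq (zpow_ne_zero _ hq0), ← zpow_sub₀ hq0, hq.zpow_eq_one_iff_dvd,
    ← ZMod.intCast_zmod_eq_zero_iff_dvd, Int.cast_sub, sub_eq_zero]

/-- These zeros are the places where strings of weight vectors break. They control simplicity, the
double root in `exists_adPoly_dvd` and all Hom dimensions. -/
theorem al_eq_zero_iff (hn : 2 ≤ n) (hq : IsPrimitiveRoot q n) (l t : ℤ) :
    al q l t = 0 ↔ (t : ZMod n) = 0 ∨ (t : ZMod n) = l := by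
  have hq1 : q - 1 ≠ 0 := sub_ne_zero.2 (hq.ne_one (by omega))
  rw [al, div_eq_zero_iff, or_iff_left hq1, mul_eq_zero, sub_eq_zero, sub_eq_zero,
    ← zpow_zero q, zpow_eq_zpow_iff hn hq, zpow_eq_zpow_iff hn hq]
  push_cast
  rw [eq_comm (a := (0 : ZMod n)), sub_eq_zero]

/-- Each passage of d over a factor a multiplies by q and adds a scalar, and `al_succ` sums these
scalars. When d x = 0 this is the action of d on V(l,s). -/
theorem IsWt.d_a_pow (hq0 : q ≠ 0) (hq1 : q ≠ 1) {s t l : ℤ} (hl : s + t = 1 - l) {x : X}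
    (hx : IsWt n q s t x) (m : ℕ) :
    𝐝 • 𝐚 ^ (m + 1) • x = al q l (m + 1) • 𝐚 ^ m • x + q ^ (m + 1) • 𝐚 ^ (m + 1) • 𝐝 • x := by
  induction m with
  | zero =>
    have h := al_succ hq0 hq1 l 0
    rw [al_zero] at h
    simp only [zero_add, pow_one, pow_zero, one_smul, Nat.cast_zero] at h ⊢
    rw [h, hx.da hq0, add_comm, hl]
    congr 2; ring_nf
  | succ m ih =>
    rw [pow_succ' _ (m + 1), mul_smul, (hx.a_pow hq0 (m + 1)).da hq0, ih]
    have h := al_succ hq0 hq1 l (m + 1)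
    have e : s + ((m + 1 : ℕ) : ℤ) + (t + ((m + 1 : ℕ) : ℤ)) = 2 * ((m : ℤ) + 1) + 1 - l := by
      push_cast; linarith
    push_cast at e ⊢
    rw [h, e, smul_add, smul_add, smul_comm 𝐚, ← mul_smul 𝐚,
      ← pow_succ', smul_comm 𝐚, ← mul_smul 𝐚, mul_smul, ← mul_smul 𝐚, ← pow_succ', pow_succ' q (m + 1)]
    generalize 𝐚 ^ (m + 1) • x = u
    generalize 𝐚 ^ (m + 1 + 1) • 𝐝 • x = w
    module

/-- The downward counterpart of `IsWt.d_a_pow`: up to a power of q, the vector d^m x sees the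
operator ad shifted by the scalar `al q l (-m)`. -/
theorem IsWt.z_d_pow (hq0 : q ≠ 0) (hq1 : q ≠ 1) {s t l : ℤ} (hl : s + t = 1 - l) {x : X}
    (hx : IsWt n q s t x) (m : ℕ) :
    𝐚 • 𝐝 • 𝐝 ^ m • x = (q ^ m)⁻¹ • 𝐝 ^ m • 𝐚 • 𝐝 • x + al q l (-m) • 𝐝 ^ m • x := by
  induction m with
  | zero => simp [al_zero]
  | succ m ih =>
    have h1 := (hx.d_pow hq0 (m + 1)).da hq0
    have h2 := ((hx.d_pow hq0 m).d hq0).da hq0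
    -- The recursion is run backwards, from -m-1 to -m, which is why the proof ends with a division
    -- by q.
    have h := al_succ hq0 hq1 l (-m - 1)
    rw [sub_add_cancel] at h
    have e : s - m - 1 + (t - m - 1) = 2 * (-(m : ℤ) - 1) + 1 - l := by linarith
    rw [e, ih, smul_add, smul_comm 𝐝, ← mul_smul 𝐝, ← pow_succ', smul_comm 𝐝,
      ← mul_smul 𝐝, ← pow_succ', h] at h2
    have e2 : -((m + 1 : ℕ) : ℤ) = -(m : ℤ) - 1 := by push_cast; ring
    rw [e2]
    have h3 : q • 𝐚 • 𝐝 • 𝐝 ^ (m + 1) • x =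
        (q ^ m)⁻¹ • 𝐝 ^ (m + 1) • 𝐚 • 𝐝 • x + (q * al q l (-m - 1)) • 𝐝 ^ (m + 1) • x := by
      rw [← sub_eq_iff_eq_add] at h2
      rw [← h2]
      generalize 𝐝 ^ (m + 1) • x = u
      generalize 𝐝 ^ (m + 1) • 𝐚 • 𝐝 • x = w
      module
    rw [← eq_inv_smul_iff₀ hq0] at h3
    rw [h3, smul_add, smul_smul q⁻¹, smul_smul q⁻¹, pow_succ q, mul_comm (q ^ m), mul_inv,
      inv_mul_cancel_left₀ hq0]

end Weights

/-! ### The spaces representing Hom from V and from P, and the projecting element -/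

section GenSpace

open Polynomial

variable {𝕜 : Type u} [Field 𝕜] {n : ℕ} {q : 𝕜}

local notation "𝐚" => D.of 𝕜 n q Gen.a
local notation "𝐛" => D.of 𝕜 n q Gen.b
local notation "𝐜" => D.of 𝕜 n q Gen.c
local notation "𝐝" => D.of 𝕜 n q Gen.d
local notation "𝐗" => (Polynomial.X : Polynomial 𝕜)

variable {X Y : Type*} [AddCommGroup X] [Module 𝕜 X] [Module (D 𝕜 n q) X]
  [IsScalarTower 𝕜 (D 𝕜 n q) X] [AddCommGroup Y] [Module 𝕜 Y] [Module (D 𝕜 n q) Y]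
  [IsScalarTower 𝕜 (D 𝕜 n q) Y]

variable (n q X) in
/-- The vectors of the weight of the generator of `V(l, s)` that are killed by `(ad) ^ 2`. -/
def genSpace (l s : ℕ) : Submodule 𝕜 X where
  carrier := {x | IsWt n q s (1 - s - l) x ∧ 𝐚 • 𝐝 • 𝐚 • 𝐝 • x = 0}
  add_mem' hx hy := ⟨hx.1.add hy.1, by simp only [smul_add, hx.2, hy.2, add_zero]⟩
  zero_mem' := ⟨IsWt.zero _ _, by simp⟩
  smul_mem' r x hx := ⟨hx.1.smul r, by
    rw [smul_comm 𝐝 r, smul_comm 𝐚 r, smul_comm 𝐝 r, smul_comm 𝐚 r, hx.2, smul_zero]⟩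

variable (n q X) in
/-- The highest weight vectors of the weight of `V(l, s)` that are killed by `a ^ l`. -/
def primSpace (l s : ℕ) : Submodule 𝕜 X where
  carrier := {x | IsWt n q s (1 - s - l) x ∧ 𝐝 • x = 0 ∧ 𝐚 ^ l • x = 0}
  add_mem' hx hy := ⟨hx.1.add hy.1, by rw [smul_add, hx.2.1, hy.2.1, add_zero],
    by rw [smul_add, hx.2.2, hy.2.2, add_zero]⟩
  zero_mem' := ⟨IsWt.zero _ _, by simp, by simp⟩
  smul_mem' r x hx := ⟨hx.1.smul r, by rw [smul_comm, hx.2.1, smul_zero],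
    by rw [smul_comm, hx.2.2, smul_zero]⟩

theorem primSpace_le_genSpace (l s : ℕ) : primSpace n q X l s ≤ genSpace n q X l s :=
  fun x hx => ⟨hx.1, by simp [hx.2.1]⟩

theorem map_mem_genSpace (f : X →ₗ[D 𝕜 n q] Y) {l s : ℕ} {x : X} (hx : x ∈ genSpace n q X l s) :
    f x ∈ genSpace n q Y l s :=
  ⟨hx.1.map f, by simp only [← map_smul, hx.2, map_zero]⟩

theorem map_mem_primSpace (f : X →ₗ[D 𝕜 n q] Y) {l s : ℕ} {x : X}
    (hx : x ∈ primSpace n q X l s) : f x ∈ primSpace n q Y l s :=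
  ⟨hx.1.map f, by rw [← map_smul, hx.2.1, map_zero], by rw [← map_smul, hx.2.2, map_zero]⟩

theorem z_mem_genSpace (hq0 : q ≠ 0) {l s : ℕ} {x : X} (hx : x ∈ genSpace n q X l s) :
    𝐚 • 𝐝 • x ∈ genSpace n q X l s :=
  ⟨hx.1.z hq0, by rw [hx.2, smul_zero, smul_zero]⟩

/-- Going down from the weight of v_1, only the steps m = 0 and m = n - l are degenerate. They
coincide when l = n. -/
theorem cast_sub_eq_zero_or {l m : ℕ} (hl : 1 ≤ l) (hln : l ≤ n) (hm : m < n)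
    (h : ((-(m : ℤ) : ℤ) : ZMod n) = 0 ∨ ((-(m : ℤ) : ℤ) : ZMod n) = ((l : ℤ) : ZMod n)) :
    m = 0 ∨ m = n - l := by
  rcases h with h | h
  · left
    rw [Int.cast_neg, neg_eq_zero, Int.cast_natCast, ZMod.natCast_eq_zero_iff] at h
    exact Nat.eq_zero_of_dvd_of_lt h hm
  · right
    have h2 : ((l + m : ℕ) : ZMod n) = 0 := by
      push_cast at h ⊢
      rw [← h]; ring
    rw [ZMod.natCast_eq_zero_iff] at h2
    obtain ⟨k, hk⟩ := h2
    have : k = 1 := by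
      have h1 : k < 2 := by
        by_contra hk2
        have : n * 2 ≤ n * k := Nat.mul_le_mul_left n (by omega)
        omega
      have : k ≠ 0 := by rintro rfl; omega
      omega
    subst this
    omega

theorem al_neg_ne_zero (hn : 2 ≤ n) (hq : IsPrimitiveRoot q n) {l m : ℕ} (hl : 1 ≤ l)
    (hln : l ≤ n) (hm : m < n) (h0 : m ≠ 0) (h1 : m ≠ n - l) : al q l (-m) ≠ 0 := fun h => by
  rcases cast_sub_eq_zero_or hl hln hm ((al_eq_zero_iff hn hq _ _).1 h) with h | h
  · exact h0 h
  · exact h1 h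

/-- Descending induction from d^n = 0. If d^(m+1) kills `genSpace`, then `IsWt.z_d_pow` expresses
d^m x as a multiple of d^m (ad x), its coefficient being nonzero for n - l < m < n. Since (ad)² x =
0, using this first for ad x and then for x gives d^m x = 0. -/
theorem d_pow_smul_genSpace (hn : 2 ≤ n) (hq : IsPrimitiveRoot q n) {l s : ℕ} (hl : 1 ≤ l)
    (hln : l ≤ n) {x : X} (hx : x ∈ genSpace n q X l s) : 𝐝 ^ (n - l + 1) • x = 0 := by
  have hq0 : q ≠ 0 := hq.ne_zero (by omega)
  have hq1 : q ≠ 1 := hq.ne_one (by omega)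
  have key : ∀ k, k ≤ l - 1 → ∀ x ∈ genSpace n q X l s, 𝐝 ^ (n - k) • x = 0 := by
    intro k
    induction k with
    | zero => intro _ x _; exact d_pow_smul x
    | succ k ih =>
      intro hk
      have ne : al q l (-(n - (k + 1) : ℕ)) ≠ 0 :=
        al_neg_ne_zero hn hq hl hln (by omega) (by omega) (by omega)
      have e : n - k = n - (k + 1) + 1 := by omega
      have step : ∀ x ∈ genSpace n q X l s, 𝐝 ^ (n - (k + 1)) • 𝐚 • 𝐝 • x = 0 →
          𝐝 ^ (n - (k + 1)) • x = 0 := by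
        intro x hx h
        have h1 := hx.1.z_d_pow hq0 hq1 (l := l) (by ring) (n - (k + 1))
        rw [← mul_smul 𝐝, ← pow_succ', ← e, ih (by omega) x hx, smul_zero, h, smul_zero, zero_add,
          eq_comm, smul_eq_zero] at h1
        exact h1.resolve_left ne
      intro x hx
      refine step x hx (step _ (z_mem_genSpace hq0 hx) ?_)
      rw [hx.2, smul_zero]
  have := key (l - 1) le_rfl x hx
  rwa [show n - (l - 1) = n - l + 1 by omega] at this

/-- Induction by `IsWt.z_d_pow`: the scalars met are nonzero while m < n - l, and (ad)² x = 0 leaves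
only two terms. The constants do not depend on x, so the induction hypothesis applies to ad x as
well. -/
theorem exists_a_pow_d_pow (hn : 2 ≤ n) (hq : IsPrimitiveRoot q n) {l s : ℕ} (hl : 1 ≤ l)
    (hln : l < n) (m : ℕ) (hm : m < n - l) : ∃ k k' : 𝕜, k ≠ 0 ∧ ∀ x ∈ genSpace n q X l s,
      𝐚 ^ m • 𝐝 ^ (m + 1) • x = k • 𝐝 • x + k' • 𝐝 • 𝐚 • 𝐝 • x := by
  have hq0 : q ≠ 0 := hq.ne_zero (by omega)
  have hq1 : q ≠ 1 := hq.ne_one (by omega)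
  induction m with
  | zero => exact ⟨1, 0, one_ne_zero, fun x _ => by simp⟩
  | succ m ih =>
    obtain ⟨k, k', hk, h⟩ := ih (by omega)
    have ne : al q l (-(m + 1 : ℕ)) ≠ 0 :=
      al_neg_ne_zero hn hq hl hln.le (by omega) (by omega) (by omega)
    refine ⟨k * al q l (-(m + 1 : ℕ)), k * (q ^ (m + 1))⁻¹ + k' * al q l (-(m + 1 : ℕ)),
      mul_ne_zero hk ne, fun x hx => ?_⟩
    have h1 := hx.1.z_d_pow hq0 hq1 (l := l) (by ring) (m + 1)
    have h2 := h _ hx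
    have h3 := h _ (z_mem_genSpace hq0 hx)
    rw [hx.2, smul_zero, smul_zero, add_zero] at h3
    rw [pow_succ, mul_smul, pow_succ' 𝐝, mul_smul, h1, smul_add, smul_comm _ (q ^ (m + 1))⁻¹,
      smul_comm _ (al q l _), h2, h3]
    generalize 𝐝 • x = u
    generalize 𝐝 • 𝐚 • u = w
    module

/-- The last step down from the generator is a multiple of `d x`. -/
theorem exists_a_pow_d_pow_eq (hn : 2 ≤ n) (hq : IsPrimitiveRoot q n) {l s : ℕ} (hl : 1 ≤ l)
    (hln : l < n) {x : X} (hx : x ∈ genSpace n q X l s) :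
    ∃ k : 𝕜, k ≠ 0 ∧ 𝐚 ^ (n - l - 1) • 𝐝 ^ (n - l) • x = k • 𝐝 • x := by
  have hq0 : q ≠ 0 := hq.ne_zero (by omega)
  have hq1 : q ≠ 1 := hq.ne_one (by omega)
  obtain ⟨k, k', hk, h⟩ := exists_a_pow_d_pow (X := X) (s := s) hn hq hl hln (n - l - 1) (by omega)
  have h1 := h x hx
  rw [show n - l - 1 + 1 = n - l by omega] at h1
  refine ⟨k, hk, ?_⟩
  have hu : 𝐝 • 𝐝 ^ (n - l) • x = 0 := by
    rw [← mul_smul, ← pow_succ', d_pow_smul_genSpace hn hq hl hln.le hx]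
  -- On u = d^(n-l) x the weights add up to 1 - (2n - l), and 2n - l is n - l modulo n. So the
  -- coefficient of a^(n-l-1) u in d a^(n-l) u vanishes, and with d u = 0 this gives d a^(n-l) u =
  -- 0.
  have h2 := (hx.1.d_pow hq0 (n - l)).d_a_pow hq0 hq1 (l := 2 * n - l) (by
    rw [Nat.cast_sub hln.le]; ring) (n - l - 1)
  have h3 : al q (2 * n - l) ((n - l - 1 : ℕ) + 1) = 0 := by
    rw [al_eq_zero_iff hn hq]
    right
    rw [← Nat.cast_add_one, show n - l - 1 + 1 = n - l by omega, Nat.cast_sub hln.le]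
    simp
  -- By the previous lemma, d a^(n-l) u is also k times d a d x, and k is nonzero.
  have h4 : 𝐝 • 𝐚 • 𝐝 • x = 0 := by
    rw [h3, hu, smul_zero, smul_zero, zero_smul, zero_add, pow_succ', mul_smul, h1, smul_add,
      smul_comm 𝐚 k, smul_comm 𝐚 k', hx.2, smul_zero, add_zero, smul_comm 𝐝 k, smul_eq_zero] at h2
    exact h2.resolve_left hk
  rw [h1, h4, smul_zero, add_zero]

theorem aeval_smul_mem (W : Submodule 𝕜 X) (y : D 𝕜 n q) (h : ∀ x ∈ W, y • x ∈ W) (p : 𝕜[X])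
    {x : X} (hx : x ∈ W) : aeval y p • x ∈ W := by
  induction p using Polynomial.induction_on' with
  | add p p' h1 h2 => rw [map_add, add_smul]; exact W.add_mem h1 h2
  | monomial k r =>
    rw [aeval_monomial, mul_smul, algebraMap_smul]
    refine W.smul_mem r ?_
    induction k with
    | zero => simpa using hx
    | succ k ih => rw [pow_succ', mul_smul]; exact h _ ih

/-- `a ^ m d ^ m` acts on weight vectors as this polynomial in `a d`. -/
def adPoly (q : 𝕜) (l : ℤ) (m : ℕ) : 𝕜[X] :=
  ∏ j ∈ Finset.range m, (C (q ^ j)⁻¹ * 𝐗 + C (al q l (-j)))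

/-- `IsWt.z_d_pow` turns the innermost pair a, d into a linear polynomial in ad applied to x, which
is again a weight vector of the same weight; the induction runs over all such x. -/
theorem a_pow_d_pow_smul (hq0 : q ≠ 0) (hq1 : q ≠ 1) {s t l : ℤ} (hl : s + t = 1 - l) (m : ℕ)
    {x : X} (hx : IsWt n q s t x) :
    𝐚 ^ m • 𝐝 ^ m • x = aeval (𝐚 * 𝐝) (adPoly q l m) • x := by
  induction m generalizing x with
  | zero => simp [adPoly]
  | succ m ih =>
    have h1 : (q ^ m)⁻¹ • 𝐚 • 𝐝 • x + al q l (-m) • x =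
        aeval (𝐚 * 𝐝) (C (q ^ m)⁻¹ * 𝐗 + C (al q l (-m))) • x := by
      rw [map_add, map_mul, aeval_C, aeval_C, aeval_X, add_smul, mul_smul, algebraMap_smul,
        algebraMap_smul, mul_smul]
    rw [pow_succ, mul_smul, pow_succ' 𝐝, mul_smul, hx.z_d_pow hq0 hq1 hl, adPoly,
      Finset.prod_range_succ, ← adPoly, map_mul, mul_smul, ← h1,
      ← ih (((hx.z hq0).smul _).add (hx.smul _)), smul_comm (q ^ m)⁻¹,
      smul_comm (al q l (-m)), ← smul_add]

/-- A linear factor is divisible by X exactly when its constant term `al q l (-j)` vanishes, which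
happens only for j = 0 and j = n - l. The remaining factors are coprime to X and form h. -/
theorem exists_adPoly_dvd (hn : 2 ≤ n) (hq : IsPrimitiveRoot q n) {l : ℕ} (hl : 1 ≤ l)
    (hln : l ≤ n) : ∃ h : 𝕜[X], IsCoprime (𝐗 ^ 2) h ∧ adPoly q l n ∣ 𝐗 ^ 2 * h := by
  classical
  have hq0 : q ≠ 0 := hq.ne_zero (by omega)
  refine ⟨∏ j ∈ (Finset.range n).filter (fun j : ℕ => ¬ al q l (-j) = 0),
     (C (q ^ j)⁻¹ * 𝐗 + C (al q l (-j))),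
    ?_, ?_⟩
  · refine IsCoprime.prod_right fun j hj => IsCoprime.pow_left ?_
    have hj : al q l (-j) ≠ 0 := (Finset.mem_filter.1 hj).2
    refine ⟨-C ((al q l (-j))⁻¹ * (q ^ j)⁻¹), C (al q l (-j))⁻¹, ?_⟩
    rw [mul_add, ← C_mul, inv_mul_cancel₀ hj, ← mul_assoc, ← C_mul, C_1]
    ring
  · rw [adPoly, ← Finset.prod_filter_mul_prod_filter_not (Finset.range n)
      (fun j : ℕ => al q l (-j) = 0) (fun j : ℕ => C (q ^ j)⁻¹ * 𝐗 + C (al q l (-j)))]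
    have e : ∀ j ∈ (Finset.range n).filter (fun j : ℕ => al q l (-j) = 0),
        C (q ^ j)⁻¹ * 𝐗 + C (al q l (-j)) = C (q ^ j)⁻¹ * 𝐗 := by
      intro j hj
      rw [(Finset.mem_filter.1 hj).2, C_0, add_zero]
    refine mul_dvd_mul_right ?_ _
    rw [Finset.prod_congr rfl e, Finset.prod_mul_distrib, Finset.prod_const]
    have hu : IsUnit (∏ j ∈ (Finset.range n).filter (fun j : ℕ => al q l (-j) = 0),
        C (q ^ j)⁻¹) := by
      rw [← map_prod, isUnit_C, isUnit_iff_ne_zero, Finset.prod_ne_zero_iff]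
      exact fun j _ => inv_ne_zero (pow_ne_zero _ hq0)
    rw [hu.mul_left_dvd]
    refine pow_dvd_pow _ ?_
    refine (Finset.card_le_card (t := {0, n - l}) fun j hj => ?_).trans Finset.card_le_two
    rw [Finset.mem_filter, Finset.mem_range, al_eq_zero_iff hn hq] at hj
    have := cast_sub_eq_zero_or hl hln hj.1 hj.2
    simpa using this

/-- The projector to the eigenvalue `q ^ s` of an element `y` with `y ^ n = 1`. -/
def eigenProj (n : ℕ) (q : 𝕜) (y : D 𝕜 n q) (s : ℤ) : D 𝕜 n q :=
  (n : 𝕜)⁻¹ • ∑ k ∈ Finset.range n, ((q ^ s)⁻¹ • y) ^ k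

theorem mul_eigenProj (hn : 2 ≤ n) (hq : IsPrimitiveRoot q n) {y : D 𝕜 n q} (hy : y ^ n = 1)
    (s : ℤ) : y * eigenProj n q y s = q ^ s • eigenProj n q y s := by
  have hq0 : q ^ s ≠ 0 := zpow_ne_zero _ (hq.ne_zero (by omega))
  have h1 : ((q ^ s)⁻¹ • y) ^ n = 1 := by
    rw [_root_.smul_pow, hy, inv_pow, ← zpow_natCast, ← zpow_mul, mul_comm, zpow_mul, zpow_natCast,
      hq.pow_eq_one, one_zpow, inv_one, one_smul]
  have h2 := mul_geom_sum ((q ^ s)⁻¹ • y) n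
  rw [h1, sub_self, sub_mul, one_mul, sub_eq_zero, smul_mul_assoc, inv_smul_eq_iff₀ hq0] at h2
  rw [eigenProj, mul_smul_comm, h2, smul_comm]

theorem eigenProj_smul [CharZero 𝕜] (hn : 2 ≤ n) (hq : IsPrimitiveRoot q n) {y : D 𝕜 n q}
    {s : ℤ} {x : X} (hx : y • x = q ^ s • x) : eigenProj n q y s • x = x := by
  have hq0 : q ^ s ≠ 0 := zpow_ne_zero _ (hq.ne_zero (by omega))
  have h : ∀ k, ((q ^ s)⁻¹ • y) ^ k • x = x := by
    intro k
    induction k with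
    | zero => simp
    | succ k ih => rw [pow_succ, mul_smul, smul_assoc, hx, inv_smul_smul₀ hq0, ih]
  rw [eigenProj, smul_assoc, Finset.sum_smul, Finset.sum_congr rfl (fun k _ => h k),
    Finset.sum_const, Finset.card_range, ← Nat.cast_smul_eq_nsmul 𝕜, inv_smul_smul₀]
  exact Nat.cast_ne_zero.2 (by omega)

theorem eigenProj_commute {y y' : D 𝕜 n q} (h : Commute y y') (s : ℤ) :
    Commute (eigenProj n q y s) y' := by
  refine Commute.smul_left (Commute.sum_left _ _ _ fun k _ => ?_) _
  exact (h.smul_left _).pow_left k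

theorem exists_isWt_one [CharZero 𝕜] (hn : 2 ≤ n) (hq : IsPrimitiveRoot q n) (s t : ℤ) :
    ∃ e : D 𝕜 n q, IsWt n q s t e ∧
      ∀ (X : Type*) [AddCommGroup X] [Module 𝕜 X] [Module (D 𝕜 n q) X]
        [IsScalarTower 𝕜 (D 𝕜 n q) X] (x : X), IsWt n q s t x → e • x = x := by
  refine ⟨eigenProj n q 𝐛 s * eigenProj n q 𝐜 t, ⟨?_, ?_⟩, ?_⟩
  · rw [smul_eq_mul, ← mul_assoc, mul_eigenProj hn hq D.satisfies_of.b_pow, smul_mul_assoc]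
  · rw [smul_eq_mul, ← mul_assoc, ← (eigenProj_commute D.satisfies_of.bc s).eq, mul_assoc,
      mul_eigenProj hn hq D.satisfies_of.c_pow, mul_smul_comm]
  · intro X _ _ _ _ x hx
    rw [mul_smul, eigenProj_smul hn hq hx.2, eigenProj_smul hn hq hx.1]

/-- There is an element of `D_n` that projects every module to its `genSpace`. -/
theorem exists_genProj [CharZero 𝕜] (hn : 2 ≤ n) (hq : IsPrimitiveRoot q n) {l : ℕ} (hl : 1 ≤ l)
    (hln : l ≤ n) (s : ℕ) : ∃ e : D 𝕜 n q, e ∈ genSpace n q (D 𝕜 n q) l s ∧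
      ∀ (X : Type*) [AddCommGroup X] [Module 𝕜 X] [Module (D 𝕜 n q) X]
        [IsScalarTower 𝕜 (D 𝕜 n q) X] (x : X), x ∈ genSpace n q X l s → e • x = x := by
  have hq0 : q ≠ 0 := hq.ne_zero (by omega)
  have hq1 : q ≠ 1 := hq.ne_one (by omega)
  obtain ⟨e, he, he'⟩ := exists_isWt_one hn hq s (1 - s - l)
  obtain ⟨h, ⟨u, v, huv⟩, r, hr⟩ := exists_adPoly_dvd hn hq hl hln
  have hz : ∀ p : 𝕜[X], IsWt n q s (1 - s - l) (aeval (𝐚 * 𝐝) p • e) := fun p =>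
    aeval_smul_mem
      { carrier := {x : D 𝕜 n q | IsWt n q s (1 - s - l) x}
        add_mem' := fun hx hy => hx.add hy
        zero_mem' := IsWt.zero _ _
        smul_mem' := fun r x hx => hx.smul r } (𝐚 * 𝐝) (fun x hx => by
          rw [mul_smul]; exact IsWt.z hq0 hx) p he
  have hz2 : ∀ {X : Type _} [AddCommGroup X] [Module 𝕜 X] [Module (D 𝕜 n q) X]
      [IsScalarTower 𝕜 (D 𝕜 n q) X] (x : X),
      𝐚 • 𝐝 • 𝐚 • 𝐝 • x = aeval (𝐚 * 𝐝) (𝐗 ^ 2 : 𝕜[X]) • x := fun x => by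
    rw [map_pow, aeval_X, pow_two, mul_smul, mul_smul, mul_smul]
  -- From u X² + v h = 1, the polynomial v h in ad is the identity on the kernel of (ad)². Moreover
  -- X² v h is a multiple of `adPoly q l n`, which sends the weight projector e to a^n d^n e = 0; so
  -- the new element lies in `genSpace` of the regular module.
  refine ⟨aeval (𝐚 * 𝐝) (v * h) • e, ⟨hz _, ?_⟩, fun X _ _ _ _ x hx => ?_⟩
  · rw [hz2, ← mul_smul, ← map_mul, show 𝐗 ^ 2 * (v * h) = v * r * adPoly q l n by
      rw [mul_assoc, mul_comm r, ← hr]; ring, map_mul, mul_smul,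
      ← a_pow_d_pow_smul hq0 hq1 (by ring) n he, d_pow_smul, smul_zero, smul_zero]
  · have h1 : v * h = 1 - u * 𝐗 ^ 2 := by rw [← huv]; ring
    rw [smul_eq_mul, mul_smul, he' X x hx.1, h1, map_sub, map_mul, sub_smul, mul_smul]
    have : aeval (𝐚 * 𝐝) (𝐗 ^ 2 : 𝕜[X]) • x = 0 := by
      rw [map_pow, aeval_X, pow_two, mul_smul, mul_smul, mul_smul, hx.2]
    rw [this, smul_zero, sub_zero, map_one, one_smul]

end GenSpace

/-! ### An explicit 2n-dimensional model of P(l, s) -/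

section ExplicitCover

variable {𝕜 : Type u} [Field 𝕜] {n : ℕ} {q : 𝕜}

/-- The vector `x_t` of the explicit model of `P(l, s)`, zero for `n ≤ t`. -/
def xvec (𝕜 : Type u) [Field 𝕜] (n t : ℕ) : (Fin n → 𝕜) × (Fin n → 𝕜) := (vec 𝕜 n (t + 1), 0)

/-- The vector `y_t` of the explicit model of `P(l, s)`, zero for `n ≤ t`. -/
def yvec (𝕜 : Type u) [Field 𝕜] (n t : ℕ) : (Fin n → 𝕜) × (Fin n → 𝕜) := (0, vec 𝕜 n (t + 1))

theorem xvec_of_le {t : ℕ} (h : n ≤ t) : xvec 𝕜 n t = 0 := by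
  rw [xvec, vec_of_lt _ _ (by omega)]; rfl

theorem yvec_of_le {t : ℕ} (h : n ≤ t) : yvec 𝕜 n t = 0 := by
  rw [yvec, vec_of_lt _ _ (by omega)]; rfl

theorem linearMap_ext_xyvec {M : Type*} [AddCommGroup M] [Module 𝕜 M]
    {f g : (Fin n → 𝕜) × (Fin n → 𝕜) →ₗ[𝕜] M} (hx : ∀ t < n, f (xvec 𝕜 n t) = g (xvec 𝕜 n t))
    (hy : ∀ t < n, f (yvec 𝕜 n t) = g (yvec 𝕜 n t)) : f = g := by
  refine LinearMap.prod_ext ?_ ?_ <;> refine (Pi.basisFun 𝕜 (Fin n)).ext fun t => ?_ <;>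
    rw [basisFun_eq_vec]
  · exact hx t t.2
  · exact hy t t.2

/-- The action of the generators on the explicit model of `P(l, s)`. -/
def coverGen (q : 𝕜) (n l s : ℕ) : Gen → Module.End 𝕜 ((Fin n → 𝕜) × (Fin n → 𝕜))
  | .a => LinearMap.prodMap (ofValues n fun j => vec 𝕜 n (j + 1))
      (ofValues n fun j => vec 𝕜 n (j + 1))
  | .b => LinearMap.prodMap (ofValues n fun j => q ^ ((s : ℤ) + j - 1) • vec 𝕜 n j)
      (ofValues n fun j => q ^ ((s : ℤ) + l + j - 1) • vec 𝕜 n j)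
  | .c => LinearMap.prodMap (ofValues n fun j => q ^ ((j : ℤ) - (s + l)) • vec 𝕜 n j)
      (ofValues n fun j => q ^ ((j : ℤ) - (s + n)) • vec 𝕜 n j)
  | .d => LinearMap.prodMap (ofValues n fun j => al q l (j - 1) • vec 𝕜 n (j - 1))
      (ofValues n fun j => al q (n - l) (j - 1) • vec 𝕜 n (j - 1)) +
      LinearMap.inr 𝕜 _ _ ∘ₗ (ofValues n fun j => q ^ (j - 1) • vec 𝕜 n (n - l + j - 1)) ∘ₗ
        LinearMap.fst 𝕜 _ _

section Action

variable (l s t : ℕ)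

theorem coverGen_a_x : coverGen q n l s .a (xvec 𝕜 n t) = xvec 𝕜 n (t + 1) := by
  rcases Nat.lt_or_ge t n with h | h
  · simp only [coverGen, xvec, LinearMap.prodMap_apply, map_zero]
    rw [ofValues_vec _ _ _ (by omega) (by omega)]
  · rw [xvec_of_le h, xvec_of_le (by omega), map_zero]

theorem coverGen_a_y : coverGen q n l s .a (yvec 𝕜 n t) = yvec 𝕜 n (t + 1) := by
  rcases Nat.lt_or_ge t n with h | h
  · simp only [coverGen, yvec, LinearMap.prodMap_apply, map_zero]
    rw [ofValues_vec _ _ _ (by omega) (by omega)]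
  · rw [yvec_of_le h, yvec_of_le (by omega), map_zero]

theorem coverGen_b_x : coverGen q n l s .b (xvec 𝕜 n t) = q ^ ((s : ℤ) + t) • xvec 𝕜 n t := by
  rcases Nat.lt_or_ge t n with h | h
  · simp only [coverGen, xvec, LinearMap.prodMap_apply, map_zero]
    rw [ofValues_vec _ _ _ (by omega) (by omega), Prod.smul_mk, smul_zero]
    congr 3; push_cast; ring
  · rw [xvec_of_le h, map_zero, smul_zero]

theorem coverGen_b_y : coverGen q n l s .b (yvec 𝕜 n t) = q ^ ((s : ℤ) + l + t) • yvec 𝕜 n t := by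
  rcases Nat.lt_or_ge t n with h | h
  · simp only [coverGen, yvec, LinearMap.prodMap_apply, map_zero]
    rw [ofValues_vec _ _ _ (by omega) (by omega), Prod.smul_mk, smul_zero]
    congr 3; push_cast; ring
  · rw [yvec_of_le h, map_zero, smul_zero]

theorem coverGen_c_x :
    coverGen q n l s .c (xvec 𝕜 n t) = q ^ ((t : ℤ) + 1 - s - l) • xvec 𝕜 n t := by
  rcases Nat.lt_or_ge t n with h | h
  · simp only [coverGen, xvec, LinearMap.prodMap_apply, map_zero]
    rw [ofValues_vec _ _ _ (by omega) (by omega), Prod.smul_mk, smul_zero]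
    congr 3; push_cast; ring
  · rw [xvec_of_le h, map_zero, smul_zero]

theorem coverGen_c_y :
    coverGen q n l s .c (yvec 𝕜 n t) = q ^ ((t : ℤ) + 1 - s - n) • yvec 𝕜 n t := by
  rcases Nat.lt_or_ge t n with h | h
  · simp only [coverGen, yvec, LinearMap.prodMap_apply, map_zero]
    rw [ofValues_vec _ _ _ (by omega) (by omega), Prod.smul_mk, smul_zero]
    congr 3; push_cast; ring
  · rw [yvec_of_le h, map_zero, smul_zero]

variable {t}

theorem coverGen_d_y_zero : coverGen q n l s .d (yvec 𝕜 n 0) = 0 := by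
  rcases Nat.eq_zero_or_pos n with rfl | h
  · rw [yvec_of_le (by omega), map_zero]
  · simp only [coverGen, yvec, LinearMap.prodMap_apply, map_zero, LinearMap.add_apply,
      LinearMap.comp_apply, LinearMap.fst_apply]
    rw [ofValues_vec _ _ _ (by omega) (by omega)]
    simp [vec_zero]

theorem coverGen_d_y (h : t + 1 < n) : coverGen q n l s .d (yvec 𝕜 n (t + 1)) =
    al q (n - l) (t + 1) • yvec 𝕜 n t := by
  simp only [coverGen, yvec, LinearMap.prodMap_apply, map_zero, LinearMap.add_apply,
    LinearMap.comp_apply, LinearMap.fst_apply]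
  rw [ofValues_vec _ _ _ (by omega) (by omega)]
  simp

theorem coverGen_d_x_zero (h : l < n) :
    coverGen q n l s .d (xvec 𝕜 n 0) = yvec 𝕜 n (n - l - 1) := by
  simp only [coverGen, xvec, yvec, LinearMap.prodMap_apply, map_zero, LinearMap.add_apply,
    LinearMap.comp_apply, LinearMap.fst_apply]
  rw [ofValues_vec _ _ _ (by omega) (by omega), ofValues_vec _ _ _ (by omega) (by omega)]
  have : n - l - 1 + 1 = n - l := by omega
  simp [vec_zero, this]

theorem coverGen_d_x (h : t + 1 < n) (_ : l < n) : coverGen q n l s .d (xvec 𝕜 n (t + 1)) =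
    al q l (t + 1) • xvec 𝕜 n t + q ^ (t + 1) • yvec 𝕜 n (n - l + t) := by
  simp only [coverGen, xvec, yvec, LinearMap.prodMap_apply, map_zero, LinearMap.add_apply,
    LinearMap.comp_apply, LinearMap.fst_apply]
  rw [ofValues_vec _ _ _ (by omega) (by omega), ofValues_vec _ _ _ (by omega) (by omega)]
  have : n - l + (t + 1) = n - l + t + 1 := by omega
  simp [this, ← add_assoc]

end Action

theorem al_n (hq : IsPrimitiveRoot q n) (l : ℤ) : al q l n = 0 := by
  simp [al, hq.pow_eq_one]

theorem zpow_add_n (hq0 : q ≠ 0) (hq : IsPrimitiveRoot q n) (z : ℤ) : q ^ (z + n) = q ^ z := by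
  rw [zpow_add₀ hq0, zpow_natCast, hq.pow_eq_one, mul_one]

/-- At t + 1 = n both sides vanish, since `al` vanishes at n; so the top of the string needs no
separate case in the relation for da. -/
theorem coverGen_d_y' (hq : IsPrimitiveRoot q n) {l s t : ℕ} (h : t < n) :
    coverGen q n l s .d (yvec 𝕜 n (t + 1)) = al q (n - l) (t + 1) • yvec 𝕜 n t := by
  rcases Nat.lt_or_ge (t + 1) n with h1 | h1
  · exact coverGen_d_y l s h1
  · have : al q (n - l) (t + 1) = 0 := by
      rw [← al_n hq (n - l)]; congr 1; norm_cast; omega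
    rw [yvec_of_le h1, map_zero, this, zero_smul]

theorem coverGen_d_x' (hq : IsPrimitiveRoot q n) {l s t : ℕ} (h : t < n) (hl : l < n) :
    coverGen q n l s .d (xvec 𝕜 n (t + 1)) =
      al q l (t + 1) • xvec 𝕜 n t + q ^ (t + 1) • yvec 𝕜 n (n - l + t) := by
  rcases Nat.lt_or_ge (t + 1) n with h1 | h1
  · exact coverGen_d_x l s h1 hl
  · have : al q l (t + 1) = 0 := by
      rw [← al_n hq l]; congr 1; norm_cast; omega
    rw [xvec_of_le h1, map_zero, this, zero_smul, yvec_of_le (by omega), smul_zero, add_zero]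

theorem coverGen_a_pow {l s : ℕ} (m t : ℕ) :
    (coverGen q n l s .a ^ m) (xvec 𝕜 n t) = xvec 𝕜 n (t + m) ∧
    (coverGen q n l s .a ^ m) (yvec 𝕜 n t) = yvec 𝕜 n (t + m) := by
  induction m with
  | zero => simp
  | succ m ih =>
    rw [pow_succ', Module.End.mul_apply, Module.End.mul_apply, ih.1, ih.2, coverGen_a_x,
      coverGen_a_y]
    exact ⟨rfl, rfl⟩

theorem coverGen_b_pow {l s : ℕ} (m t : ℕ) :
    (coverGen q n l s .b ^ m) (xvec 𝕜 n t) = (q ^ ((s : ℤ) + t)) ^ m • xvec 𝕜 n t ∧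
    (coverGen q n l s .b ^ m) (yvec 𝕜 n t) = (q ^ ((s : ℤ) + l + t)) ^ m • yvec 𝕜 n t := by
  induction m with
  | zero => simp
  | succ m ih =>
    rw [pow_succ', Module.End.mul_apply, Module.End.mul_apply, ih.1, ih.2, map_smul, map_smul,
      coverGen_b_x, coverGen_b_y, smul_smul, smul_smul, pow_succ, pow_succ]
    exact ⟨rfl, rfl⟩

theorem coverGen_c_pow {l s : ℕ} (m t : ℕ) :
    (coverGen q n l s .c ^ m) (xvec 𝕜 n t) = (q ^ ((t : ℤ) + 1 - s - l)) ^ m • xvec 𝕜 n t ∧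
    (coverGen q n l s .c ^ m) (yvec 𝕜 n t) = (q ^ ((t : ℤ) + 1 - s - n)) ^ m • yvec 𝕜 n t := by
  induction m with
  | zero => simp
  | succ m ih =>
    rw [pow_succ', Module.End.mul_apply, Module.End.mul_apply, ih.1, ih.2, map_smul, map_smul,
      coverGen_c_x, coverGen_c_y, smul_smul, smul_smul, pow_succ, pow_succ]
    exact ⟨rfl, rfl⟩

theorem coverGen_d_pow_y {l s : ℕ} (m t : ℕ) (h : t < m) :
    (coverGen q n l s .d ^ m) (yvec 𝕜 n t) = 0 := by
  induction m generalizing t with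
  | zero => omega
  | succ m ih =>
    rcases Nat.lt_or_ge t n with h1 | h1
    · rw [pow_succ, Module.End.mul_apply]
      cases t with
      | zero => rw [coverGen_d_y_zero, map_zero]
      | succ t => rw [coverGen_d_y _ _ h1, map_smul, ih t (by omega), smul_zero]
    · rw [yvec_of_le h1, map_zero]

/-- The coefficient `al q (n - l) (n - l)` is zero, so d cannot descend below y_(n-l). These breaks
are what keep every d-string in the model short enough for d^n = 0. -/
theorem coverGen_d_pow_y_top {l s : ℕ} (hl : l < n) (m t : ℕ) (h : t < m) :
    (coverGen q n l s .d ^ m) (yvec 𝕜 n (n - l + t)) = 0 := by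
  induction m generalizing t with
  | zero => omega
  | succ m ih =>
    rcases Nat.lt_or_ge (n - l + t) n with h1 | h1
    · rw [pow_succ, Module.End.mul_apply]
      cases t with
      | zero =>
        obtain ⟨k, hk⟩ : ∃ k, n - l = k + 1 := ⟨n - l - 1, by omega⟩
        have e : al q (n - l) (k + 1) = 0 := by
          rw [← Nat.cast_add_one, ← hk, Nat.cast_sub hl.le, al_self]
        rw [add_zero, hk, coverGen_d_y _ _ (by omega), e, zero_smul, map_zero]
      | succ t =>
        rw [← add_assoc, coverGen_d_y _ _ (by omega), map_smul, ih t (by omega), smul_zero]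
    · rw [yvec_of_le h1, map_zero]

theorem coverGen_d_pow_x_bot {l s : ℕ} (hl : l < n) (t m : ℕ) (ht : t < l)
    (h : t + 1 + (n - l) ≤ m) : (coverGen q n l s .d ^ m) (xvec 𝕜 n t) = 0 := by
  induction t generalizing m with
  | zero =>
    obtain ⟨m, rfl⟩ : ∃ k, m = k + 1 := ⟨m - 1, by omega⟩
    rw [pow_succ, Module.End.mul_apply, coverGen_d_x_zero _ _ hl, coverGen_d_pow_y _ _ (by omega)]
  | succ t ih =>
    obtain ⟨m, rfl⟩ : ∃ k, m = k + 1 := ⟨m - 1, by omega⟩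
    rw [pow_succ, Module.End.mul_apply, coverGen_d_x _ _ (by omega) hl, map_add, map_smul, map_smul,
      coverGen_d_pow_y _ _ (by omega), ih m (by omega) (by omega), smul_zero, smul_zero, add_zero]

/-- The x-string breaks at x_l: d x_l is a multiple of y_(n-1), which survives at most l - 1 further
applications of d. -/
theorem coverGen_d_pow_x_top {l s : ℕ} (hl0 : 1 ≤ l) (hl : l < n) (t m : ℕ) (ht : l + t < n)
    (h : l + t + 1 ≤ m) : (coverGen q n l s .d ^ m) (xvec 𝕜 n (l + t)) = 0 := by
  induction t generalizing m with
  | zero =>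
    obtain ⟨m, rfl⟩ : ∃ k, m = k + 1 := ⟨m - 1, by omega⟩
    obtain ⟨k, rfl⟩ : ∃ k, l = k + 1 := ⟨l - 1, by omega⟩
    have e : al q (k + 1 : ℕ) (k + 1) = 0 := by
      rw [← Nat.cast_add_one, al_self]
    rw [pow_succ, Module.End.mul_apply, add_zero, coverGen_d_x _ _ (by omega) hl, e, zero_smul,
      zero_add, map_smul, coverGen_d_pow_y_top hl _ _ (by omega), smul_zero]
  | succ t ih =>
    obtain ⟨m, rfl⟩ : ∃ k, m = k + 1 := ⟨m - 1, by omega⟩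
    rw [pow_succ, Module.End.mul_apply, ← add_assoc, coverGen_d_x _ _ (by omega) hl, map_add,
      map_smul, ih m (by omega) (by omega), yvec_of_le (by omega)]
    simp

/-- The y_t span a submodule: y_(n-l), …, y_(n-1) is a copy of V(l,s), with quotient V(n-l,s+l).
Modulo it, the x_t form a string with head V(l,s) and submodule V(n-l,s+l). The term q^t y_(n-l+t-1)
in d x_t glues the two strings; its factor q^t is forced by da - q ad = 1 - bc, which holds on each
string by `al_succ`. -/
theorem satisfies_coverGen (hn : 2 ≤ n) (hq : IsPrimitiveRoot q n) {l s : ℕ} (hl0 : 1 ≤ l)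
    (hl : l < n) : Satisfies n q (coverGen q n l s) := by
  have hq0 : q ≠ 0 := hq.ne_zero (by omega)
  have hq1 : q ≠ 1 := hq.ne_one (by omega)
  have hpow : ∀ z : ℤ, (q ^ z) ^ n = 1 := fun z => by
    rw [← zpow_natCast, ← zpow_mul, mul_comm, zpow_mul, zpow_natCast, hq.pow_eq_one, one_zpow]
  have hsucc : ∀ z : ℤ, q ^ (z + 1) = q * q ^ z := fun z => by rw [zpow_add_one₀ hq0, mul_comm]
  constructor
  · refine linearMap_ext_xyvec (fun t _ => ?_) (fun t _ => ?_)
    · simp only [Module.End.mul_apply, LinearMap.smul_apply, coverGen_a_x, coverGen_b_x, map_smul,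
        smul_smul, ← hsucc]
      congr 2
    · simp only [Module.End.mul_apply, LinearMap.smul_apply, coverGen_a_y, coverGen_b_y, map_smul,
        smul_smul, ← hsucc]
      congr 2
  · refine linearMap_ext_xyvec (fun t ht => ?_) (fun t ht => ?_)
    · simp only [Module.End.mul_apply, LinearMap.smul_apply, coverGen_b_x, map_smul]
      cases t with
      | zero =>
        rw [coverGen_d_x_zero _ _ hl, coverGen_b_y, smul_smul, ← hsucc]
        congr 1
        rw [← zpow_add_n hq0 hq]
        congr 1
        rw [Nat.cast_sub (by omega), Nat.cast_sub (by omega)]; push_cast; ring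
      | succ t =>
        rw [coverGen_d_x _ _ ht hl, map_add, map_smul, map_smul, coverGen_b_x, coverGen_b_y]
        have e1 : q ^ ((s : ℤ) + (t + 1 : ℕ)) = q * q ^ ((s : ℤ) + t) := by
          rw [← hsucc]; congr 1
        have e2 : q ^ ((s : ℤ) + l + (n - l + t : ℕ)) = q ^ ((s : ℤ) + t) := by
          rw [← zpow_add_n hq0 hq (s + t)]; congr 1; push_cast [Nat.cast_sub hl.le]; ring
        rw [e1, e2]
        module
    · simp only [Module.End.mul_apply, LinearMap.smul_apply, coverGen_b_y, map_smul]
      cases t with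
      | zero => rw [coverGen_d_y_zero, map_zero, smul_zero, smul_zero]
      | succ t =>
        rw [coverGen_d_y _ _ ht, map_smul, coverGen_b_y]
        have e1 : q ^ ((s : ℤ) + l + (t + 1 : ℕ)) = q * q ^ ((s : ℤ) + l + t) := by
          rw [← hsucc]; congr 1
        rw [e1]
        module
  · refine linearMap_ext_xyvec (fun t _ => ?_) (fun t _ => ?_)
    · simp only [Module.End.mul_apply, coverGen_b_x, coverGen_c_x, map_smul]
      rw [smul_comm]
    · simp only [Module.End.mul_apply, coverGen_b_y, coverGen_c_y, map_smul]
      rw [smul_comm]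
  · refine linearMap_ext_xyvec (fun t _ => ?_) (fun t _ => ?_)
    · simp only [Module.End.mul_apply, LinearMap.smul_apply, coverGen_a_x, coverGen_c_x, map_smul,
        smul_smul, ← hsucc]
      congr 2; push_cast; ring
    · simp only [Module.End.mul_apply, LinearMap.smul_apply, coverGen_a_y, coverGen_c_y, map_smul,
        smul_smul, ← hsucc]
      congr 2; push_cast; ring
  · refine linearMap_ext_xyvec (fun t ht => ?_) (fun t ht => ?_)
    · simp only [Module.End.mul_apply, LinearMap.smul_apply, coverGen_c_x, map_smul]
      cases t with
      | zero =>
        rw [coverGen_d_x_zero _ _ hl, coverGen_c_y, smul_smul, ← hsucc]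
        congr 2
        rw [Nat.cast_sub (by omega), Nat.cast_sub (by omega)]; push_cast; ring
      | succ t =>
        rw [coverGen_d_x _ _ ht hl, map_add, map_smul, map_smul, coverGen_c_x, coverGen_c_y]
        have e1 : q ^ (((t + 1 : ℕ) : ℤ) + 1 - s - l) = q * q ^ ((t : ℤ) + 1 - s - l) := by
          rw [← hsucc]; congr 1; push_cast; ring
        have e2 : ((n - l + t : ℕ) : ℤ) + 1 - s - n = (t : ℤ) + 1 - s - l := by
          push_cast [Nat.cast_sub hl.le]; ring
        rw [e1, e2]
        module
    · simp only [Module.End.mul_apply, LinearMap.smul_apply, coverGen_c_y, map_smul]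
      cases t with
      | zero => rw [coverGen_d_y_zero, map_zero, smul_zero, smul_zero]
      | succ t =>
        rw [coverGen_d_y _ _ ht, map_smul, coverGen_c_y]
        have e1 : q ^ (((t + 1 : ℕ) : ℤ) + 1 - s - n) = q * q ^ ((t : ℤ) + 1 - s - n) := by
          rw [← hsucc]; congr 1; push_cast; ring
        rw [e1]
        module
  · have hmul : ∀ z w : ℤ, q ^ z * q ^ w = q ^ (z + w) := fun z w => (zpow_add₀ hq0 z w).symm
    refine linearMap_ext_xyvec (fun t ht => ?_) (fun t ht => ?_)
    · simp only [Module.End.mul_apply, LinearMap.smul_apply, LinearMap.sub_apply, coverGen_a_x,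
        coverGen_b_x, coverGen_c_x, map_smul, Module.End.one_apply, smul_smul, hmul]
      rw [coverGen_d_x' hq ht hl, al_succ hq0 hq1,
        show ((t : ℤ) + 1 - s - l + (s + t)) = 2 * t + 1 - l by ring]
      cases t with
      | zero =>
        rw [coverGen_d_x_zero _ _ hl, coverGen_a_y, show n - l - 1 + 1 = n - l by omega,
          Nat.cast_zero, al_zero, add_zero]
        module
      | succ t =>
        rw [coverGen_d_x _ _ ht hl, map_add, map_smul, map_smul, coverGen_a_x, coverGen_a_y,
          ← add_assoc (n - l), Nat.cast_add_one]
        module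
    · simp only [Module.End.mul_apply, LinearMap.smul_apply, LinearMap.sub_apply, coverGen_a_y,
        coverGen_b_y, coverGen_c_y, map_smul, Module.End.one_apply, smul_smul, hmul]
      rw [coverGen_d_y' hq ht, al_succ hq0 hq1,
        show ((t : ℤ) + 1 - s - n + (s + l + t)) = 2 * t + 1 - (n - l) by ring]
      cases t with
      | zero =>
        rw [coverGen_d_y_zero, map_zero, Nat.cast_zero, al_zero]
        module
      | succ t =>
        rw [coverGen_d_y _ _ ht, map_smul, coverGen_a_y, Nat.cast_add_one]
        module
  · refine linearMap_ext_xyvec (fun t _ => ?_) (fun t _ => ?_)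
    · rw [(coverGen_a_pow n t).1, xvec_of_le (by omega), LinearMap.zero_apply]
    · rw [(coverGen_a_pow n t).2, yvec_of_le (by omega), LinearMap.zero_apply]
  · refine linearMap_ext_xyvec (fun t ht => ?_) (fun t ht => ?_)
    · rw [LinearMap.zero_apply]
      rcases Nat.lt_or_ge t l with h | h
      · exact coverGen_d_pow_x_bot hl t n h (by omega)
      · obtain ⟨t, rfl⟩ := Nat.exists_eq_add_of_le h
        exact coverGen_d_pow_x_top hl0 hl t n ht (by omega)
    · rw [LinearMap.zero_apply, coverGen_d_pow_y _ _ ht]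
  · refine linearMap_ext_xyvec (fun t _ => ?_) (fun t _ => ?_)
    · rw [(coverGen_b_pow n t).1, hpow, one_smul, Module.End.one_apply]
    · rw [(coverGen_b_pow n t).2, hpow, one_smul, Module.End.one_apply]
  · refine linearMap_ext_xyvec (fun t _ => ?_) (fun t _ => ?_)
    · rw [(coverGen_c_pow n t).1, hpow, one_smul, Module.End.one_apply]
    · rw [(coverGen_c_pow n t).2, hpow, one_smul, Module.End.one_apply]

end ExplicitCover

/-! ### Maps out of prescribed modules; the simple modules V(l, s) -/

section Universal

variable {𝕜 : Type u} [Field 𝕜] {n : ℕ} {q : 𝕜}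

local notation "𝐚" => D.of 𝕜 n q Gen.a
local notation "𝐛" => D.of 𝕜 n q Gen.b
local notation "𝐜" => D.of 𝕜 n q Gen.c
local notation "𝐝" => D.of 𝕜 n q Gen.d

variable {X Y : Type*} [AddCommGroup X] [Module 𝕜 X] [Module (D 𝕜 n q) X]
  [IsScalarTower 𝕜 (D 𝕜 n q) X] [AddCommGroup Y] [Module 𝕜 Y] [Module (D 𝕜 n q) Y]
  [IsScalarTower 𝕜 (D 𝕜 n q) Y]

/-- The module on `M` in which the generators act as prescribed. -/
abbrev DMod.ofGen {M : Type w} [AddCommGroup M] [Module 𝕜 M] (f : Gen → Module.End 𝕜 M)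
    (hf : Satisfies n q f) : DMod.{u, w} 𝕜 n q := DMod.ofRep (D.lift f hf)

/-- The identity, as a linear equivalence between `DMod.ofGen f hf` and the underlying space. -/
def ofGenEquiv {M : Type w} [AddCommGroup M] [Module 𝕜 M] (f : Gen → Module.End 𝕜 M)
    (hf : Satisfies n q f) : M ≃ₗ[𝕜] DMod.ofGen f hf := LinearEquiv.refl 𝕜 M

theorem of_smul_ofGenEquiv {M : Type w} [AddCommGroup M] [Module 𝕜 M]
    (f : Gen → Module.End 𝕜 M) (hf : Satisfies n q f) (g : Gen) (x : M) :
    D.of 𝕜 n q g • ofGenEquiv f hf x = ofGenEquiv f hf (f g x) := by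
  change D.lift f hf (D.of 𝕜 n q g) x = f g x
  rw [D.lift_of]

/-- A linear map out of `M` that intertwines the prescribed operators with the generators. -/
def homOfGen {M : Type w} [AddCommGroup M] [Module 𝕜 M] (f : Gen → Module.End 𝕜 M)
    (hf : Satisfies n q f) (φ : M →ₗ[𝕜] X) (h : ∀ g x, φ (f g x) = D.of 𝕜 n q g • φ x) :
    DMod.ofGen f hf →ₗ[D 𝕜 n q] X :=
  homOfComm (φ ∘ₗ (ofGenEquiv f hf).symm.toLinearMap) fun g x => by
    obtain ⟨x, rfl⟩ := (ofGenEquiv f hf).surjective x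
    rw [of_smul_ofGenEquiv]
    simp only [LinearMap.comp_apply, LinearEquiv.coe_coe, LinearEquiv.symm_apply_apply, h]

theorem homOfGen_apply {M : Type w} [AddCommGroup M] [Module 𝕜 M] (f : Gen → Module.End 𝕜 M)
    (hf : Satisfies n q f) (φ : M →ₗ[𝕜] X) (h : ∀ g x, φ (f g x) = D.of 𝕜 n q g • φ x) (x : M) :
    homOfGen f hf φ h (ofGenEquiv f hf x) = φ x := by
  simp [homOfGen]

/-- Evaluation at the generator c identifies Hom(X, Y) with W: two maps that agree at c agree on a
submodule containing c, hence everywhere. -/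
theorem finrank_hom_eq (c : X) (hc : ∀ N : Submodule (D 𝕜 n q) X, c ∈ N → N = ⊤)
    (W : Submodule 𝕜 Y) (h1 : ∀ f : X →ₗ[D 𝕜 n q] Y, f c ∈ W)
    (h2 : ∀ y ∈ W, ∃ f : X →ₗ[D 𝕜 n q] Y, f c = y) :
    Module.finrank 𝕜 (X →ₗ[D 𝕜 n q] Y) = Module.finrank 𝕜 W := by
  let ev : (X →ₗ[D 𝕜 n q] Y) →ₗ[𝕜] W :=
    { toFun := fun f => ⟨f c, h1 f⟩
      map_add' := fun f g => rfl
      map_smul' := fun r f => rfl }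
  refine (LinearEquiv.ofBijective ev ⟨?_, ?_⟩).finrank_eq
  · intro f g hfg
    have h : f c = g c := congrArg Subtype.val hfg
    have := hc (LinearMap.eqLocus f g) h
    exact LinearMap.eqLocus_eq_top.1 this
  · rintro ⟨y, hy⟩
    obtain ⟨f, hf⟩ := h2 y hy
    exact ⟨f, Subtype.ext hf⟩

section SimpleModule

theorem linearMap_ext_vec {M : Type*} [AddCommGroup M] [Module 𝕜 M] {l : ℕ}
    {f g : (Fin l → 𝕜) →ₗ[𝕜] M} (h : ∀ t < l, f (vec 𝕜 l (t + 1)) = g (vec 𝕜 l (t + 1))) :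
    f = g := by
  refine (Pi.basisFun 𝕜 (Fin l)).ext fun t => ?_
  rw [basisFun_eq_vec]
  exact h t t.2

/-- The linear map with prescribed values on `v_1, …, v_l`. -/
def constrVec (l : ℕ) (f : ℕ → X) : (Fin l → 𝕜) →ₗ[𝕜] X :=
  (Pi.basisFun 𝕜 (Fin l)).constr 𝕜 fun t => f t

theorem constrVec_vec (l : ℕ) (f : ℕ → X) {t : ℕ} (h : t < l) :
    constrVec (𝕜 := 𝕜) l f (vec 𝕜 l (t + 1)) = f t := by
  have := basisFun_eq_vec (𝕜 := 𝕜) l ⟨t, h⟩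
  rw [← this, constrVec, Module.Basis.constr_basis]

theorem IsWt.congr (hn : 2 ≤ n) (hq : IsPrimitiveRoot q n) {s t s' t' : ℤ} {x : X}
    (hs : (s : ZMod n) = s') (ht : (t : ZMod n) = t') (hx : IsWt n q s t x) :
    IsWt n q s' t' x :=
  ⟨by rw [hx.1, (zpow_eq_zpow_iff hn hq _ _).2 hs], by rw [hx.2, (zpow_eq_zpow_iff hn hq _ _).2 ht]⟩

variable (hn : 2 ≤ n) (hq : IsPrimitiveRoot q n) (i : Idx n)

/-- The basis vector `v_{t+1}` of `V(l, s)`. -/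
def svec (t : ℕ) : simple hn hq i :=
  ofGenEquiv _ (satisfies_simpleGen hn hq i.1 i.2.val i.1.2.2) (vec 𝕜 i.1 (t + 1))

/-- The identity between `𝕜 ^ l` and `V(l, s)`. -/
def simpleEquiv : (Fin i.1 → 𝕜) ≃ₗ[𝕜] simple hn hq i :=
  ofGenEquiv _ (satisfies_simpleGen hn hq i.1 i.2.val i.1.2.2)

instance : Module.Finite 𝕜 (simple hn hq i) := Module.Finite.equiv (simpleEquiv hn hq i)

theorem finrank_simple : Module.finrank 𝕜 (simple hn hq i) = i.1 := by
  rw [← (simpleEquiv hn hq i).finrank_eq, Module.finrank_fin_fun]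

theorem of_smul_simpleEquiv (g : Gen) (x : Fin i.1 → 𝕜) : D.of 𝕜 n q g • simpleEquiv hn hq i x =
    simpleEquiv hn hq i (simpleGen q i.1 i.2.val g x) := of_smul_ofGenEquiv _ _ _ _

theorem simpleEquiv_vec (t : ℕ) : simpleEquiv hn hq i (vec 𝕜 i.1 (t + 1)) = svec hn hq i t := rfl

theorem svec_of_le {t : ℕ} (h : i.1 ≤ t) : svec hn hq i t = 0 := by
  rw [← simpleEquiv_vec, vec_of_lt _ _ (by omega), map_zero]

theorem svec_ne_zero {t : ℕ} (h : t < i.1) : svec hn hq i t ≠ 0 := by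
  rw [← simpleEquiv_vec, Ne, LinearEquiv.map_eq_zero_iff]
  intro h0
  have := congrFun h0 ⟨t, h⟩
  simp [vec] at this

theorem a_svec (t : ℕ) : 𝐚 • svec hn hq i t = svec hn hq i (t + 1) := by
  rw [← simpleEquiv_vec, of_smul_simpleEquiv, simpleGen_a _ _ _ (by omega), simpleEquiv_vec]

theorem a_pow_svec (m t : ℕ) : 𝐚 ^ m • svec hn hq i t = svec hn hq i (t + m) := by
  induction m with
  | zero => simp
  | succ m ih => rw [pow_succ', mul_smul, ih, a_svec]; rfl

theorem isWt_svec (t : ℕ) :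
    IsWt n q (i.2.val + t) (t + 1 - i.2.val - (i.1 : ℕ)) (svec hn hq i t) := by
  constructor <;> rw [← simpleEquiv_vec, of_smul_simpleEquiv]
  · rw [simpleGen_b, map_smul]; congr 2; push_cast; ring
  · rw [simpleGen_c, map_smul]; congr 2; push_cast; ring

theorem d_svec_zero : 𝐝 • svec hn hq i 0 = 0 := by
  have : 1 ≤ (i.1 : ℕ) := i.1.2.1
  rw [← simpleEquiv_vec, of_smul_simpleEquiv, simpleGen_d _ _ _ (by omega)]
  simp [vec_zero]

theorem d_svec {t : ℕ} (h : t + 1 < i.1) :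
    𝐝 • svec hn hq i (t + 1) = al q (i.1 : ℕ) (t + 1) • svec hn hq i t := by
  rw [← simpleEquiv_vec, of_smul_simpleEquiv, simpleGen_d _ _ _ (by omega), map_smul, alpha_eq_al]
  simp [simpleEquiv_vec]

theorem z_svec {t : ℕ} (h : t < i.1) :
    𝐚 • 𝐝 • svec hn hq i t = al q (i.1 : ℕ) t • svec hn hq i t := by
  cases t with
  | zero => rw [d_svec_zero, Nat.cast_zero, al_zero, smul_zero, zero_smul]
  | succ t => rw [d_svec _ _ _ h, smul_comm, a_svec, Nat.cast_succ]

/-- The coordinates of a vector of `V(l, s)`. -/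
def scoord (t : Fin i.1) : simple hn hq i →ₗ[𝕜] 𝕜 :=
  LinearMap.proj t ∘ₗ (simpleEquiv hn hq i).symm.toLinearMap

theorem simple_ext {M : Type*} [AddCommGroup M] [Module 𝕜 M] {f g : simple hn hq i →ₗ[𝕜] M}
    (h : ∀ t < (i.1 : ℕ), f (svec hn hq i t) = g (svec hn hq i t)) : f = g := by
  have : f ∘ₗ (simpleEquiv hn hq i).toLinearMap = g ∘ₗ (simpleEquiv hn hq i).toLinearMap :=
    linearMap_ext_vec h
  ext x
  obtain ⟨x, rfl⟩ := (simpleEquiv hn hq i).surjective x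
  exact LinearMap.congr_fun this x

theorem scoord_svec (t : Fin i.1) (t' : ℕ) :
    scoord hn hq i t (svec hn hq i t') = if (t : ℕ) = t' then 1 else 0 := by
  simp [scoord, ← simpleEquiv_vec, vec]

theorem scoord_b (t : Fin i.1) (x : simple hn hq i) :
    scoord hn hq i t (𝐛 • x) = q ^ ((i.2.val : ℤ) + t) * scoord hn hq i t x := by
  refine LinearMap.congr_fun (f := scoord hn hq i t ∘ₗ Algebra.lsmul 𝕜 𝕜 _ 𝐛)
    (g := q ^ ((i.2.val : ℤ) + t) • scoord hn hq i t) (simple_ext _ _ _ fun t' ht' => ?_) x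
  simp only [LinearMap.comp_apply, Algebra.lsmul_coe, (isWt_svec hn hq i t').1, map_smul,
    LinearMap.smul_apply, scoord_svec]
  split_ifs with h
  · rw [h]
  · simp

theorem scoord_c (t : Fin i.1) (x : simple hn hq i) : scoord hn hq i t (𝐜 • x) =
    q ^ ((t : ℤ) + 1 - i.2.val - (i.1 : ℕ)) * scoord hn hq i t x := by
  refine LinearMap.congr_fun (f := scoord hn hq i t ∘ₗ Algebra.lsmul 𝕜 𝕜 _ 𝐜)
    (g := q ^ ((t : ℤ) + 1 - i.2.val - (i.1 : ℕ)) • scoord hn hq i t)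
    (simple_ext _ _ _ fun t' ht' => ?_) x
  simp only [LinearMap.comp_apply, Algebra.lsmul_coe, (isWt_svec hn hq i t').2, map_smul,
    LinearMap.smul_apply, scoord_svec]
  split_ifs with h
  · rw [h]
  · simp

theorem scoord_z (t : Fin i.1) (x : simple hn hq i) :
    scoord hn hq i t (𝐚 • 𝐝 • x) = al q (i.1 : ℕ) t * scoord hn hq i t x := by
  refine LinearMap.congr_fun
    (f := scoord hn hq i t ∘ₗ Algebra.lsmul 𝕜 𝕜 _ 𝐚 ∘ₗ Algebra.lsmul 𝕜 𝕜 _ 𝐝)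
    (g := al q (i.1 : ℕ) t • scoord hn hq i t) (simple_ext _ _ _ fun t' ht' => ?_) x
  simp only [LinearMap.comp_apply, Algebra.lsmul_coe, z_svec hn hq i ht', map_smul,
    LinearMap.smul_apply, scoord_svec]
  split_ifs with h
  · rw [h]
  · simp

theorem eq_smul_svec_zero {x : simple hn hq i} {h0 : 0 < (i.1 : ℕ)}
    (h : ∀ t : Fin i.1, (t : ℕ) ≠ 0 → scoord hn hq i t x = 0) :
    x = scoord hn hq i ⟨0, h0⟩ x • svec hn hq i 0 := by
  apply (simpleEquiv hn hq i).symm.injective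
  ext t
  change scoord hn hq i t x = scoord hn hq i t (scoord hn hq i ⟨0, h0⟩ x • svec hn hq i 0)
  rw [map_smul, scoord_svec]
  split_ifs with ht
  · rw [smul_eq_mul, mul_one]; congr 2; exact Fin.ext ht
  · rw [h t ht, smul_zero]

theorem al_ne_zero_of_lt (hn : 2 ≤ n) (hq : IsPrimitiveRoot q n) {l t : ℕ} (ht0 : t ≠ 0)
    (ht : t < l) (hl : l ≤ n) : al q l t ≠ 0 := by
  rw [Ne, al_eq_zero_iff hn hq, not_or]
  constructor
  · rw [Int.cast_natCast, ZMod.natCast_eq_zero_iff]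
    exact fun h => ht0 (Nat.eq_zero_of_dvd_of_lt h (by omega))
  · rw [Int.cast_natCast, Int.cast_natCast, eq_comm, ← sub_eq_zero, ← Nat.cast_sub ht.le,
      ZMod.natCast_eq_zero_iff]
    exact fun h => by have := Nat.le_of_dvd (by omega) h; omega

theorem svec_zero_generates (N : Submodule (D 𝕜 n q) (simple hn hq i))
    (h : svec hn hq i 0 ∈ N) : N = ⊤ := by
  have h1 : (N.restrictScalars 𝕜).mkQ = 0 := simple_ext _ _ _ fun t _ => by
    rw [Submodule.mkQ_apply, LinearMap.zero_apply, Submodule.Quotient.mk_eq_zero]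
    have := N.smul_mem (𝐚 ^ t) h
    rwa [a_pow_svec, zero_add] at this
  rw [Submodule.eq_top_iff']
  intro x
  have := LinearMap.congr_fun h1 x
  rwa [Submodule.mkQ_apply, LinearMap.zero_apply, Submodule.Quotient.mk_eq_zero] at this

theorem svec_zero_mem_primSpace : svec hn hq i 0 ∈ primSpace n q (simple hn hq i) i.1 i.2.val := by
  refine ⟨?_, d_svec_zero hn hq i, ?_⟩
  · convert isWt_svec hn hq i 0 using 1 <;> push_cast <;> ring
  · rw [a_pow_svec, svec_of_le]; omega

/-- The map sends v_(t+1) to a^t x. It is compatible with d by `IsWt.d_a_pow` and d x = 0, and with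
the end of the string by a^l x = 0. -/
theorem exists_hom_simple {x : X} (hx : x ∈ primSpace n q X i.1 i.2.val) :
    ∃ f : simple hn hq i →ₗ[D 𝕜 n q] X, f (svec hn hq i 0) = x := by
  have hq0 : q ≠ 0 := hq.ne_zero (by omega)
  have hq1 : q ≠ 1 := hq.ne_one (by omega)
  have h0 : 1 ≤ (i.1 : ℕ) := i.1.2.1
  obtain ⟨hw, hd, ha⟩ := hx
  let φ : (Fin i.1 → 𝕜) →ₗ[𝕜] X := constrVec i.1 fun t => 𝐚 ^ t • x
  have hφ : ∀ t, φ (vec 𝕜 i.1 (t + 1)) = 𝐚 ^ t • x := by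
    intro t
    rcases Nat.lt_or_ge t i.1 with h | h
    · exact constrVec_vec _ _ h
    · obtain ⟨m, rfl⟩ := Nat.exists_eq_add_of_le' h
      rw [vec_of_lt _ _ (by omega), map_zero, pow_add, mul_smul, ha, smul_zero]
  have comm : ∀ g, φ ∘ₗ simpleGen q i.1 i.2.val g = Algebra.lsmul 𝕜 𝕜 X (D.of 𝕜 n q g) ∘ₗ φ := by
    intro g
    refine linearMap_ext_vec fun t ht => ?_
    simp only [LinearMap.comp_apply, Algebra.lsmul_coe, hφ]
    have hwt := hw.a_pow hq0 t
    cases g with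
    | a => rw [simpleGen_a _ _ _ (by omega), hφ, pow_succ', mul_smul]
    | b => rw [simpleGen_b, map_smul, hφ, hwt.1]; congr 2; push_cast; ring
    | c => rw [simpleGen_c, map_smul, hφ, hwt.2]; congr 2; push_cast; ring
    | d =>
      rw [simpleGen_d _ _ _ (by omega), map_smul, alpha_eq_al]
      cases t with
      | zero => simp [vec_zero, hd]
      | succ t =>
        rw [hw.d_a_pow hq0 hq1 (l := (i.1 : ℕ)) (by ring), hd, smul_zero, smul_zero, add_zero,
          Nat.add_sub_cancel, hφ]
        push_cast; rfl
  refine ⟨homOfGen _ (satisfies_simpleGen hn hq i.1 i.2.val i.1.2.2) φ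
    fun g x => LinearMap.congr_fun (comm g) x, ?_⟩
  exact (homOfGen_apply _ _ _ _ _).trans ((hφ 0).trans (by rw [pow_zero, one_smul]))

/-- In a nonzero submodule, apply d to a nonzero vector until the last nonzero result. That vector
is killed by ad, whose eigenvalue on v_(t+1) is nonzero unless t = 0; so it is a multiple of v_1,
which generates. -/
theorem isSimpleModule_simple : IsSimpleModule (D 𝕜 n q) (simple hn hq i) := by
  have h0 : 0 < (i.1 : ℕ) := i.1.2.1
  have : Nontrivial (simple hn hq i) := ⟨svec hn hq i 0, 0, svec_ne_zero hn hq i h0⟩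
  rw [isSimpleModule_iff]
  refine { eq_bot_or_eq_top := fun N => or_iff_not_imp_left.2 fun hN => ?_ }
  obtain ⟨x, hx, hx0⟩ := N.ne_bot_iff.1 hN
  have hex : ∃ m, 𝐝 ^ m • x = 0 := ⟨n, d_pow_smul x⟩
  classical
  obtain ⟨m, hm⟩ : ∃ m, Nat.find hex = m + 1 := Nat.exists_eq_succ_of_ne_zero fun h => hx0 (by
    simpa [h] using Nat.find_spec hex)
  have h1 : 𝐝 ^ m • x ≠ 0 := Nat.find_min hex (by omega)
  have h2 : 𝐝 • 𝐝 ^ m • x = 0 := by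
    rw [← mul_smul, ← pow_succ', ← hm]; exact Nat.find_spec hex
  have h3 := eq_smul_svec_zero hn hq i (x := 𝐝 ^ m • x) (h0 := h0) fun t ht => by
    have := scoord_z hn hq i t (𝐝 ^ m • x)
    rw [h2, smul_zero, map_zero, eq_comm, mul_eq_zero] at this
    exact this.resolve_left (al_ne_zero_of_lt hn hq ht t.2 i.1.2.2)
  refine svec_zero_generates hn hq i N ?_
  have h4 : scoord hn hq i ⟨0, h0⟩ (𝐝 ^ m • x) ≠ 0 := fun h => h1 (by rw [h3, h, zero_smul])
  have h5 := N.smul_of_tower_mem (scoord hn hq i ⟨0, h0⟩ (𝐝 ^ m • x))⁻¹ (N.smul_mem (𝐝 ^ m) hx)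
  rw [h3] at h5
  rwa [map_smul, scoord_svec, if_pos rfl, smul_eq_mul, mul_one, inv_smul_smul₀ h4] at h5

end SimpleModule

end Universal

/-! ### The universal property of the projective covers -/

section Cover

variable {𝕜 : Type u} [Field 𝕜] {n : ℕ} {q : 𝕜}

local notation "𝐚" => D.of 𝕜 n q Gen.a
local notation "𝐛" => D.of 𝕜 n q Gen.b
local notation "𝐜" => D.of 𝕜 n q Gen.c
local notation "𝐝" => D.of 𝕜 n q Gen.d

variable {X Y : Type*} [AddCommGroup X] [Module 𝕜 X] [Module (D 𝕜 n q) X]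
  [IsScalarTower 𝕜 (D 𝕜 n q) X] [AddCommGroup Y] [Module 𝕜 Y] [Module (D 𝕜 n q) Y]
  [IsScalarTower 𝕜 (D 𝕜 n q) Y]

variable (hn : 2 ≤ n) (hq : IsPrimitiveRoot q n) (i : Idx n) (hi : (i.1 : ℕ) < n)

/-- The explicit model of `P(l, s)` for `l < n`. -/
def qmod : DMod.{u, u} 𝕜 n q :=
  DMod.ofGen (coverGen q n i.1 i.2.val) (satisfies_coverGen hn hq i.1.2.1 hi)

/-- The identity between `𝕜 ^ n × 𝕜 ^ n` and the explicit model of `P(l, s)`. -/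
def qmodEquiv : ((Fin n → 𝕜) × (Fin n → 𝕜)) ≃ₗ[𝕜] qmod hn hq i hi :=
  ofGenEquiv _ (satisfies_coverGen hn hq i.1.2.1 hi)

instance : Module.Finite 𝕜 (qmod hn hq i hi) := Module.Finite.equiv (qmodEquiv hn hq i hi)

theorem of_smul_qmodEquiv (g : Gen) (x : (Fin n → 𝕜) × (Fin n → 𝕜)) :
    D.of 𝕜 n q g • qmodEquiv hn hq i hi x =
      qmodEquiv hn hq i hi (coverGen q n i.1 i.2.val g x) := of_smul_ofGenEquiv _ _ _ _

/-- The vector `x_t` of the explicit model of `P(l, s)`. -/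
def qx (t : ℕ) : qmod hn hq i hi := qmodEquiv hn hq i hi (xvec 𝕜 n t)

/-- The vector `y_t` of the explicit model of `P(l, s)`. -/
def qy (t : ℕ) : qmod hn hq i hi := qmodEquiv hn hq i hi (yvec 𝕜 n t)

theorem qy_of_le {t : ℕ} (h : n ≤ t) : qy hn hq i hi t = 0 := by
  rw [qy, yvec_of_le h, map_zero]

theorem a_qx (t : ℕ) : 𝐚 • qx hn hq i hi t = qx hn hq i hi (t + 1) := by
  rw [qx, of_smul_qmodEquiv, coverGen_a_x]; rfl

theorem a_qy (t : ℕ) : 𝐚 • qy hn hq i hi t = qy hn hq i hi (t + 1) := by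
  rw [qy, of_smul_qmodEquiv, coverGen_a_y]; rfl

theorem a_pow_qx (m t : ℕ) : 𝐚 ^ m • qx hn hq i hi t = qx hn hq i hi (t + m) := by
  induction m with
  | zero => simp
  | succ m ih => rw [pow_succ', mul_smul, ih, a_qx]; rfl

theorem a_pow_qy (m t : ℕ) : 𝐚 ^ m • qy hn hq i hi t = qy hn hq i hi (t + m) := by
  induction m with
  | zero => simp
  | succ m ih => rw [pow_succ', mul_smul, ih, a_qy]; rfl

theorem isWt_qx (t : ℕ) :
    IsWt n q (i.2.val + t) (t + 1 - i.2.val - (i.1 : ℕ)) (qx hn hq i hi t) := by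
  constructor <;> rw [qx, of_smul_qmodEquiv]
  · rw [coverGen_b_x, map_smul]
  · rw [coverGen_c_x, map_smul]

theorem isWt_qy (t : ℕ) :
    IsWt n q (i.2.val + (i.1 : ℕ) + t) (t + 1 - i.2.val - n) (qy hn hq i hi t) := by
  constructor <;> rw [qy, of_smul_qmodEquiv]
  · rw [coverGen_b_y, map_smul]
  · rw [coverGen_c_y, map_smul]

theorem d_qx_zero : 𝐝 • qx hn hq i hi 0 = qy hn hq i hi (n - i.1 - 1) := by
  rw [qx, of_smul_qmodEquiv, coverGen_d_x_zero _ _ hi]; rfl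

theorem d_qx {t : ℕ} (h : t + 1 < n) : 𝐝 • qx hn hq i hi (t + 1) =
    al q (i.1 : ℕ) (t + 1) • qx hn hq i hi t + q ^ (t + 1) • qy hn hq i hi (n - i.1 + t) := by
  rw [qx, of_smul_qmodEquiv, coverGen_d_x _ _ h hi, map_add, map_smul, map_smul]; rfl

theorem d_qy_zero : 𝐝 • qy hn hq i hi 0 = 0 := by
  rw [qy, of_smul_qmodEquiv, coverGen_d_y_zero, map_zero]

theorem d_qy {t : ℕ} (h : t + 1 < n) : 𝐝 • qy hn hq i hi (t + 1) =
    al q (n - (i.1 : ℕ)) (t + 1) • qy hn hq i hi t := by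
  rw [qy, of_smul_qmodEquiv, coverGen_d_y _ _ h, map_smul]; rfl

theorem z_qx {t : ℕ} (h : t < n) : 𝐚 • 𝐝 • qx hn hq i hi t =
    al q (i.1 : ℕ) t • qx hn hq i hi t + q ^ t • qy hn hq i hi (n - i.1 + t) := by
  cases t with
  | zero =>
    rw [d_qx_zero, a_qy, Nat.cast_zero, al_zero, zero_smul, zero_add, pow_zero, one_smul]
    congr 1; omega
  | succ t =>
    rw [d_qx _ _ _ _ h, smul_add, smul_comm 𝐚, smul_comm 𝐚, a_qx, a_qy, Nat.cast_succ]; rfl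

theorem z_qy {t : ℕ} (h : t < n) :
    𝐚 • 𝐝 • qy hn hq i hi t = al q (n - (i.1 : ℕ)) t • qy hn hq i hi t := by
  cases t with
  | zero => rw [d_qy_zero, Nat.cast_zero, al_zero, smul_zero, zero_smul]
  | succ t => rw [d_qy _ _ _ _ h, smul_comm, a_qy, Nat.cast_succ]

theorem d_qy_mid : 𝐝 • qy hn hq i hi (n - i.1) = 0 := by
  have h1 : 1 ≤ (i.1 : ℕ) := i.1.2.1
  obtain ⟨k, hk⟩ : ∃ k, n - (i.1 : ℕ) = k + 1 := ⟨n - i.1 - 1, by omega⟩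
  have e : al q (n - (i.1 : ℕ)) (k + 1) = 0 := by
    rw [← Nat.cast_succ, Nat.succ_eq_add_one, ← hk, Nat.cast_sub hi.le, al_self]
  rw [hk, d_qy _ _ _ _ (by omega), e, zero_smul]

theorem qmod_ext {M : Type*} [AddCommGroup M] [Module 𝕜 M] {f g : qmod hn hq i hi →ₗ[𝕜] M}
    (hx : ∀ t < n, f (qx hn hq i hi t) = g (qx hn hq i hi t))
    (hy : ∀ t < n, f (qy hn hq i hi t) = g (qy hn hq i hi t)) : f = g := by
  have : f ∘ₗ (qmodEquiv hn hq i hi).toLinearMap = g ∘ₗ (qmodEquiv hn hq i hi).toLinearMap :=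
    linearMap_ext_xyvec hx hy
  ext x
  obtain ⟨x, rfl⟩ := (qmodEquiv hn hq i hi).surjective x
  exact LinearMap.congr_fun this x

/-- d x_0 = y_(n-l-1), and d descends from there to y_0 through nonzero coefficients; a then climbs
both strings. -/
theorem qx_zero_generates (N : Submodule (D 𝕜 n q) (qmod hn hq i hi))
    (h : qx hn hq i hi 0 ∈ N) : N = ⊤ := by
  have hl : 1 ≤ (i.1 : ℕ) := i.1.2.1
  have hy : ∀ k < n - i.1, qy hn hq i hi (n - i.1 - 1 - k) ∈ N := by
    intro k
    induction k with
    | zero =>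
      intro _
      have := N.smul_mem 𝐝 h
      rwa [d_qx_zero] at this
    | succ k ih =>
      intro hk
      have h1 := N.smul_mem 𝐝 (ih (by omega))
      rw [show n - i.1 - 1 - k = n - i.1 - 1 - (k + 1) + 1 by omega, d_qy _ _ _ _ (by omega)] at h1
      have ne : al q (n - (i.1 : ℕ)) ((n - i.1 - 1 - (k + 1) : ℕ) + 1) ≠ 0 := by
        rw [← Nat.cast_sub hi.le, ← Nat.cast_succ]
        exact al_ne_zero_of_lt hn hq (by omega) (by omega) (by omega)
      have h2 := N.smul_of_tower_mem (al q (n - (i.1 : ℕ)) ((n - i.1 - 1 - (k + 1) : ℕ) + 1))⁻¹ h1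
      rwa [inv_smul_smul₀ ne] at h2
  have hy0 : qy hn hq i hi 0 ∈ N := by
    have := hy (n - i.1 - 1) (by omega)
    rwa [Nat.sub_self] at this
  have h1 : (N.restrictScalars 𝕜).mkQ = 0 := by
    refine qmod_ext _ _ _ _ (fun t _ => ?_) (fun t _ => ?_) <;>
      rw [Submodule.mkQ_apply, LinearMap.zero_apply, Submodule.Quotient.mk_eq_zero]
    · have := N.smul_mem (𝐚 ^ t) h
      rwa [a_pow_qx, zero_add] at this
    · have := N.smul_mem (𝐚 ^ t) hy0
      rwa [a_pow_qy, zero_add] at this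
  rw [Submodule.eq_top_iff']
  intro x
  have := LinearMap.congr_fun h1 x
  rwa [Submodule.mkQ_apply, LinearMap.zero_apply, Submodule.Quotient.mk_eq_zero] at this

theorem qx_zero_mem_genSpace :
    qx hn hq i hi 0 ∈ genSpace n q (qmod hn hq i hi) i.1 i.2.val := by
  have h1 : 1 ≤ (i.1 : ℕ) := i.1.2.1
  refine ⟨?_, ?_⟩
  · convert isWt_qx hn hq i hi 0 using 1 <;> push_cast <;> ring
  · rw [d_qx_zero, a_qy, show n - i.1 - 1 + 1 = n - i.1 by omega, d_qy_mid, smul_zero]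

theorem al_add_n (hq0 : q ≠ 0) (hq : IsPrimitiveRoot q n) (l t : ℤ) :
    al q (l + n) t = al q l t := by
  rw [al, al, ← zpow_add_n hq0 hq (t - (l + n))]
  congr 4; ring

/-- The map is x_t ↦ a^t x and y_t ↦ k⁻¹ a^t d^(n-l) x with k from `exists_a_pow_d_pow_eq`. This
normalization makes y_(n-l-1) go to d x, as d x_0 = y_(n-l-1) requires, and d y_0 = 0 becomes
`d_pow_smul_genSpace`. -/
theorem exists_hom_qmod {x : X} (hx : x ∈ genSpace n q X i.1 i.2.val) :
    ∃ f : qmod hn hq i hi →ₗ[D 𝕜 n q] X, f (qx hn hq i hi 0) = x := by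
  have hq0 : q ≠ 0 := hq.ne_zero (by omega)
  have hq1 : q ≠ 1 := hq.ne_one (by omega)
  have h0 : 1 ≤ (i.1 : ℕ) := i.1.2.1
  obtain ⟨k, hk, hkx⟩ := exists_a_pow_d_pow_eq hn hq h0 hi hx
  have hd : 𝐝 • x = k⁻¹ • 𝐚 ^ (n - i.1 - 1) • 𝐝 ^ (n - i.1) • x := by rw [hkx, inv_smul_smul₀ hk]
  have hu : 𝐝 • 𝐝 ^ (n - i.1) • x = 0 := by
    rw [← mul_smul, ← pow_succ', d_pow_smul_genSpace hn hq h0 hi.le hx]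
  have hw := hx.1
  have hwu := hw.d_pow hq0 (n - i.1)
  generalize hudef : 𝐝 ^ (n - i.1) • x = w at *
  let φ : ((Fin n → 𝕜) × (Fin n → 𝕜)) →ₗ[𝕜] X :=
    (constrVec n fun t => 𝐚 ^ t • x).coprod (constrVec n fun t => k⁻¹ • 𝐚 ^ t • w)
  have hφx : ∀ t, φ (xvec 𝕜 n t) = 𝐚 ^ t • x := by
    intro t
    rcases Nat.lt_or_ge t n with h | h
    · simp [φ, xvec, constrVec_vec _ _ h]
    · rw [xvec_of_le h, a_pow_smul_of_le h, map_zero]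
  have hφy : ∀ t, φ (yvec 𝕜 n t) = k⁻¹ • 𝐚 ^ t • w := by
    intro t
    rcases Nat.lt_or_ge t n with h | h
    · simp [φ, yvec, constrVec_vec _ _ h]
    · rw [yvec_of_le h, a_pow_smul_of_le h, map_zero, smul_zero]
  have comm : ∀ g, φ ∘ₗ coverGen q n i.1 i.2.val g =
      Algebra.lsmul 𝕜 𝕜 X (D.of 𝕜 n q g) ∘ₗ φ := by
    intro g
    refine linearMap_ext_xyvec (fun t ht => ?_) (fun t ht => ?_) <;>
      simp only [LinearMap.comp_apply, Algebra.lsmul_coe, hφx, hφy]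
    · have hwt := hw.a_pow hq0 t
      cases g with
      | a => rw [coverGen_a_x, hφx, pow_succ', mul_smul]
      | b => rw [coverGen_b_x, map_smul, hφx, hwt.1]
      | c => rw [coverGen_c_x, map_smul, hφx, hwt.2]; congr 2; ring
      | d =>
        cases t with
        | zero => rw [coverGen_d_x_zero _ _ hi, hφy, pow_zero, one_smul, hd]
        | succ t =>
          rw [coverGen_d_x _ _ ht hi, map_add, map_smul, map_smul, hφx, hφy,
            hw.d_a_pow hq0 hq1 (l := (i.1 : ℕ)) (by ring), hd, smul_comm (𝐚 ^ (t + 1)) k⁻¹,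
            ← mul_smul (𝐚 ^ (t + 1)),
            ← pow_add, show t + 1 + (n - i.1 - 1) = n - i.1 + t by omega]
    · have hwt := hwu.a_pow hq0 t
      rw [smul_comm _ k⁻¹]
      cases g with
      | a => rw [coverGen_a_y, hφy, pow_succ', mul_smul]
      | b =>
        rw [coverGen_b_y, map_smul, hφy, hwt.1, smul_comm,
          ← zpow_add_n hq0 hq (_ - _ + _)]
        congr 3; push_cast [Nat.cast_sub hi.le]; ring
      | c =>
        rw [coverGen_c_y, map_smul, hφy, hwt.2, smul_comm]
        congr 3; push_cast [Nat.cast_sub hi.le]; ring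
      | d =>
        cases t with
        | zero => rw [coverGen_d_y_zero, map_zero, pow_zero, one_smul, hu, smul_zero]
        | succ t =>
          -- The weight of w gives the parameter 2n - l, whereas the model uses n - l; `al` is
          -- n-periodic in this argument.
          rw [coverGen_d_y _ _ ht, map_smul, hφy, hwu.d_a_pow hq0 hq1 (l := n - (i.1 : ℕ) + n) (by
            push_cast [Nat.cast_sub hi.le]; ring), hu, smul_zero, smul_zero, add_zero,
            al_add_n hq0 hq, smul_comm]
  refine ⟨homOfGen _ (satisfies_coverGen hn hq i.1.2.1 hi) φ
    fun g x => LinearMap.congr_fun (comm g) x, ?_⟩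
  exact (homOfGen_apply _ _ _ _ _).trans ((hφx 0).trans (by rw [pow_zero, one_smul]))

/-- The projective cover of `V(l, s)`. -/
def cover : DMod.{u, u} 𝕜 n q :=
  if h : (i.1 : ℕ) < n then qmod hn hq i h else simple hn hq i

/-- For l = n, `d_pow_smul_genSpace` says d x = 0, and a^n = 0 always. So V(n,s) itself represents
`genSpace` and is its own projective cover. -/
theorem genSpace_eq_primSpace_of_eq {s : ℕ} (hn : 2 ≤ n) (hq : IsPrimitiveRoot q n) {x : X}
    (hx : x ∈ genSpace n q X n s) : x ∈ primSpace n q X n s := by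
  refine ⟨hx.1, ?_, a_pow_smul x⟩
  have := d_pow_smul_genSpace hn hq (by omega) le_rfl hx
  rwa [Nat.sub_self, zero_add, pow_one] at this

/-- The projective cover has a generator that represents the functor `genSpace`. -/
theorem exists_cover_gen : ∃ g ∈ genSpace n q (cover hn hq i) i.1 i.2.val,
    (∀ N : Submodule (D 𝕜 n q) (cover hn hq i), g ∈ N → N = ⊤) ∧
    ∀ (X : Type w) [AddCommGroup X] [Module 𝕜 X] [Module (D 𝕜 n q) X]
      [IsScalarTower 𝕜 (D 𝕜 n q) X], ∀ x ∈ genSpace n q X i.1 i.2.val,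
      ∃ f : cover hn hq i →ₗ[D 𝕜 n q] X, f g = x := by
  by_cases h : (i.1 : ℕ) < n
  · rw [cover, dif_pos h]
    exact ⟨_, qx_zero_mem_genSpace hn hq i h, qx_zero_generates hn hq i h,
      fun X _ _ _ _ x hx => exists_hom_qmod hn hq i h hx⟩
  · rw [cover, dif_neg h]
    have h1 : (i.1 : ℕ) = n := le_antisymm i.1.2.2 (not_lt.1 h)
    refine ⟨_, primSpace_le_genSpace _ _ (svec_zero_mem_primSpace hn hq i),
      svec_zero_generates hn hq i, fun X _ _ _ _ x hx => exists_hom_simple hn hq i ?_⟩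
    rw [h1] at hx ⊢
    exact genSpace_eq_primSpace_of_eq hn hq hx

instance : Module.Finite 𝕜 (cover hn hq i) := by
  by_cases h : (i.1 : ℕ) < n
  · rw [cover, dif_pos h]; infer_instance
  · rw [cover, dif_neg h]; infer_instance

theorem finrank_hom_cover : Module.finrank 𝕜 (cover hn hq i →ₗ[D 𝕜 n q] X) =
    Module.finrank 𝕜 (genSpace n q X i.1 i.2.val) := by
  obtain ⟨g, hg, hgen, huniv⟩ := exists_cover_gen hn hq i
  exact finrank_hom_eq g hgen _ (fun f => map_mem_genSpace f hg) (huniv X)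

theorem finrank_hom_simple : Module.finrank 𝕜 (simple hn hq i →ₗ[D 𝕜 n q] X) =
    Module.finrank 𝕜 (primSpace n q X i.1 i.2.val) :=
  finrank_hom_eq (svec hn hq i 0) (svec_zero_generates hn hq i) _
    (fun f => map_mem_primSpace f (svec_zero_mem_primSpace hn hq i))
    (fun _ hx => exists_hom_simple hn hq i hx)

end Cover

/-! ### Complementary pairs -/

section Index

variable {n : ℕ} [NeZero n]

theorem Idx.ext_val {i j : Idx n} (h1 : (i.1 : ℕ) = j.1) (h2 : i.2 = j.2) : i = j :=
  Prod.ext (Subtype.ext h1) h2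

theorem Idx.compl_fst {i : Idx n} (h : (i.1 : ℕ) < n) : (i.compl.1 : ℕ) = n - i.1 := by
  rw [Idx.compl, dif_pos h]

theorem Idx.compl_snd {i : Idx n} (h : (i.1 : ℕ) < n) : i.compl.2 = i.2 + (i.1 : ℕ) := by
  rw [Idx.compl, dif_pos h]

theorem Idx.compl_fst_lt {i : Idx n} (h : (i.1 : ℕ) < n) : (i.compl.1 : ℕ) < n := by
  have : 1 ≤ (i.1 : ℕ) := i.1.2.1
  rw [Idx.compl_fst h]; omega

theorem Idx.compl_compl {i : Idx n} (h : (i.1 : ℕ) < n) : i.compl.compl = i := by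
  refine Idx.ext_val ?_ ?_
  · rw [Idx.compl_fst (Idx.compl_fst_lt h), Idx.compl_fst h]; omega
  · rw [Idx.compl_snd (Idx.compl_fst_lt h), Idx.compl_snd h, Idx.compl_fst h, Nat.cast_sub h.le]
    simp

/-- The second coordinate moves by ℓ, which is nonzero modulo n, so even ℓ = n/2 yields two distinct
pairs. This keeps the two cases of Hom(P(i),P(j)) disjoint. -/
theorem Idx.compl_ne {i : Idx n} (h : (i.1 : ℕ) < n) : i.compl ≠ i := by
  intro he
  have h1 : 1 ≤ (i.1 : ℕ) := i.1.2.1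
  have h2 := Idx.compl_snd h
  rw [he, left_eq_add, ZMod.natCast_eq_zero_iff] at h2
  exact absurd (Nat.le_of_dvd (by omega) h2) (by omega)

theorem eq_of_cast_eq {a b : ℕ} (h : (a : ZMod n) = b) (ha : 1 ≤ a) (ha' : a ≤ n) (hb : 1 ≤ b)
    (hb' : b ≤ n) : a = b :=
  ((ZMod.natCast_eq_natCast_iff _ _ _).1 h).eq_of_abs_lt (by rw [abs_lt]; omega)

theorem eq_of_cast_eq_of_lt {a b : ℕ} (h : (a : ZMod n) = b) (ha' : a < n) (hb' : b < n) :
    a = b :=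
  ((ZMod.natCast_eq_natCast_iff _ _ _).1 h).eq_of_abs_lt (by rw [abs_lt]; omega)

end Index

/-! ### Dimensions of Hom spaces between the V(i) and P(j) -/

section HomDimensions

variable {𝕜 : Type u} [Field 𝕜] {n : ℕ} [NeZero n] {q : 𝕜}

local notation "𝐚" => D.of 𝕜 n q Gen.a
local notation "𝐛" => D.of 𝕜 n q Gen.b
local notation "𝐜" => D.of 𝕜 n q Gen.c
local notation "𝐝" => D.of 𝕜 n q Gen.d

theorem finrank_eq_of_coord {X F : Type*} [AddCommGroup X] [Module 𝕜 X] [AddCommGroup F]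
    [Module 𝕜 F] (W : Submodule 𝕜 X) (φ : X →ₗ[𝕜] F) (h1 : ∀ x ∈ W, φ x = 0 → x = 0)
    (h2 : ∀ y, ∃ x ∈ W, φ x = y) : Module.finrank 𝕜 W = Module.finrank 𝕜 F := by
  refine (LinearEquiv.ofBijective (φ.domRestrict W) ⟨?_, fun y => ?_⟩).finrank_eq
  · rw [← LinearMap.ker_eq_bot, LinearMap.ker_eq_bot']
    exact fun x hx => Subtype.ext (h1 x x.2 hx)
  · obtain ⟨x, hx, rfl⟩ := h2 y
    exact ⟨⟨x, hx⟩, rfl⟩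

variable (hn : 2 ≤ n) (hq : IsPrimitiveRoot q n) (i j : Idx n)

/-- On V(j) the operator ad is diagonal, with eigenvalue zero only at v_1; the weights of b and c
there recover the pair. -/
theorem scoord_genSpace {x : simple hn hq j} (hx : x ∈ genSpace n q (simple hn hq j) i.1 i.2.val)
    {t : Fin j.1} (h : scoord hn hq j t x ≠ 0) : (t : ℕ) = 0 ∧ i = j := by
  have hj : (j.1 : ℕ) ≤ n := j.1.2.2
  have hz := congrArg (scoord hn hq j t) hx.2
  rw [scoord_z, scoord_z, map_zero, ← mul_assoc, mul_eq_zero, or_iff_left h, mul_self_eq_zero] at hz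
  have ht : (t : ℕ) = 0 := by
    by_contra h0
    exact al_ne_zero_of_lt hn hq h0 t.2 hj hz
  refine ⟨ht, ?_⟩
  have hb := congrArg (scoord hn hq j t) hx.1.1
  have hc := congrArg (scoord hn hq j t) hx.1.2
  rw [scoord_b, map_smul, smul_eq_mul, mul_left_inj' h, zpow_eq_zpow_iff hn hq, ht] at hb
  rw [scoord_c, map_smul, smul_eq_mul, mul_left_inj' h, zpow_eq_zpow_iff hn hq, ht] at hc
  push_cast at hb hc
  simp only [ZMod.natCast_zmod_val, add_zero] at hb hc
  refine Idx.ext_val (eq_of_cast_eq ?_ i.1.2.1 i.1.2.2 j.1.2.1 j.1.2.2) hb.symm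
  rw [hb] at hc
  exact (sub_right_inj.1 hc).symm

theorem simple_eq_zero {x : simple hn hq j} (h : ∀ t, scoord hn hq j t x = 0) : x = 0 := by
  apply (simpleEquiv hn hq j).symm.injective
  rw [map_zero]
  ext t
  exact h t

theorem finrank_genSpace_simple : Module.finrank 𝕜 (genSpace n q (simple hn hq j) i.1 i.2.val) =
    if i = j then 1 else 0 := by
  split_ifs with hij
  · subst hij
    have h0 : 0 < (i.1 : ℕ) := i.1.2.1
    rw [finrank_eq_of_coord _ (scoord hn hq i ⟨0, h0⟩), Module.finrank_self]
    · intro x hx h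
      refine simple_eq_zero hn hq i fun t => ?_
      by_contra ht
      have := (scoord_genSpace hn hq i i hx ht).1
      rw [show t = ⟨0, h0⟩ from Fin.ext this] at ht
      exact ht h
    · intro y
      refine ⟨y • svec hn hq i 0, Submodule.smul_mem _ _
        (primSpace_le_genSpace _ _ (svec_zero_mem_primSpace hn hq i)), ?_⟩
      rw [map_smul, scoord_svec, if_pos rfl, smul_eq_mul, mul_one]
  · have : genSpace n q (simple hn hq j) i.1 i.2.val = ⊥ := by
      rw [Submodule.eq_bot_iff]
      intro x hx
      refine simple_eq_zero hn hq j fun t => ?_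
      by_contra ht
      exact hij (scoord_genSpace hn hq i j hx ht).2
    rw [this, finrank_bot]

theorem finrank_primSpace_simple : Module.finrank 𝕜 (primSpace n q (simple hn hq j) i.1 i.2.val) =
    if i = j then 1 else 0 := by
  rw [← finrank_genSpace_simple hn hq i j]
  suffices h : primSpace n q (simple hn hq j) i.1 i.2.val =
      genSpace n q (simple hn hq j) i.1 i.2.val by rw [h]
  refine le_antisymm (primSpace_le_genSpace _ _) fun x hx => ?_
  by_cases hij : i = j
  · subst hij
    have h0 : 0 < (i.1 : ℕ) := i.1.2.1
    rw [eq_smul_svec_zero hn hq i (h0 := h0) (x := x) fun t ht => ?_]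
    · exact Submodule.smul_mem _ _ (svec_zero_mem_primSpace hn hq i)
    · by_contra h
      exact ht (scoord_genSpace hn hq i i hx h).1
  · have : x = 0 := by
      refine simple_eq_zero hn hq j fun t => ?_
      by_contra ht
      exact hij (scoord_genSpace hn hq i j hx ht).2
    rw [this]; exact Submodule.zero_mem _

section QCoord

variable (hj : (j.1 : ℕ) < n)

/-- The coordinates of a vector of `P(l, s)` with respect to the `x_t`. -/
def xcoord (t : Fin n) : qmod hn hq j hj →ₗ[𝕜] 𝕜 :=
  LinearMap.proj t ∘ₗ LinearMap.fst 𝕜 _ _ ∘ₗ (qmodEquiv hn hq j hj).symm.toLinearMap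

/-- The coordinates of a vector of `P(l, s)` with respect to the `y_t`. -/
def ycoord (t : Fin n) : qmod hn hq j hj →ₗ[𝕜] 𝕜 :=
  LinearMap.proj t ∘ₗ LinearMap.snd 𝕜 _ _ ∘ₗ (qmodEquiv hn hq j hj).symm.toLinearMap

theorem xcoord_qx (t : Fin n) (t' : ℕ) :
    xcoord hn hq j hj t (qx hn hq j hj t') = if (t : ℕ) = t' then 1 else 0 := by
  simp [xcoord, qx, xvec, vec]

theorem xcoord_qy (t : Fin n) (t' : ℕ) : xcoord hn hq j hj t (qy hn hq j hj t') = 0 := by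
  simp [xcoord, qy, yvec]

theorem ycoord_qx (t : Fin n) (t' : ℕ) : ycoord hn hq j hj t (qx hn hq j hj t') = 0 := by
  simp [ycoord, qx, xvec]

theorem ycoord_qy (t : Fin n) (t' : ℕ) :
    ycoord hn hq j hj t (qy hn hq j hj t') = if (t : ℕ) = t' then 1 else 0 := by
  simp [ycoord, qy, yvec, vec]

theorem qmod_eq_of_coord {x y : qmod hn hq j hj}
    (h : ∀ t, xcoord hn hq j hj t x = xcoord hn hq j hj t y)
    (h' : ∀ t, ycoord hn hq j hj t x = ycoord hn hq j hj t y) : x = y := by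
  apply (qmodEquiv hn hq j hj).symm.injective
  exact Prod.ext (funext h) (funext h')

theorem xcoord_of_b (t : Fin n) (x : qmod hn hq j hj) :
    xcoord hn hq j hj t (𝐛 • x) = q ^ ((j.2.val : ℤ) + t) * xcoord hn hq j hj t x := by
  refine LinearMap.congr_fun (f := xcoord hn hq j hj t ∘ₗ Algebra.lsmul 𝕜 𝕜 _ 𝐛)
    (g := q ^ ((j.2.val : ℤ) + t) • xcoord hn hq j hj t)
    (qmod_ext _ _ _ _ (fun t' ht' => ?_) fun t' ht' => ?_) x
  · simp only [LinearMap.comp_apply, Algebra.lsmul_coe, (isWt_qx hn hq j hj t').1, map_smul,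
      LinearMap.smul_apply, xcoord_qx]
    split_ifs with h
    · rw [h]
    · simp
  · simp only [LinearMap.comp_apply, Algebra.lsmul_coe, (isWt_qy hn hq j hj t').1, map_smul,
      LinearMap.smul_apply, xcoord_qy, smul_zero]

theorem xcoord_of_c (t : Fin n) (x : qmod hn hq j hj) : xcoord hn hq j hj t (𝐜 • x) =
    q ^ ((t : ℤ) + 1 - j.2.val - (j.1 : ℕ)) * xcoord hn hq j hj t x := by
  refine LinearMap.congr_fun (f := xcoord hn hq j hj t ∘ₗ Algebra.lsmul 𝕜 𝕜 _ 𝐜)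
    (g := q ^ ((t : ℤ) + 1 - j.2.val - (j.1 : ℕ)) • xcoord hn hq j hj t)
    (qmod_ext _ _ _ _ (fun t' ht' => ?_) fun t' ht' => ?_) x
  · simp only [LinearMap.comp_apply, Algebra.lsmul_coe, (isWt_qx hn hq j hj t').2, map_smul,
      LinearMap.smul_apply, xcoord_qx]
    split_ifs with h
    · rw [h]
    · simp
  · simp only [LinearMap.comp_apply, Algebra.lsmul_coe, (isWt_qy hn hq j hj t').2, map_smul,
      LinearMap.smul_apply, xcoord_qy, smul_zero]

theorem ycoord_of_b (t : Fin n) (x : qmod hn hq j hj) : ycoord hn hq j hj t (𝐛 • x) =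
    q ^ ((j.2.val : ℤ) + (j.1 : ℕ) + t) * ycoord hn hq j hj t x := by
  refine LinearMap.congr_fun (f := ycoord hn hq j hj t ∘ₗ Algebra.lsmul 𝕜 𝕜 _ 𝐛)
    (g := q ^ ((j.2.val : ℤ) + (j.1 : ℕ) + t) • ycoord hn hq j hj t)
    (qmod_ext _ _ _ _ (fun t' ht' => ?_) fun t' ht' => ?_) x
  · simp only [LinearMap.comp_apply, Algebra.lsmul_coe, (isWt_qx hn hq j hj t').1, map_smul,
      LinearMap.smul_apply, ycoord_qx, smul_zero]
  · simp only [LinearMap.comp_apply, Algebra.lsmul_coe, (isWt_qy hn hq j hj t').1, map_smul,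
      LinearMap.smul_apply, ycoord_qy]
    split_ifs with h
    · rw [h]
    · simp

theorem ycoord_of_c (t : Fin n) (x : qmod hn hq j hj) : ycoord hn hq j hj t (𝐜 • x) =
    q ^ ((t : ℤ) + 1 - j.2.val - n) * ycoord hn hq j hj t x := by
  refine LinearMap.congr_fun (f := ycoord hn hq j hj t ∘ₗ Algebra.lsmul 𝕜 𝕜 _ 𝐜)
    (g := q ^ ((t : ℤ) + 1 - j.2.val - n) • ycoord hn hq j hj t)
    (qmod_ext _ _ _ _ (fun t' ht' => ?_) fun t' ht' => ?_) x
  · simp only [LinearMap.comp_apply, Algebra.lsmul_coe, (isWt_qx hn hq j hj t').2, map_smul,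
      LinearMap.smul_apply, ycoord_qx, smul_zero]
  · simp only [LinearMap.comp_apply, Algebra.lsmul_coe, (isWt_qy hn hq j hj t').2, map_smul,
      LinearMap.smul_apply, ycoord_qy]
    split_ifs with h
    · rw [h]
    · simp

theorem xcoord_of_z (t : Fin n) (x : qmod hn hq j hj) : xcoord hn hq j hj t (𝐚 • 𝐝 • x) =
    al q (j.1 : ℕ) t * xcoord hn hq j hj t x := by
  refine LinearMap.congr_fun
    (f := xcoord hn hq j hj t ∘ₗ Algebra.lsmul 𝕜 𝕜 _ 𝐚 ∘ₗ Algebra.lsmul 𝕜 𝕜 _ 𝐝)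
    (g := al q (j.1 : ℕ) t • xcoord hn hq j hj t)
    (qmod_ext _ _ _ _ (fun t' ht' => ?_) fun t' ht' => ?_) x
  · simp only [LinearMap.comp_apply, Algebra.lsmul_coe, z_qx hn hq j hj ht', map_add, map_smul,
      LinearMap.smul_apply, xcoord_qx, xcoord_qy, smul_zero, add_zero]
    split_ifs with h
    · rw [h]
    · simp
  · simp only [LinearMap.comp_apply, Algebra.lsmul_coe, z_qy hn hq j hj ht', map_smul,
      LinearMap.smul_apply, xcoord_qy, smul_zero]

/-- The extra term is the non-diagonal part of ad, coming from the gluing of x_t to y_(n-l+t). For t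
below n - l the subtraction in the index is truncated, but then the factor in front is zero. -/
theorem ycoord_of_z (t : Fin n) (x : qmod hn hq j hj) : ycoord hn hq j hj t (𝐚 • 𝐝 • x) =
    al q (n - (j.1 : ℕ)) t * ycoord hn hq j hj t x +
      (if n - (j.1 : ℕ) ≤ t then q ^ (t - (n - (j.1 : ℕ))) else 0) *
        xcoord hn hq j hj ⟨t - (n - j.1), by omega⟩ x := by
  refine LinearMap.congr_fun
    (f := ycoord hn hq j hj t ∘ₗ Algebra.lsmul 𝕜 𝕜 _ 𝐚 ∘ₗ Algebra.lsmul 𝕜 𝕜 _ 𝐝)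
    (g := al q (n - (j.1 : ℕ)) t • ycoord hn hq j hj t +
      (if n - (j.1 : ℕ) ≤ t then q ^ (t - (n - (j.1 : ℕ))) else 0) •
        xcoord hn hq j hj ⟨t - (n - j.1), by omega⟩)
    (qmod_ext _ _ _ _ (fun t' ht' => ?_) fun t' ht' => ?_) x
  · simp only [LinearMap.comp_apply, Algebra.lsmul_coe, z_qx hn hq j hj ht', map_add, map_smul,
      LinearMap.smul_apply, LinearMap.add_apply, xcoord_qx, ycoord_qx, ycoord_qy, smul_zero,
      zero_add]
    by_cases h : (t : ℕ) = n - j.1 + t'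
    · rw [if_pos h, if_pos (by omega), if_pos (by omega),
        show (t : ℕ) - (n - (j.1 : ℕ)) = t' by omega]
    · rw [if_neg h]
      by_cases h1 : n - (j.1 : ℕ) ≤ t
      · rw [if_neg (show ¬ (t : ℕ) - (n - (j.1 : ℕ)) = t' by omega)]; simp
      · rw [if_neg h1]; simp
  · simp only [LinearMap.comp_apply, Algebra.lsmul_coe, z_qy hn hq j hj ht', map_smul,
      LinearMap.smul_apply, LinearMap.add_apply, ycoord_qy, xcoord_qy, smul_zero, add_zero]
    split_ifs with h
    · rw [h]
    · simp

include hn hq in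
theorem al_eq_zero_cases {l t : ℕ} (hl : l < n) (ht : t < n) (h : al q l t = 0) :
    t = 0 ∨ t = l := by
  rcases (al_eq_zero_iff hn hq _ _).1 h with h | h
  · left; exact eq_of_cast_eq_of_lt (by exact_mod_cast h) ht (by omega)
  · right; exact eq_of_cast_eq_of_lt (by exact_mod_cast h) ht hl

variable {x : qmod hn hq j hj}
  (hx : x ∈ genSpace n q (qmod hn hq j hj) i.1 i.2.val)

include hx

theorem xcoord_weight {t : Fin n} (h : xcoord hn hq j hj t x ≠ 0) :
    i.2 = j.2 + (t : ℕ) ∧ ((i.1 : ℕ) : ZMod n) + 2 * (t : ℕ) = (j.1 : ℕ) := by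
  have hb := congrArg (xcoord hn hq j hj t) hx.1.1
  have hc := congrArg (xcoord hn hq j hj t) hx.1.2
  rw [xcoord_of_b, map_smul, smul_eq_mul, mul_left_inj' h, zpow_eq_zpow_iff hn hq] at hb
  rw [xcoord_of_c, map_smul, smul_eq_mul, mul_left_inj' h, zpow_eq_zpow_iff hn hq] at hc
  push_cast at hb hc
  simp only [ZMod.natCast_zmod_val] at hb hc
  exact ⟨hb.symm, by linear_combination hc + hb⟩

theorem ycoord_weight {t : Fin n} (h : ycoord hn hq j hj t x ≠ 0) :
    i.2 = j.2 + (j.1 : ℕ) + (t : ℕ) ∧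
      ((i.1 : ℕ) : ZMod n) + 2 * (t : ℕ) = -((j.1 : ℕ) : ZMod n) := by
  have hb := congrArg (ycoord hn hq j hj t) hx.1.1
  have hc := congrArg (ycoord hn hq j hj t) hx.1.2
  rw [ycoord_of_b, map_smul, smul_eq_mul, mul_left_inj' h, zpow_eq_zpow_iff hn hq] at hb
  rw [ycoord_of_c, map_smul, smul_eq_mul, mul_left_inj' h, zpow_eq_zpow_iff hn hq] at hc
  push_cast at hb hc
  simp only [ZMod.natCast_zmod_val, ZMod.natCast_self, sub_zero] at hb hc
  exact ⟨hb.symm, by linear_combination hc + hb⟩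

/-- On x-coordinates ad is diagonal, so (ad)² x = 0 leaves only x_0, of the weight belonging to j,
and x_l, of the weight belonging to its complement. -/
theorem eq_or_eq_compl_of_xcoord {t : Fin n} (h : xcoord hn hq j hj t x ≠ 0) :
    i = j ∨ i = j.compl := by
  obtain ⟨h1, h2⟩ := xcoord_weight hn hq i j hj hx h
  have hz := congrArg (xcoord hn hq j hj t) hx.2
  rw [xcoord_of_z, xcoord_of_z, map_zero, ← mul_assoc, mul_eq_zero, or_iff_left h,
    mul_self_eq_zero] at hz
  have hl := j.1.2.1
  rcases al_eq_zero_cases hn hq hj t.2 hz with ht | ht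
  · left
    rw [ht, Nat.cast_zero] at h1 h2
    exact Idx.ext_val (eq_of_cast_eq (by linear_combination h2) i.1.2.1 i.1.2.2 hl hj.le)
      (by rw [h1, add_zero])
  · right
    rw [ht] at h1 h2
    refine Idx.ext_val ?_ (by rw [Idx.compl_snd hj, h1])
    rw [Idx.compl_fst hj]
    refine eq_of_cast_eq ?_ i.1.2.1 i.1.2.2 (by omega) (by omega)
    rw [Nat.cast_sub hj.le, ZMod.natCast_self]
    linear_combination h2

/-- Once the x-coordinates vanish, ad is diagonal on the y-coordinates too. The surviving vectors
are y_0, with the weight of the complement, and y_(n-l), with the weight of j. -/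
theorem eq_or_eq_compl_of_ycoord (h0 : ∀ t, xcoord hn hq j hj t x = 0) {t : Fin n}
    (h : ycoord hn hq j hj t x ≠ 0) : i = j ∨ i = j.compl := by
  obtain ⟨h1, h2⟩ := ycoord_weight hn hq i j hj hx h
  have hz := congrArg (ycoord hn hq j hj t) hx.2
  rw [ycoord_of_z, ycoord_of_z, map_zero, xcoord_of_z, h0, mul_zero, mul_zero, add_zero, mul_zero,
    add_zero, ← mul_assoc, mul_eq_zero, or_iff_left h, mul_self_eq_zero, ← Nat.cast_sub hj.le] at hz
  have hl : 1 ≤ (j.1 : ℕ) := j.1.2.1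
  rcases al_eq_zero_cases hn hq (by omega) t.2 hz with ht | ht
  · right
    rw [ht, Nat.cast_zero] at h1 h2
    refine Idx.ext_val ?_ (by rw [Idx.compl_snd hj, h1, add_zero])
    rw [Idx.compl_fst hj]
    refine eq_of_cast_eq ?_ i.1.2.1 i.1.2.2 (by omega) (by omega)
    rw [Nat.cast_sub hj.le, ZMod.natCast_self]
    linear_combination h2
  · left
    rw [ht, Nat.cast_sub hj.le, ZMod.natCast_self] at h1 h2
    exact Idx.ext_val (eq_of_cast_eq (by linear_combination h2) i.1.2.1 i.1.2.2 hl hj.le)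
      (by rw [h1]; ring)

theorem eq_zero_of_mem_genSpace (h1 : i ≠ j) (h2 : i ≠ j.compl) : x = 0 := by
  have h0 : ∀ t, xcoord hn hq j hj t x = 0 := fun t => by
    by_contra h
    rcases eq_or_eq_compl_of_xcoord hn hq i j hj hx h with h | h
    · exact h1 h
    · exact h2 h
  refine qmod_eq_of_coord hn hq j hj (fun t => by rw [h0, map_zero]) fun t => ?_
  rw [map_zero]
  by_contra h
  rcases eq_or_eq_compl_of_ycoord hn hq i j hj hx h0 h with h | h
  · exact h1 h
  · exact h2 h

omit hx

/-- Within each string of length n the eigenvalues of b are distinct, so each string contributes one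
basis vector. -/
theorem eq_of_mem_genSpace_self (hx : x ∈ genSpace n q (qmod hn hq j hj) j.1 j.2.val) :
    x = xcoord hn hq j hj 0 x • qx hn hq j hj 0 +
      ycoord hn hq j hj ⟨n - j.1, Nat.sub_lt (by omega) j.1.2.1⟩ x • qy hn hq j hj (n - j.1) := by
  have hl : 1 ≤ (j.1 : ℕ) := j.1.2.1
  refine qmod_eq_of_coord hn hq j hj (fun t => ?_) fun t => ?_
  · rw [map_add, map_smul, map_smul, xcoord_qx, xcoord_qy, smul_zero, add_zero]
    split_ifs with h
    · rw [smul_eq_mul, mul_one]; congr 2; exact Fin.ext (by simpa using h)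
    · rw [smul_zero]
      by_contra h0
      have h1 := (xcoord_weight hn hq j j hj hx h0).1
      rw [left_eq_add] at h1
      exact h (eq_of_cast_eq_of_lt (by exact_mod_cast h1) t.2 (by omega))
  · rw [map_add, map_smul, map_smul, ycoord_qx, ycoord_qy, smul_zero, zero_add]
    split_ifs with h
    · rw [smul_eq_mul, mul_one]; congr 2; exact Fin.ext h
    · rw [smul_zero]
      by_contra h0
      have h1 := (ycoord_weight hn hq j j hj hx h0).1
      rw [add_assoc, left_eq_add] at h1
      refine h (eq_of_cast_eq_of_lt ?_ t.2 (by omega))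
      rw [Nat.cast_sub hj.le, ZMod.natCast_self]
      linear_combination h1

theorem eq_of_mem_genSpace_compl
    (hx : x ∈ genSpace n q (qmod hn hq j hj) j.compl.1 j.compl.2.val) :
    x = xcoord hn hq j hj ⟨j.1, hj⟩ x • qx hn hq j hj j.1 +
      ycoord hn hq j hj 0 x • qy hn hq j hj 0 := by
  have hl : 1 ≤ (j.1 : ℕ) := j.1.2.1
  refine qmod_eq_of_coord hn hq j hj (fun t => ?_) fun t => ?_
  · rw [map_add, map_smul, map_smul, xcoord_qx, xcoord_qy, smul_zero, add_zero]
    split_ifs with h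
    · rw [smul_eq_mul, mul_one]; congr 2; exact Fin.ext (by simpa using h)
    · rw [smul_zero]
      by_contra h0
      have h1 := (xcoord_weight hn hq _ j hj hx h0).1
      rw [Idx.compl_snd hj, add_right_inj] at h1
      exact h (eq_of_cast_eq_of_lt h1.symm t.2 hj)
  · rw [map_add, map_smul, map_smul, ycoord_qx, ycoord_qy, smul_zero, zero_add]
    split_ifs with h
    · rw [smul_eq_mul, mul_one]; congr 2; exact Fin.ext (by simpa using h)
    · rw [smul_zero]
      by_contra h0
      have h1 := (ycoord_weight hn hq _ j hj hx h0).1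
      rw [Idx.compl_snd hj, left_eq_add] at h1
      exact h (eq_of_cast_eq_of_lt (by exact_mod_cast h1) t.2 (by omega))

theorem qy_mid_mem_primSpace :
    qy hn hq j hj (n - j.1) ∈ primSpace n q (qmod hn hq j hj) j.1 j.2.val := by
  refine ⟨?_, d_qy_mid hn hq j hj, ?_⟩
  · refine (isWt_qy hn hq j hj _).congr hn hq ?_ ?_ <;> push_cast [Nat.cast_sub hj.le] <;>
      simp only [ZMod.natCast_self] <;> ring
  · rw [a_pow_qy, qy_of_le]; omega

theorem qy_zero_mem_genSpace :
    qy hn hq j hj 0 ∈ genSpace n q (qmod hn hq j hj) j.compl.1 j.compl.2.val := by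
  refine ⟨?_, by rw [d_qy_zero]; simp⟩
  refine (isWt_qy hn hq j hj _).congr hn hq ?_ ?_ <;> (try rw [Idx.compl_fst hj]) <;>
    push_cast [Nat.cast_sub hj.le] <;>
    simp only [ZMod.natCast_zmod_val, Idx.compl_snd hj, ZMod.natCast_self] <;> ring

theorem d_qx_mid : 𝐝 • qx hn hq j hj j.1 = q ^ (j.1 : ℕ) • qy hn hq j hj (n - 1) := by
  have hl : 1 ≤ (j.1 : ℕ) := j.1.2.1
  obtain ⟨k, hk⟩ : ∃ k, (j.1 : ℕ) = k + 1 := ⟨j.1 - 1, by omega⟩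
  have h := d_qx hn hq j hj (t := k) (by omega)
  rw [← Nat.cast_succ, Nat.succ_eq_add_one, ← hk, al_self, zero_smul, zero_add] at h
  rw [h]
  congr 2
  omega

theorem qx_mid_mem_genSpace :
    qx hn hq j hj j.1 ∈ genSpace n q (qmod hn hq j hj) j.compl.1 j.compl.2.val := by
  have hl : 1 ≤ (j.1 : ℕ) := j.1.2.1
  refine ⟨?_, ?_⟩
  · refine (isWt_qx hn hq j hj _).congr hn hq ?_ ?_ <;> (try rw [Idx.compl_fst hj]) <;>
      push_cast [Nat.cast_sub hj.le] <;>
      simp only [ZMod.natCast_zmod_val, Idx.compl_snd hj, ZMod.natCast_self] <;> ring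
  · rw [d_qx_mid, smul_comm 𝐚 (q ^ (j.1 : ℕ)), a_qy, show n - 1 + 1 = n by omega, qy_of_le _ _ _ _ le_rfl]
    simp

/-- The bases are x_0, y_(n-l) for i = j and x_l, y_0 for the complement, matching two composition
factors of each of the two types. -/
theorem finrank_genSpace_qmod : Module.finrank 𝕜 (genSpace n q (qmod hn hq j hj) i.1 i.2.val) =
    if i = j ∨ i = j.compl then 2 else 0 := by
  have h2 : Module.finrank 𝕜 (𝕜 × 𝕜) = 2 := by simp
  split_ifs with hij
  · rcases hij with rfl | rfl
    · rw [finrank_eq_of_coord _ ((xcoord hn hq i hj 0).prod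
        (ycoord hn hq i hj ⟨n - i.1, Nat.sub_lt (by omega) i.1.2.1⟩)), h2]
      · intro x hx h
        have h := Prod.mk_eq_zero.1 h
        rw [eq_of_mem_genSpace_self hn hq i hj hx, h.1, h.2, zero_smul, zero_smul, add_zero]
      · intro y
        refine ⟨y.1 • qx hn hq i hj 0 + y.2 • qy hn hq i hj (n - i.1), Submodule.add_mem _
          (Submodule.smul_mem _ _ (qx_zero_mem_genSpace hn hq i hj)) (Submodule.smul_mem _ _
          (primSpace_le_genSpace _ _ (qy_mid_mem_primSpace hn hq i hj))), ?_⟩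
        refine Prod.ext (Eq.trans (map_add (xcoord _ _ _ _ _) _ _) ?_)
          (Eq.trans (map_add (ycoord _ _ _ _ _) _ _) ?_) <;>
        simp [xcoord_qx, xcoord_qy, ycoord_qx, ycoord_qy]
    · rw [finrank_eq_of_coord _ ((xcoord hn hq j hj ⟨j.1, hj⟩).prod
        (ycoord hn hq j hj 0)), h2]
      · intro x hx h
        have h := Prod.mk_eq_zero.1 h
        rw [eq_of_mem_genSpace_compl hn hq j hj hx, h.1, h.2, zero_smul, zero_smul, add_zero]
      · intro y
        refine ⟨y.1 • qx hn hq j hj j.1 + y.2 • qy hn hq j hj 0, Submodule.add_mem _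
          (Submodule.smul_mem _ _ (qx_mid_mem_genSpace hn hq j hj)) (Submodule.smul_mem _ _
          (qy_zero_mem_genSpace hn hq j hj)), ?_⟩
        refine Prod.ext (Eq.trans (map_add (xcoord _ _ _ _ _) _ _) ?_)
          (Eq.trans (map_add (ycoord _ _ _ _ _) _ _) ?_) <;>
        simp [xcoord_qx, xcoord_qy, ycoord_qx, ycoord_qy]
  · rw [not_or] at hij
    have : genSpace n q (qmod hn hq j hj) i.1 i.2.val = ⊥ := by
      rw [Submodule.eq_bot_iff]
      intro x hx
      exact eq_zero_of_mem_genSpace hn hq i j hj hx hij.1 hij.2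
    rw [this, finrank_bot]

/-- Of the four vectors spanning the spaces above only y_(n-l) qualifies: d does not kill x_0 or
x_l, and a^(n-l) y_0 = y_(n-l) is nonzero. Thus V(j) is the socle of P(j). -/
theorem finrank_primSpace_qmod : Module.finrank 𝕜 (primSpace n q (qmod hn hq j hj) i.1 i.2.val) =
    if i = j then 1 else 0 := by
  have hl : 1 ≤ (j.1 : ℕ) := j.1.2.1
  split_ifs with hij
  · subst hij
    rw [finrank_eq_of_coord _ (ycoord hn hq i hj ⟨n - i.1, Nat.sub_lt (by omega) i.1.2.1⟩),
      Module.finrank_self]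
    · intro x hx h
      have h1 := eq_of_mem_genSpace_self hn hq i hj (primSpace_le_genSpace _ _ hx)
      rw [h, zero_smul, add_zero] at h1
      have h2 := congrArg (ycoord hn hq i hj ⟨n - i.1 - 1, by omega⟩) hx.2.1
      rw [h1, smul_comm, d_qx_zero, map_smul, ycoord_qy, if_pos rfl, map_zero, smul_eq_mul,
        mul_one] at h2
      rw [h1, h2, zero_smul]
    · intro y
      refine ⟨y • qy hn hq i hj (n - i.1), Submodule.smul_mem _ _
        (qy_mid_mem_primSpace hn hq i hj), ?_⟩
      rw [map_smul, ycoord_qy, if_pos rfl, smul_eq_mul, mul_one]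
  · have : primSpace n q (qmod hn hq j hj) i.1 i.2.val = ⊥ := by
      rw [Submodule.eq_bot_iff]
      intro x hx
      by_cases h2 : i = j.compl
      · subst h2
        have h1 := eq_of_mem_genSpace_compl hn hq j hj (primSpace_le_genSpace _ _ hx)
        have h2 := congrArg (ycoord hn hq j hj ⟨n - 1, by omega⟩) hx.2.1
        have h3 := congrArg (ycoord hn hq j hj ⟨n - j.1, by omega⟩) hx.2.2
        have hq0 : q ≠ 0 := hq.ne_zero (by omega)
        rw [h1, smul_add, smul_comm 𝐝, smul_comm 𝐝, d_qx_mid, d_qy_zero, smul_zero, add_zero,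
          map_smul, map_smul, ycoord_qy, if_pos rfl, map_zero, smul_eq_mul, smul_eq_mul, mul_one,
          mul_eq_zero, or_iff_left (pow_ne_zero _ hq0)] at h2
        rw [h2, zero_smul, zero_add] at h1
        rw [h1, Idx.compl_fst hj, smul_comm, a_pow_qy, map_smul, ycoord_qy, if_pos (by simp),
          map_zero, smul_eq_mul, mul_one] at h3
        rw [h1, h3, zero_smul]
      · exact eq_zero_of_mem_genSpace hn hq i j hj (primSpace_le_genSpace _ _ hx) hij h2
    rw [this, finrank_bot]

end QCoord

end HomDimensions

/-! ### Projectivity and projective covers -/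

section Projective

variable {𝕜 : Type u} [Field 𝕜] [CharZero 𝕜] {n : ℕ} [NeZero n] {q : 𝕜}

local notation "𝐚" => D.of 𝕜 n q Gen.a
local notation "𝐛" => D.of 𝕜 n q Gen.b
local notation "𝐜" => D.of 𝕜 n q Gen.c
local notation "𝐝" => D.of 𝕜 n q Gen.d

variable (hn : 2 ≤ n) (hq : IsPrimitiveRoot q n) (i : Idx n)

/-- The generator x goes to the projecting element e, and 1 goes back to x. The composite fixes x,
since e acts as the identity on `genSpace`. -/
theorem exists_retract_cover : ∃ (f : cover hn hq i →ₗ[D 𝕜 n q] D 𝕜 n q)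
    (g : D 𝕜 n q →ₗ[D 𝕜 n q] cover hn hq i), g ∘ₗ f = LinearMap.id := by
  obtain ⟨e, he, he'⟩ := exists_genProj.{u, u} hn hq i.1.2.1 i.1.2.2 i.2.val
  obtain ⟨x, hx, hgen, huniv⟩ := exists_cover_gen.{u, u} hn hq i
  obtain ⟨f, hf⟩ := huniv (D 𝕜 n q) e he
  refine ⟨f, LinearMap.toSpanSingleton _ _ x, ?_⟩
  rw [← LinearMap.eqLocus_eq_top]
  refine hgen _ ?_
  rw [LinearMap.mem_eqLocus, LinearMap.comp_apply, hf, LinearMap.toSpanSingleton_apply,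
    he' _ x hx, LinearMap.id_apply]

theorem projective_cover : Module.Projective (D 𝕜 n q) (cover hn hq i) := by
  obtain ⟨f, g, h⟩ := exists_retract_cover hn hq i
  exact Module.Projective.of_split f g h

/-- If N and the kernel span everything, N contains some m over v_1. Then e m lies in `genSpace`, so
it equals x_0 + β y_(n-l). Applying ad gives y_(n-l) in N, hence x_0 in N, and x_0 generates. -/
theorem exists_superfluous : ∃ f : cover hn hq i →ₗ[D 𝕜 n q] simple hn hq i,
    Function.Surjective f ∧
      ∀ N : Submodule (D 𝕜 n q) (cover hn hq i), N ⊔ LinearMap.ker f = ⊤ → N = ⊤ := by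
  have hv := svec_zero_mem_primSpace hn hq i
  have hsurj : ∀ {X : Type u} [AddCommGroup X] [Module (D 𝕜 n q) X]
      (f : X →ₗ[D 𝕜 n q] simple hn hq i) (x : X), f x = svec hn hq i 0 →
      Function.Surjective f := fun f x hx => by
    rw [← LinearMap.range_eq_top]
    exact svec_zero_generates hn hq i _ ⟨x, hx⟩
  obtain ⟨e, he, he'⟩ := exists_genProj.{u, u} hn hq i.1.2.1 i.1.2.2 i.2.val
  by_cases h : (i.1 : ℕ) < n
  · rw [cover, dif_pos h]
    obtain ⟨f, hf⟩ := exists_hom_qmod hn hq i h (primSpace_le_genSpace _ _ hv)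
    refine ⟨f, hsurj f _ hf, fun N hN => qx_zero_generates hn hq i h N ?_⟩
    have hl : 1 ≤ (i.1 : ℕ) := i.1.2.1
    have hz : 𝐚 • 𝐝 • qx hn hq i h 0 = qy hn hq i h (n - i.1) := by
      rw [d_qx_zero, a_qy]; congr 1; omega
    have hfy : f (qy hn hq i h (n - i.1)) = 0 := by
      rw [← hz, map_smul, map_smul, hf, hv.2.1, smul_zero]
    obtain ⟨m, hm, k, hk, hmk⟩ := Submodule.mem_sup.1
      (show qx hn hq i h 0 ∈ N ⊔ LinearMap.ker f by rw [hN]; trivial)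
    have hfm : f m = svec hn hq i 0 := by
      rw [← hf, ← hmk, map_add, LinearMap.mem_ker.1 hk, add_zero]
    have hem : e • m ∈ genSpace n q (qmod hn hq i h) i.1 i.2.val :=
      map_mem_genSpace (LinearMap.toSpanSingleton (D 𝕜 n q) _ m) he
    have hfem : f (e • m) = svec hn hq i 0 := by
      rw [map_smul, hfm, he' _ _ (primSpace_le_genSpace _ _ hv)]
    have h1 := eq_of_mem_genSpace_self hn hq i h hem
    set α := xcoord hn hq i h 0 (e • m)
    set β := ycoord hn hq i h ⟨n - i.1, Nat.sub_lt (by omega) i.1.2.1⟩ (e • m)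
    have hα : α = 1 := by
      rw [h1, map_add, LinearMap.map_smul_of_tower, LinearMap.map_smul_of_tower, hf, hfy,
        smul_zero, add_zero, ← sub_eq_zero] at hfem
      nth_rewrite 2 [← one_smul 𝕜 (svec hn hq i 0)] at hfem
      rw [← sub_smul, smul_eq_zero, or_iff_left (svec_ne_zero hn hq i hl), sub_eq_zero] at hfem
      exact hfem
    rw [hα, one_smul] at h1
    have hy : qy hn hq i h (n - i.1) ∈ N := by
      have h2 := N.smul_mem 𝐚 (N.smul_mem 𝐝 (N.smul_mem e hm))
      rwa [h1, smul_add, smul_add, hz, smul_comm 𝐝 β, d_qy_mid, smul_zero, smul_zero,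
        add_zero] at h2
    have h3 := N.sub_mem (N.smul_mem e hm) (N.smul_of_tower_mem β hy)
    rwa [h1, add_sub_cancel_right] at h3
  · rw [cover, dif_neg h]
    refine ⟨LinearMap.id, Function.surjective_id, fun N hN => ?_⟩
    rwa [LinearMap.ker_id, sup_bot_eq] at hN

theorem isProjectiveCover_cover : IsProjectiveCover (cover hn hq i) (simple hn hq i) :=
  ⟨projective_cover hn hq i, exists_superfluous hn hq i⟩

/-- The lift φ of f through f' is onto because the kernel of f' is superfluous. It has a section ψ,
which is onto because the kernel of f is superfluous; so φ is injective. -/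
theorem IsProjectiveCover.nonempty_equiv {P : DMod.{u, v} 𝕜 n q} {P' : DMod.{u, w} 𝕜 n q}
    {S : DMod.{u, u} 𝕜 n q} (h : IsProjectiveCover P S) (h' : IsProjectiveCover P' S) :
    Nonempty (P ≃ₗ[D 𝕜 n q] P') := by
  obtain ⟨hP, f, hf, hsf⟩ := h
  obtain ⟨hP', f', hf', hsf'⟩ := h'
  obtain ⟨φ, hφ⟩ := Module.projective_lifting_property f' f hf'
  have hφs : Function.Surjective φ := by
    rw [← LinearMap.range_eq_top]
    refine hsf' _ ?_
    rw [eq_top_iff]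
    intro x _
    obtain ⟨y, hy⟩ := hf (f' x)
    refine Submodule.mem_sup.2 ⟨φ y, ⟨y, rfl⟩, x - φ y, ?_, by abel⟩
    rw [LinearMap.mem_ker, map_sub, ← LinearMap.comp_apply, hφ, hy, sub_self]
  obtain ⟨ψ, hψ⟩ := Module.projective_lifting_property φ LinearMap.id hφs
  have hψs : Function.Surjective ψ := by
    rw [← LinearMap.range_eq_top]
    refine hsf _ ?_
    rw [eq_top_iff]
    intro x _
    refine Submodule.mem_sup.2 ⟨ψ (φ x), ⟨φ x, rfl⟩, x - ψ (φ x), ?_, by abel⟩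
    have h1 : φ (ψ (φ x)) = φ x := LinearMap.congr_fun hψ (φ x)
    rw [LinearMap.mem_ker, map_sub, ← hφ, LinearMap.comp_apply, LinearMap.comp_apply, h1, sub_self]
  refine ⟨LinearEquiv.ofBijective φ ⟨fun x y hxy => ?_, hφs⟩⟩
  obtain ⟨x, rfl⟩ := hψs x
  obtain ⟨y, rfl⟩ := hψs y
  have hx : φ (ψ x) = x := LinearMap.congr_fun hψ x
  have hy : φ (ψ y) = y := LinearMap.congr_fun hψ y
  rw [hx, hy] at hxy
  rw [hxy]

end Projective

/-! ### Every simple module is some V(i) -/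

section Classification

open Polynomial in
-- X^n - 1 is the product of the factors X - r over the n-th roots of unity r. Applying the factors
-- at y one by one to a nonzero vector, some nonzero intermediate vector is killed by the next
-- factor.
theorem exists_eigenvector {𝕜 : Type u} [Field 𝕜] {n : ℕ} {q : 𝕜} {X : Type*} [AddCommGroup X]
    [Module 𝕜 X] [Module (D 𝕜 n q) X] [IsScalarTower 𝕜 (D 𝕜 n q) X] (hn : 2 ≤ n)
    (hq : IsPrimitiveRoot q n) {y : D 𝕜 n q} (hy : y ^ n = 1) (W : Submodule 𝕜 X)
    (hW : ∀ x ∈ W, y • x ∈ W) (h : W ≠ ⊥) : ∃ x ∈ W, x ≠ 0 ∧ ∃ s : ℕ, y • x = q ^ (s : ℤ) • x := by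
  have key : ∀ S : Finset 𝕜, ∀ x ∈ W, x ≠ 0 →
      aeval y (∏ r ∈ S, (Polynomial.X - C r)) • x = 0 →
      ∃ r ∈ S, ∃ x ∈ W, x ≠ 0 ∧ y • x = r • x := by
    classical
    intro S
    induction S using Finset.induction_on with
    | empty => intro x _ hx0 hx; simp at hx; exact absurd hx hx0
    | insert r S hr ih =>
      intro x hx hx0 h
      by_cases h1 : y • x = r • x
      · exact ⟨r, Finset.mem_insert_self _ _, x, hx, hx0, h1⟩
      · rw [Finset.prod_insert hr, mul_comm, map_mul, mul_smul, map_sub, aeval_X, aeval_C, sub_smul,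
          algebraMap_smul] at h
        obtain ⟨r', hr', h2⟩ := ih _ (W.sub_mem (hW x hx) (W.smul_mem r hx)) (sub_ne_zero.2 h1) h
        exact ⟨r', Finset.mem_insert_of_mem hr', h2⟩
  obtain ⟨x, hx, hx0⟩ := W.ne_bot_iff.1 h
  obtain ⟨r, hr, x, hx, hx0, hyx⟩ := key (nthRootsFinset n (1 : 𝕜)) x hx hx0 (by
    rw [← X_pow_sub_one_eq_prod (by omega) hq]
    simp [hy])
  have : NeZero n := ⟨by omega⟩
  obtain ⟨s, _, rfl⟩ := hq.eq_pow_of_pow_eq_one ((mem_nthRootsFinset (by omega) 1).1 hr)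
  exact ⟨x, hx, hx0, s, by rw [zpow_natCast, hyx]⟩

variable {𝕜 : Type u} [Field 𝕜] {n : ℕ} [NeZero n] {q : 𝕜}

local notation "𝐚" => D.of 𝕜 n q Gen.a
local notation "𝐛" => D.of 𝕜 n q Gen.b
local notation "𝐜" => D.of 𝕜 n q Gen.c
local notation "𝐝" => D.of 𝕜 n q Gen.d

theorem exists_cast_eq (z : ZMod n) : ∃ l : ℕ, 1 ≤ l ∧ l ≤ n ∧ (l : ZMod n) = z := by
  rcases Nat.eq_zero_or_pos z.val with h | h
  · exact ⟨n, NeZero.pos n, le_rfl, by rw [ZMod.natCast_self, eq_comm, ← ZMod.val_eq_zero, h]⟩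
  · exact ⟨z.val, h, (ZMod.val_lt z).le, ZMod.natCast_zmod_val z⟩

/-- The kernel of d is nonzero by nilpotency and stable under b and c, hence contains a common
eigenvector. Its weights q^s, q^t determine ℓ in 1, …, n by ℓ ≡ 1 - s - t. -/
theorem exists_genSpace_ne_zero {X : Type*} [AddCommGroup X] [Module 𝕜 X] [Module (D 𝕜 n q) X]
    [IsScalarTower 𝕜 (D 𝕜 n q) X] [Nontrivial X] (hn : 2 ≤ n) (hq : IsPrimitiveRoot q n) :
    ∃ i : Idx n, ∃ x ∈ genSpace n q X i.1 i.2.val, x ≠ 0 := by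
  have hq0 : q ≠ 0 := hq.ne_zero (by omega)
  obtain ⟨x, hx0⟩ := exists_ne (0 : X)
  have hex : ∃ m, 𝐝 ^ m • x = 0 := ⟨n, d_pow_smul x⟩
  classical
  obtain ⟨m, hm⟩ : ∃ m, Nat.find hex = m + 1 := Nat.exists_eq_succ_of_ne_zero fun h => hx0 (by
    simpa [h] using Nat.find_spec hex)
  have h1 : 𝐝 ^ m • x ≠ 0 := Nat.find_min hex (by omega)
  have h2 : 𝐝 • 𝐝 ^ m • x = 0 := by
    rw [← mul_smul, ← pow_succ', ← hm]; exact Nat.find_spec hex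
  let W : Submodule 𝕜 X := LinearMap.ker (Algebra.lsmul 𝕜 𝕜 X 𝐝)
  have hWmem : ∀ x, x ∈ W ↔ 𝐝 • x = 0 := fun x => Iff.rfl
  obtain ⟨x1, hx1, hx10, s, hs⟩ := exists_eigenvector hn hq D.satisfies_of.b_pow W (by
    intro x hx
    rw [hWmem] at hx ⊢
    rw [db_smul, hx, smul_zero, smul_zero]) (W.ne_bot_iff.2 ⟨_, h2, h1⟩)
  let W' : Submodule 𝕜 X := W ⊓ LinearMap.ker (Algebra.lsmul 𝕜 𝕜 X 𝐛 - q ^ (s : ℤ) • LinearMap.id)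
  have hWmem' : ∀ x, x ∈ W' ↔ 𝐝 • x = 0 ∧ 𝐛 • x - q ^ (s : ℤ) • x = 0 := fun x => Iff.rfl
  obtain ⟨x2, hx2, hx20, t, ht⟩ := exists_eigenvector hn hq D.satisfies_of.c_pow W' (by
    intro x hx
    rw [hWmem'] at hx ⊢
    rw [dc_smul, hx.1, smul_zero, smul_zero, bc_smul, sub_eq_zero.1 hx.2, smul_comm, sub_self]
    exact ⟨rfl, rfl⟩) (W'.ne_bot_iff.2 ⟨x1, (hWmem' _).2 ⟨hx1, sub_eq_zero.2 hs⟩, hx10⟩)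
  rw [hWmem', sub_eq_zero] at hx2
  obtain ⟨l, hl1, hln, hl⟩ := exists_cast_eq (n := n) (1 - s - t)
  refine ⟨(⟨l, hl1, hln⟩, (s : ZMod n)), x2, ⟨?_, by simp [hx2.1]⟩, hx20⟩
  refine IsWt.congr hn hq ?_ ?_ (⟨hx2.2, ht⟩ : IsWt n q s t x2)
  · push_cast; rw [ZMod.natCast_zmod_val]
  · push_cast; rw [ZMod.natCast_zmod_val, hl]; ring

/-- A nonzero vector of `genSpace` gives a surjection from the cover. Its kernel is maximal, so it
contains the superfluous kernel of the map to V(i); hence V(i) maps nontrivially onto X. -/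
theorem exists_equiv_simple [CharZero 𝕜] (hn : 2 ≤ n) (hq : IsPrimitiveRoot q n) (X : Type w)
    [AddCommGroup X] [Module 𝕜 X] [Module (D 𝕜 n q) X] [IsScalarTower 𝕜 (D 𝕜 n q) X]
    [hX : IsSimpleModule (D 𝕜 n q) X] : ∃ i, Nonempty (simple hn hq i ≃ₗ[D 𝕜 n q] X) := by
  have : Nontrivial X := IsSimpleModule.nontrivial (D 𝕜 n q) X
  obtain ⟨i, x, hx, hx0⟩ := exists_genSpace_ne_zero (X := X) hn hq
  obtain ⟨g, hg, hgen, huniv⟩ := exists_cover_gen.{u, w} hn hq i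
  obtain ⟨φ, hφ⟩ := huniv X x hx
  obtain ⟨f, hf, hsf⟩ := exists_superfluous hn hq i
  have hφs : Function.Surjective φ := LinearMap.surjective_of_ne_zero (by
    rintro rfl; exact hx0 hφ.symm)
  have hco : IsCoatom (LinearMap.ker φ) := by
    rw [← isSimpleModule_iff_isCoatom]
    exact IsSimpleModule.congr (φ.quotKerEquivOfSurjective hφs)
  have hle : LinearMap.ker f ≤ LinearMap.ker φ := by
    by_contra h
    have h1 : LinearMap.ker φ ⊔ LinearMap.ker f = ⊤ := hco.2 _ (left_lt_sup.2 h)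
    exact hco.1 (hsf _ h1)
  have := isSimpleModule_simple hn hq i
  let ψ : simple hn hq i →ₗ[D 𝕜 n q] X :=
    (LinearMap.ker f).liftQ φ hle ∘ₗ (f.quotKerEquivOfSurjective hf).symm.toLinearMap
  have hψ : ψ ≠ 0 := by
    intro h
    apply hx0
    have h1 : ψ (f g) = φ g := by
      have : (f.quotKerEquivOfSurjective hf).symm (f g) = Submodule.Quotient.mk g := by
        rw [LinearEquiv.symm_apply_eq]; rfl
      simp only [ψ, LinearMap.comp_apply, LinearEquiv.coe_coe, this]
      rfl
    rw [← hφ, ← h1, h, LinearMap.zero_apply]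
  exact ⟨i, ⟨LinearEquiv.ofBijective ψ (LinearMap.bijective_of_ne_zero hψ)⟩⟩

end Classification

/-! ### D_n is spanned by the monomials a^i b^j c^k d^l -/

section FiniteDimensional

open Pointwise

variable {𝕜 : Type u} [Field 𝕜] {n : ℕ} {q : 𝕜}

local notation "𝐚" => D.of 𝕜 n q Gen.a
local notation "𝐛" => D.of 𝕜 n q Gen.b
local notation "𝐜" => D.of 𝕜 n q Gen.c
local notation "𝐝" => D.of 𝕜 n q Gen.d

theorem finite_range_pow_of_eq_zero {A : Type*} [Ring A] {y : A} (h : y ^ n = 0) :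
    (Set.range fun i : ℕ => y ^ i).Finite := by
  refine ((Set.finite_Iic n).image fun i : ℕ => y ^ i).subset ?_
  rintro _ ⟨i, rfl⟩
  rcases le_total i n with hi | hi
  · exact ⟨i, hi, rfl⟩
  · exact ⟨n, Set.mem_Iic.2 le_rfl, by simp only [pow_eq_zero_of_le hi h, h]⟩

theorem finite_range_pow_of_eq_one {A : Type*} [Ring A] {y : A} (hn : 0 < n) (h : y ^ n = 1) :
    (Set.range fun i : ℕ => y ^ i).Finite := by
  refine ((Set.finite_Iic n).image fun i : ℕ => y ^ i).subset ?_
  rintro _ ⟨i, rfl⟩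
  exact ⟨i % n, (Nat.mod_lt i hn).le, (pow_eq_pow_mod i h).symm⟩

/-- `D_n` is finite-dimensional. -/
theorem finite_D (hn : 0 < n) : Module.Finite 𝕜 (D 𝕜 n q) := by
  have H := D.satisfies_of (𝕜 := 𝕜) (n := n) (q := q)
  set T : Set (D 𝕜 n q) := (Set.range fun i : ℕ => 𝐚 ^ i) * ((Set.range fun i : ℕ => 𝐛 ^ i) *
    ((Set.range fun i : ℕ => 𝐜 ^ i) * (Set.range fun i : ℕ => 𝐝 ^ i)))
  have hT : T.Finite := (finite_range_pow_of_eq_zero H.a_pow).mul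
    ((finite_range_pow_of_eq_one hn H.b_pow).mul
      ((finite_range_pow_of_eq_one hn H.c_pow).mul (finite_range_pow_of_eq_zero H.d_pow)))
  set S : Submodule 𝕜 (D 𝕜 n q) := Submodule.span 𝕜 T
  have hmem : ∀ i j k l : ℕ, 𝐚 ^ i * (𝐛 ^ j * (𝐜 ^ k * 𝐝 ^ l)) ∈ S := fun i j k l =>
    Submodule.subset_span (Set.mul_mem_mul ⟨i, rfl⟩ (Set.mul_mem_mul ⟨j, rfl⟩
      (Set.mul_mem_mul ⟨k, rfl⟩ ⟨l, rfl⟩)))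
  have hext : ∀ y : D 𝕜 n q, (∀ i j k l : ℕ, y * (𝐚 ^ i * (𝐛 ^ j * (𝐜 ^ k * 𝐝 ^ l))) ∈ S) →
      ∀ x ∈ S, y * x ∈ S := by
    intro y hy x hx
    induction hx using Submodule.span_induction with
    | mem x hx =>
      obtain ⟨_, ⟨i, rfl⟩, _, ⟨_, ⟨j, rfl⟩, _, ⟨_, ⟨k, rfl⟩, _, ⟨l, rfl⟩, rfl⟩, rfl⟩, rfl⟩ := hx
      exact hy i j k l
    | zero => rw [mul_zero]; exact S.zero_mem
    | add x x' _ _ h1 h2 => rw [mul_add]; exact S.add_mem h1 h2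
    | smul r x _ h => rw [mul_smul_comm]; exact S.smul_mem r h
  have ha : ∀ x ∈ S, 𝐚 * x ∈ S := hext _ fun i j k l => by
    rw [← mul_assoc, ← pow_succ']; exact hmem _ _ _ _
  have hb : ∀ x ∈ S, 𝐛 * x ∈ S := hext _ fun i j k l => by
    rw [← mul_assoc, qcomm_pow H.ba, smul_mul_assoc, mul_assoc, ← mul_assoc 𝐛, ← pow_succ']
    exact S.smul_mem _ (hmem _ _ _ _)
  have hc : ∀ x ∈ S, 𝐜 * x ∈ S := hext _ fun i j k l => by
    have h1 : 𝐜 * 𝐛 ^ j = 𝐛 ^ j * 𝐜 := (Commute.pow_left (H.bc : Commute 𝐛 𝐜) j).symm.eq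
    rw [← mul_assoc, qcomm_pow H.ca, smul_mul_assoc, mul_assoc, ← mul_assoc 𝐜, h1, mul_assoc,
      ← mul_assoc 𝐜, ← pow_succ']
    exact S.smul_mem _ (hmem _ _ _ _)
  -- Induction on the power of a: da = q ad + 1 - bc reduces d a^(i+1) to a times the case i and to
  -- products already known to lie in S.
  have hd : ∀ x ∈ S, 𝐝 * x ∈ S := hext _ fun i j k l => by
    induction i with
    | zero =>
      rw [pow_zero, one_mul, ← mul_assoc, qcomm_pow H.db, smul_mul_assoc, mul_assoc,
        ← mul_assoc 𝐝, qcomm_pow H.dc, smul_mul_assoc, mul_smul_comm, mul_assoc, ← pow_succ']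
      have := hmem 0 j k (l + 1)
      rw [pow_zero, one_mul] at this
      exact S.smul_mem _ (S.smul_mem _ this)
    | succ i ih =>
      have h1 : 𝐝 * 𝐚 = q • (𝐚 * 𝐝) + (1 - 𝐛 * 𝐜) := by rw [← H.da]; abel
      rw [pow_succ', mul_assoc, ← mul_assoc, h1, add_mul, sub_mul, smul_mul_assoc, one_mul,
        mul_assoc, mul_assoc 𝐛]
      exact S.add_mem (S.smul_mem _ (ha _ ih))
        (S.sub_mem (hmem _ _ _ _) (hb _ (hc _ (hmem _ _ _ _))))
  have htop : S = ⊤ := by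
    rw [Submodule.eq_top_iff']
    refine D.mem_of_closed S ?_ fun g => ?_
    · simpa using hmem 0 0 0 0
    · cases g
      exacts [ha, hb, hc, hd]
  exact Module.finite_def.2 (htop ▸ Submodule.fg_span hT)

end FiniteDimensional

/-! ### Tensor products of modules, maps and finite products -/

section Tensor

variable {𝕜 : Type u} [Field 𝕜] {n : ℕ} {q : 𝕜} (hq : IsPrimitiveRoot q n)

local notation "𝐚" => D.of 𝕜 n q Gen.a
local notation "𝐛" => D.of 𝕜 n q Gen.b
local notation "𝐜" => D.of 𝕜 n q Gen.c
local notation "𝐝" => D.of 𝕜 n q Gen.d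

/-- The pure tensor `x ⊗ y` as an element of the tensor product of `D_n`-modules. -/
def tm (M : DMod.{u, v} 𝕜 n q) (N : DMod.{u, w} 𝕜 n q) : M →ₗ[𝕜] N →ₗ[𝕜] DMod.tensor hq M N :=
  TensorProduct.mk 𝕜 M N

/-- The identity, as a linear equivalence from the tensor product of vector spaces to the tensor
product of modules. -/
def tensorEquiv (M : DMod.{u, v} 𝕜 n q) (N : DMod.{u, w} 𝕜 n q) :
    M ⊗[𝕜] N ≃ₗ[𝕜] DMod.tensor hq M N := LinearEquiv.refl 𝕜 _

variable {M : DMod.{u, v} 𝕜 n q} {N : DMod.{u, w} 𝕜 n q}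

theorem of_smul_tensor (g : Gen) (x : M) (y : N) : D.of 𝕜 n q g • tm hq M N x y =
    tensorEquiv hq M N (Module.endTensorEndAlgHom (R := 𝕜) (S := 𝕜) (A := 𝕜)
      (Algebra.TensorProduct.map M.rep N.rep (comulGen 𝕜 n q g)) (x ⊗ₜ y)) := by
  have : comulGen 𝕜 n q g = comul hq (D.of 𝕜 n q g) := (D.lift_of _ _ g).symm
  rw [this]
  rfl

theorem a_tm (x : M) (y : N) :
    𝐚 • tm hq M N x y = tm hq M N (𝐚 • x) (𝐛 • y) + tm hq M N x (𝐚 • y) := by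
  rw [of_smul_tensor, comulGen, map_add, map_add, Algebra.TensorProduct.map_tmul,
    Algebra.TensorProduct.map_tmul, LinearMap.add_apply, Module.endTensorEndAlgHom_apply,
    Module.endTensorEndAlgHom_apply, map_one]
  rfl

theorem d_tm (x : M) (y : N) :
    𝐝 • tm hq M N x y = tm hq M N (𝐝 • x) (𝐜 • y) + tm hq M N x (𝐝 • y) := by
  rw [of_smul_tensor, comulGen, map_add, map_add, Algebra.TensorProduct.map_tmul,
    Algebra.TensorProduct.map_tmul, LinearMap.add_apply, Module.endTensorEndAlgHom_apply,
    Module.endTensorEndAlgHom_apply, map_one]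
  rfl

theorem b_tm (x : M) (y : N) : 𝐛 • tm hq M N x y = tm hq M N (𝐛 • x) (𝐛 • y) := by
  rw [of_smul_tensor, comulGen, Algebra.TensorProduct.map_tmul, Module.endTensorEndAlgHom_apply]
  rfl

theorem c_tm (x : M) (y : N) : 𝐜 • tm hq M N x y = tm hq M N (𝐜 • x) (𝐜 • y) := by
  rw [of_smul_tensor, comulGen, Algebra.TensorProduct.map_tmul, Module.endTensorEndAlgHom_apply]
  rfl

theorem tensor_ext {R : Type*} [AddCommGroup R] [Module 𝕜 R] {f g : DMod.tensor hq M N →ₗ[𝕜] R}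
    (h : ∀ x y, f (tm hq M N x y) = g (tm hq M N x y)) : f = g := by
  have : f ∘ₗ (tensorEquiv hq M N).toLinearMap = g ∘ₗ (tensorEquiv hq M N).toLinearMap :=
    TensorProduct.ext' h
  ext x
  obtain ⟨x, rfl⟩ := (tensorEquiv hq M N).surjective x
  exact LinearMap.congr_fun this x

instance [Module.Finite 𝕜 M] [Module.Finite 𝕜 N] : Module.Finite 𝕜 (DMod.tensor hq M N) :=
  Module.Finite.equiv (tensorEquiv hq M N)

theorem finrank_tensor : Module.finrank 𝕜 (DMod.tensor hq M N) =
    Module.finrank 𝕜 M * Module.finrank 𝕜 N := by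
  rw [← (tensorEquiv hq M N).finrank_eq, Module.finrank_tensorProduct]

universe v' w'

variable {M' : DMod.{u, v'} 𝕜 n q} {N' : DMod.{u, w'} 𝕜 n q}

/-- The linear map underlying the tensor product of two `D_n`-linear maps. -/
def tensorMapAux (f : M →ₗ[D 𝕜 n q] M') (g : N →ₗ[D 𝕜 n q] N') :
    DMod.tensor hq M N →ₗ[𝕜] DMod.tensor hq M' N' :=
  (tensorEquiv hq M' N').toLinearMap ∘ₗ
    TensorProduct.map (f.restrictScalars 𝕜) (g.restrictScalars 𝕜) ∘ₗ
      (tensorEquiv hq M N).symm.toLinearMap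

theorem tensorMapAux_tm (f : M →ₗ[D 𝕜 n q] M') (g : N →ₗ[D 𝕜 n q] N') (x : M) (y : N) :
    tensorMapAux hq f g (tm hq M N x y) = tm hq M' N' (f x) (g y) := rfl

/-- The tensor product of two `D_n`-linear maps. -/
def tensorMap (f : M →ₗ[D 𝕜 n q] M') (g : N →ₗ[D 𝕜 n q] N') :
    DMod.tensor hq M N →ₗ[D 𝕜 n q] DMod.tensor hq M' N' :=
  homOfComm (tensorMapAux hq f g) fun h x => by
    refine LinearMap.congr_fun (f := tensorMapAux hq f g ∘ₗ Algebra.lsmul 𝕜 𝕜 _ (D.of 𝕜 n q h))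
      (g := Algebra.lsmul 𝕜 𝕜 _ (D.of 𝕜 n q h) ∘ₗ tensorMapAux hq f g)
      (tensor_ext hq fun x y => ?_) x
    simp only [LinearMap.comp_apply, Algebra.lsmul_coe, tensorMapAux_tm]
    cases h <;> simp only [a_tm, b_tm, c_tm, d_tm, tensorMapAux_tm, map_add, map_smul]

theorem tensorMap_tm (f : M →ₗ[D 𝕜 n q] M') (g : N →ₗ[D 𝕜 n q] N') (x : M) (y : N) :
    tensorMap hq f g (tm hq M N x y) = tm hq M' N' (f x) (g y) := rfl

theorem tensor_hom_ext {R : Type*} [AddCommGroup R] [Module 𝕜 R] [Module (D 𝕜 n q) R]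
    [IsScalarTower 𝕜 (D 𝕜 n q) R] {f g : DMod.tensor hq M N →ₗ[D 𝕜 n q] R}
    (h : ∀ x y, f (tm hq M N x y) = g (tm hq M N x y)) : f = g := by
  have := tensor_ext hq (f := f.restrictScalars 𝕜) (g := g.restrictScalars 𝕜) h
  ext x
  exact LinearMap.congr_fun this x

/-- The tensor product of two isomorphisms. -/
def tensorCongr (e : M ≃ₗ[D 𝕜 n q] M') (e' : N ≃ₗ[D 𝕜 n q] N') :
    DMod.tensor hq M N ≃ₗ[D 𝕜 n q] DMod.tensor hq M' N' :=
  LinearEquiv.ofLinearMap (tensorMap hq e.toLinearMap e'.toLinearMap)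
    (tensorMap hq e.symm.toLinearMap e'.symm.toLinearMap)
    (tensor_hom_ext hq fun x y => by simp [tensorMap_tm])
    (tensor_hom_ext hq fun x y => by simp [tensorMap_tm])

theorem nonempty_tensorPowSucc_equiv (e : M ≃ₗ[D 𝕜 n q] M') (k : ℕ) :
    Nonempty (DMod.tensorPowSucc hq M k ≃ₗ[D 𝕜 n q] DMod.tensorPowSucc hq M' k) := by
  induction k with
  | zero => exact ⟨e⟩
  | succ k ih =>
    obtain ⟨e'⟩ := ih
    exact ⟨tensorCongr hq e' e⟩

/-- Tensoring from the right preserves finite direct products. -/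
theorem nonempty_tensor_pi_equiv {ι : Type} [Fintype ι] (T : ι → DMod.{u, w} 𝕜 n q)
    (V : DMod.{u, v'} 𝕜 n q) (e : M ≃ₗ[D 𝕜 n q] ∀ t, T t) :
    Nonempty (DMod.tensor hq M V ≃ₗ[D 𝕜 n q] ∀ t, DMod.tensor hq (T t) V) := by
  classical
  -- The projections p and inclusions s satisfy p s = 1, mixed composites vanish, and the sum of s p
  -- is 1. These identities survive tensoring with V and give the inverse maps F and G.
  let p : ∀ t, M →ₗ[D 𝕜 n q] T t := fun t => LinearMap.proj t ∘ₗ e.toLinearMap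
  let s : ∀ t, T t →ₗ[D 𝕜 n q] M := fun t => e.symm.toLinearMap ∘ₗ LinearMap.single (D 𝕜 n q) (fun t => T t) t
  have hps : ∀ t x, p t (s t x) = x := fun t x => by simp [p, s]
  have hps' : ∀ t t' x, t' ≠ t → p t (s t' x) = 0 := fun t t' x h => by
    simp [p, s, h.symm]
  have hsum : ∀ x, ∑ t, s t (p t x) = x := fun x => by
    apply e.injective
    ext t
    rw [map_sum, Finset.sum_apply, Finset.sum_eq_single t]
    · exact hps t _
    · intro t' _ h
      exact hps' t t' _ h
    · simp
  let F : DMod.tensor hq M V →ₗ[D 𝕜 n q] ∀ t, DMod.tensor hq (T t) V :=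
    LinearMap.pi fun t => tensorMap hq (p t) LinearMap.id
  let G : (∀ t, DMod.tensor hq (T t) V) →ₗ[D 𝕜 n q] DMod.tensor hq M V :=
    ∑ t, tensorMap hq (s t) LinearMap.id ∘ₗ LinearMap.proj t
  refine ⟨LinearEquiv.ofLinearMap F G ?_ ?_⟩
  · refine LinearMap.ext fun x => funext fun t => ?_
    have h1 : tensorMap hq (p t) (LinearMap.id (M := V)) ∘ₗ tensorMap hq (s t) LinearMap.id =
        LinearMap.id := tensor_hom_ext hq fun x y => by
      simp [tensorMap_tm, hps]
    have h2 : ∀ t', t' ≠ t →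
        tensorMap hq (p t) (LinearMap.id (M := V)) ∘ₗ tensorMap hq (s t') LinearMap.id = 0 :=
      fun t' h => tensor_hom_ext hq fun x y => by
        simp [tensorMap_tm, hps' t t' _ h]
    simp only [F, G, LinearMap.comp_apply, LinearMap.pi_apply, LinearMap.sum_apply, map_sum,
      LinearMap.proj_apply, LinearMap.id_apply]
    rw [Finset.sum_eq_single t]
    · exact LinearMap.congr_fun h1 (x t)
    · intro t' _ h
      exact LinearMap.congr_fun (h2 t' h) (x t')
    · simp
  · refine tensor_hom_ext hq fun x y => ?_
    simp only [F, G, LinearMap.comp_apply, LinearMap.pi_apply, LinearMap.sum_apply,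
      LinearMap.proj_apply, LinearMap.id_apply, tensorMap_tm]
    rw [← LinearMap.sum_apply, ← map_sum, hsum]

end Tensor

/-! ### Projective modules remain projective under tensoring -/

section Regular

variable {𝕜 : Type u} [Field 𝕜] {n : ℕ} {q : 𝕜} (hq : IsPrimitiveRoot q n)

local notation "𝐚" => D.of 𝕜 n q Gen.a
local notation "𝐛" => D.of 𝕜 n q Gen.b
local notation "𝐜" => D.of 𝕜 n q Gen.c
local notation "𝐝" => D.of 𝕜 n q Gen.d

variable (𝕜 n q) in
/-- The regular module. -/
def reg : DMod.{u, u} 𝕜 n q where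
  carrier := D 𝕜 n q

/-- The tensor product of the regular module with a finite-dimensional module is free. -/
theorem nonempty_regular_tensor_equiv (hn : 0 < n) (V : DMod.{u, v} 𝕜 n q)
    [Module.Finite 𝕜 V] : Nonempty
      ((Fin (Module.finrank 𝕜 V) → D 𝕜 n q) ≃ₗ[D 𝕜 n q] DMod.tensor hq (reg 𝕜 n q) V) := by
  have hfin : Module.Finite 𝕜 (D 𝕜 n q) := finite_D hn
  have hfin' : Module.Finite 𝕜 (reg 𝕜 n q) := hfin
  let v := Module.finBasis 𝕜 V
  let T : D 𝕜 n q →ₗ[𝕜] V →ₗ[𝕜] DMod.tensor hq (reg 𝕜 n q) V := tm hq (reg 𝕜 n q) V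
  let F : (Fin (Module.finrank 𝕜 V) → D 𝕜 n q) →ₗ[D 𝕜 n q] DMod.tensor hq (reg 𝕜 n q) V :=
    Fintype.linearCombination (D 𝕜 n q) fun k => T 1 (v k)
  have hF1 : ∀ y, T 1 y ∈ LinearMap.range F := by
    intro y
    rw [← v.sum_repr y, map_sum]
    refine Submodule.sum_mem _ fun k _ => ?_
    rw [map_smul]
    refine Submodule.smul_of_tower_mem _ _ ⟨Pi.single k 1, ?_⟩
    simp [F]
  -- W contains 1 and is stable under left multiplication by the generators because b and c are
  -- invertible: for instance (ax) ⊗ y = a(x ⊗ b⁻¹y) - x ⊗ ab⁻¹y, with b⁻¹ = b^(n-1).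
  let W : Submodule 𝕜 (D 𝕜 n q) :=
    { carrier := {x | ∀ y, T x y ∈ LinearMap.range F}
      add_mem' := fun {x x'} hx hx' y => by
        rw [map_add T, LinearMap.add_apply]
        exact Submodule.add_mem _ (hx y) (hx' y)
      zero_mem' := fun y => by
        rw [map_zero T, LinearMap.zero_apply]
        exact Submodule.zero_mem _
      smul_mem' := fun r x hx y => by
        rw [map_smul T, LinearMap.smul_apply]
        exact Submodule.smul_of_tower_mem _ _ (hx y) }
  have H := D.satisfies_of (𝕜 := 𝕜) (n := n) (q := q)
  have hbn : ∀ y : V, 𝐛 • 𝐛 ^ (n - 1) • y = y := fun y => by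
    rw [← mul_smul, ← pow_succ', Nat.sub_add_cancel hn, H.b_pow, one_smul]
  have hcn : ∀ y : V, 𝐜 • 𝐜 ^ (n - 1) • y = y := fun y => by
    rw [← mul_smul, ← pow_succ', Nat.sub_add_cancel hn, H.c_pow, one_smul]
  have hW : ∀ x, x ∈ W := by
    refine D.mem_of_closed W hF1 fun g x hx y => ?_
    cases g with
    | a =>
      have h := a_tm hq (M := reg 𝕜 n q) (N := V) x (𝐛 ^ (n - 1) • y)
      rw [hbn] at h
      have h2 := Submodule.sub_mem _ (Submodule.smul_mem _ 𝐚 (hx (𝐛 ^ (n - 1) • y)))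
        (hx (𝐚 • 𝐛 ^ (n - 1) • y))
      change 𝐚 • T x _ = T (𝐚 * x) y + T x _ at h
      rwa [h, add_sub_cancel_right] at h2
    | b =>
      have h := b_tm hq (M := reg 𝕜 n q) (N := V) x (𝐛 ^ (n - 1) • y)
      rw [hbn] at h
      have h2 := Submodule.smul_mem _ 𝐛 (hx (𝐛 ^ (n - 1) • y))
      change 𝐛 • T x _ = T (𝐛 * x) y at h
      rwa [h] at h2
    | c =>
      have h := c_tm hq (M := reg 𝕜 n q) (N := V) x (𝐜 ^ (n - 1) • y)
      rw [hcn] at h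
      have h2 := Submodule.smul_mem _ 𝐜 (hx (𝐜 ^ (n - 1) • y))
      change 𝐜 • T x _ = T (𝐜 * x) y at h
      rwa [h] at h2
    | d =>
      have h := d_tm hq (M := reg 𝕜 n q) (N := V) x (𝐜 ^ (n - 1) • y)
      rw [hcn] at h
      have h2 := Submodule.sub_mem _ (Submodule.smul_mem _ 𝐝 (hx (𝐜 ^ (n - 1) • y)))
        (hx (𝐝 • 𝐜 ^ (n - 1) • y))
      change 𝐝 • T x _ = T (𝐝 * x) y + T x _ at h
      rwa [h, add_sub_cancel_right] at h2
  have hsurj : Function.Surjective F := by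
    rw [← LinearMap.range_eq_top]
    have : ((LinearMap.range F).restrictScalars 𝕜).mkQ = 0 := tensor_ext hq fun x y => by
      rw [Submodule.mkQ_apply, LinearMap.zero_apply, Submodule.Quotient.mk_eq_zero]
      exact hW x y
    rw [Submodule.eq_top_iff']
    intro x
    have := LinearMap.congr_fun this x
    rwa [Submodule.mkQ_apply, LinearMap.zero_apply, Submodule.Quotient.mk_eq_zero] at this
  have hrank : Module.finrank 𝕜 (Fin (Module.finrank 𝕜 V) → D 𝕜 n q) =
      Module.finrank 𝕜 (DMod.tensor hq (reg 𝕜 n q) V) := by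
    rw [finrank_tensor, Module.finrank_pi_fintype, Finset.sum_const, Finset.card_univ,
      Fintype.card_fin, smul_eq_mul, mul_comm]
    rfl
  refine ⟨LinearEquiv.ofBijective F ⟨?_, hsurj⟩⟩
  exact (LinearMap.injective_iff_surjective_of_finrank_eq_finrank (f := F.restrictScalars 𝕜)
    hrank).2 hsurj

variable [CharZero 𝕜] [NeZero n]

/-- A cover is a retract of D_n, retracts survive tensoring, and D_n ⊗ V is free. -/
theorem projective_cover_tensor (hn : 2 ≤ n) (i : Idx n) (V : DMod.{u, v} 𝕜 n q)
    [Module.Finite 𝕜 V] : Module.Projective (D 𝕜 n q) (DMod.tensor hq (cover hn hq i) V) := by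
  obtain ⟨e⟩ := nonempty_regular_tensor_equiv hq (by omega) V
  have hp : Module.Projective (D 𝕜 n q) (DMod.tensor hq (reg 𝕜 n q) V) :=
    Module.Projective.of_equiv e
  obtain ⟨f, g, h⟩ : ∃ (f : cover hn hq i →ₗ[D 𝕜 n q] reg 𝕜 n q)
    (g : reg 𝕜 n q →ₗ[D 𝕜 n q] cover hn hq i), g ∘ₗ f = LinearMap.id :=
    exists_retract_cover hn hq i
  refine Module.Projective.of_split (tensorMap hq f (LinearMap.id (M := V)))
    (tensorMap hq g (LinearMap.id (M := V))) (tensor_hom_ext hq fun x y => ?_)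
  rw [LinearMap.comp_apply, tensorMap_tm, tensorMap_tm, LinearMap.id_apply, LinearMap.id_apply,
    LinearMap.id_apply]
  exact congrArg (fun z => tm hq (cover hn hq i) V z y) (LinearMap.congr_fun h x)

end Regular

/-! ### The product of V(ℓ, s) with a two-dimensional V(2, r) -/

section TensorSimple

variable {𝕜 : Type u} [Field 𝕜] {n : ℕ} [NeZero n] {q : 𝕜} (hn : 2 ≤ n)
  (hq : IsPrimitiveRoot q n)

local notation "𝐚" => D.of 𝕜 n q Gen.a
local notation "𝐛" => D.of 𝕜 n q Gen.b
local notation "𝐜" => D.of 𝕜 n q Gen.c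
local notation "𝐝" => D.of 𝕜 n q Gen.d

theorem IsWt.tm (hq0 : q ≠ 0) {M : DMod.{u, v} 𝕜 n q} {N : DMod.{u, w} 𝕜 n q} {s t s' t' : ℤ}
    {x : M} {y : N} (hx : IsWt n q s t x) (hy : IsWt n q s' t' y) :
    IsWt n q (s + s') (t + t') (tm hq M N x y) := by
  constructor
  · rw [b_tm, hx.1, hy.1, map_smul, map_smul, LinearMap.smul_apply, smul_smul, mul_comm,
      zpow_add₀ hq0]
  · rw [c_tm, hx.2, hy.2, map_smul, map_smul, LinearMap.smul_apply, smul_smul, mul_comm,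
      zpow_add₀ hq0]

variable (i j : Idx n)

/-- The tensor product of two basis vectors. -/
def stm (t t' : ℕ) : DMod.tensor hq (simple hn hq i) (simple hn hq j) :=
  tm hq _ _ (svec hn hq i t) (svec hn hq j t')

theorem stm_of_le {t : ℕ} (h : i.1 ≤ t) (t' : ℕ) : stm hn hq i j t t' = 0 := by
  rw [stm, svec_of_le _ _ _ h, map_zero, LinearMap.zero_apply]

theorem stm_of_le' {t' : ℕ} (h : j.1 ≤ t') (t : ℕ) : stm hn hq i j t t' = 0 := by
  rw [stm, svec_of_le _ _ _ h, map_zero]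

theorem a_stm (t t' : ℕ) : 𝐚 • stm hn hq i j t t' =
    q ^ ((j.2.val : ℤ) + t') • stm hn hq i j (t + 1) t' + stm hn hq i j t (t' + 1) := by
  rw [stm, a_tm, a_svec, a_svec, (isWt_svec hn hq j t').1, map_smul]
  rfl

theorem a_pow_stm_one (hj : (j.1 : ℕ) = 2) (m t : ℕ) :
    ∃ r : 𝕜, 𝐚 ^ m • stm hn hq i j t 1 = r • stm hn hq i j (t + m) 1 := by
  induction m with
  | zero => exact ⟨1, by simp⟩
  | succ m ih =>
    obtain ⟨r, hr⟩ := ih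
    refine ⟨r * q ^ ((j.2.val : ℤ) + (1 : ℕ)), ?_⟩
    rw [pow_succ', mul_smul, hr, smul_comm, a_stm, stm_of_le' hn hq i j (t' := 1 + 1) (by omega),
      add_zero, smul_smul]
    rfl

theorem a_pow_stm_zero (hj : (j.1 : ℕ) = 2) (m t : ℕ) :
    ∃ r r' : 𝕜, 𝐚 ^ (m + 1) • stm hn hq i j t 0 =
      r • stm hn hq i j (t + m + 1) 0 + r' • stm hn hq i j (t + m) 1 := by
  induction m with
  | zero => exact ⟨q ^ ((j.2.val : ℤ) + (0 : ℕ)), 1, by rw [zero_add, pow_one, a_stm, one_smul]; rfl⟩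
  | succ m ih =>
    obtain ⟨r, r', hr⟩ := ih
    refine ⟨r * q ^ ((j.2.val : ℤ) + (0 : ℕ)), r + r' * q ^ ((j.2.val : ℤ) + (1 : ℕ)), ?_⟩
    rw [pow_succ', mul_smul, hr, smul_add, smul_comm 𝐚 r, smul_comm 𝐚 r', a_stm, a_stm,
      stm_of_le' hn hq i j (t' := 1 + 1) (by omega), add_zero, zero_add, ← add_assoc]
    module

theorem d_stm_zero_zero : 𝐝 • stm hn hq i j 0 0 = 0 := by
  rw [stm, d_tm, d_svec_zero, d_svec_zero, map_zero, LinearMap.zero_apply, map_zero, add_zero]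

theorem d_stm_succ_zero {t : ℕ} (h : t + 1 < i.1) : 𝐝 • stm hn hq i j (t + 1) 0 =
    (al q (i.1 : ℕ) (t + 1) * q ^ ((1 : ℤ) - j.2.val - (j.1 : ℕ))) • stm hn hq i j t 0 := by
  rw [stm, d_tm, d_svec_zero, d_svec _ _ _ h, map_zero, add_zero, (isWt_svec hn hq j 0).2,
    map_smul, map_smul, LinearMap.smul_apply, smul_smul, mul_comm, stm]
  congr 2

theorem d_stm_zero_one (hj : (j.1 : ℕ) = 2) :
    𝐝 • stm hn hq i j 0 1 = al q 2 1 • stm hn hq i j 0 0 := by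
  have h := d_svec hn hq j (t := 0) (by omega)
  rw [stm, d_tm, d_svec_zero, map_zero, LinearMap.zero_apply, zero_add, h, map_smul, hj, stm]
  simp

theorem d_stm_succ_one (hj : (j.1 : ℕ) = 2) {t : ℕ} (h : t + 1 < i.1) :
    ∃ r : 𝕜, 𝐝 • stm hn hq i j (t + 1) 1 =
      r • stm hn hq i j t 1 + al q 2 1 • stm hn hq i j (t + 1) 0 := by
  have h1 := d_svec hn hq j (t := 0) (by omega)
  refine ⟨al q (i.1 : ℕ) (t + 1) * q ^ ((1 : ℕ) + 1 - j.2.val - (j.1 : ℕ) : ℤ), ?_⟩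
  rw [stm, d_tm, d_svec _ _ _ h, h1, (isWt_svec hn hq j 1).2, map_smul, map_smul, map_smul,
    LinearMap.smul_apply, smul_smul, hj, mul_comm]
  simp [stm]

theorem isWt_stm (t t' : ℕ) : IsWt n q (i.2.val + t + (j.2.val + t'))
    (t + 1 - i.2.val - (i.1 : ℕ) + (t' + 1 - j.2.val - (j.1 : ℕ))) (stm hn hq i j t t') :=
  (isWt_svec hn hq i t).tm hq (hq.ne_zero (by omega)) (isWt_svec hn hq j t')

/-- The coordinates of a vector of the tensor product. -/
def stcoord (t : Fin i.1) (t' : Fin j.1) :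
    DMod.tensor hq (simple hn hq i) (simple hn hq j) →ₗ[𝕜] 𝕜 :=
  LinearMap.mul' 𝕜 𝕜 ∘ₗ TensorProduct.map (scoord hn hq i t) (scoord hn hq j t') ∘ₗ
    (tensorEquiv hq _ _).symm.toLinearMap

theorem stcoord_stm (t : Fin i.1) (t' : Fin j.1) (k k' : ℕ) :
    stcoord hn hq i j t t' (stm hn hq i j k k') =
      (if (t : ℕ) = k then 1 else 0) * (if (t' : ℕ) = k' then 1 else 0) := by
  rw [← scoord_svec hn hq i t k, ← scoord_svec hn hq j t' k']
  rfl

variable {i j}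

include hn hq in
theorem al_two_one_ne_zero : al q 2 1 ≠ 0 := by
  have := al_ne_zero_of_lt hn hq (l := 2) (t := 1) (by omega) (by omega) hn
  exact_mod_cast this

/-- The second factor can absorb at most one a, so a^(ℓ+1) forces at least ℓ factors onto the first
vector, where a^ℓ = 0. -/
theorem stm_zero_zero_mem (hj : (j.1 : ℕ) = 2) (k : Idx n) (hk : (k.1 : ℕ) = i.1 + 1)
    (hk' : k.2 = i.2 + j.2) : stm hn hq i j 0 0 ∈
      primSpace n q (DMod.tensor hq (simple hn hq i) (simple hn hq j)) k.1 k.2.val := by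
  refine ⟨?_, d_stm_zero_zero hn hq i j, ?_⟩
  · refine (isWt_stm hn hq i j 0 0).congr hn hq ?_ ?_ <;> rw [hk'] <;> (try rw [hj]) <;> (try rw [hk]) <;>
      push_cast <;> simp only [ZMod.natCast_zmod_val] <;> ring
  · obtain ⟨r, r', h⟩ := a_pow_stm_zero hn hq i j hj i.1 0
    rw [hk, h, stm_of_le _ _ _ _ (by omega), stm_of_le _ _ _ _ (by omega), smul_zero, smul_zero,
      add_zero]

theorem exists_ne_zero_mem_primSpace (hj : (j.1 : ℕ) = 2) (k : Idx n) (hk : (k.1 : ℕ) + 1 = i.1)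
    (hk' : k.2 = i.2 + j.2 + 1) :
    ∃ x ∈ primSpace n q (DMod.tensor hq (simple hn hq i) (simple hn hq j)) k.1 k.2.val, x ≠ 0 := by
  have hq0 : q ≠ 0 := hq.ne_zero (by omega)
  have hq1 : q ≠ 1 := hq.ne_one (by omega)
  have hk1 : 1 ≤ (k.1 : ℕ) := k.1.2.1
  have hal := al_two_one_ne_zero hn hq
  obtain ⟨m, hm⟩ : ∃ m, (k.1 : ℕ) = m + 1 := ⟨k.1 - 1, by omega⟩
  -- The coefficients of x are chosen so that the two multiples of v_1 ⊗ w_1 arising in d x cancel.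
  set c : 𝕜 := al q (i.1 : ℕ) ((0 : ℕ) + 1) * q ^ ((1 : ℤ) - j.2.val - (j.1 : ℕ)) with hc
  set x := al q 2 1 • stm hn hq i j 1 0 - c • stm hn hq i j 0 1 with hx
  have hwt : IsWt n q k.2.val (1 - k.2.val - (k.1 : ℕ)) x := by
    rw [hx, sub_eq_add_neg (al q 2 1 • _), ← neg_smul]
    refine IsWt.add (IsWt.smul _ ?_) (IsWt.smul _ ?_)
    · refine (isWt_stm hn hq i j 1 0).congr hn hq ?_ ?_ <;> rw [hk'] <;> (try rw [hj]) <;> (try rw [← hk]) <;>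
        push_cast <;> simp only [ZMod.natCast_zmod_val] <;> ring
    · refine (isWt_stm hn hq i j 0 1).congr hn hq ?_ ?_ <;> rw [hk'] <;> (try rw [hj]) <;> (try rw [← hk]) <;>
        push_cast <;> simp only [ZMod.natCast_zmod_val] <;> ring
  have hd : 𝐝 • x = 0 := by
    rw [hx, smul_sub, smul_comm 𝐝 (al q 2 1), smul_comm 𝐝 c, d_stm_succ_zero _ _ _ _ (by omega),
      d_stm_zero_one _ _ _ _ hj, ← hc, smul_comm, sub_self]
  refine ⟨x, ⟨hwt, hd, ?_⟩, fun h0 => ?_⟩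
  · obtain ⟨r, r', h1⟩ := a_pow_stm_zero hn hq i j hj m 1
    obtain ⟨r'', h2⟩ := a_pow_stm_one hn hq i j hj (m + 1) 0
    obtain ⟨e, h3⟩ := d_stm_succ_one hn hq i j hj (t := m) (by omega)
    have h4 : 𝐚 ^ (m + 1) • x = (al q 2 1 * r' - c * r'') • stm hn hq i j (m + 1) 1 := by
      rw [hx, smul_sub, smul_comm _ (al q 2 1), smul_comm _ c, h1, h2,
        stm_of_le _ _ _ _ (by omega : (i.1 : ℕ) ≤ 1 + m + 1), smul_zero, zero_add, zero_add,
        add_comm 1 m]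
      module
    -- For reasons of length a^(ℓ-1) x is a multiple of v_ℓ ⊗ w_2. It is killed by d, as d x = 0 and
    -- `al` vanishes at ℓ - 1. But d (v_ℓ ⊗ w_2) has the nonzero coordinate `al q 2 1` at v_ℓ ⊗ w_1,
    -- so the multiple is zero.
    have h5 := hwt.d_a_pow hq0 hq1 (l := (k.1 : ℕ)) (by ring) m
    have h6 : al q (k.1 : ℕ) (m + 1) = 0 := by rw [hm, ← Nat.cast_add_one, al_self]
    rw [hd, smul_zero, smul_zero, h6, zero_smul, add_zero, h4, smul_comm, h3] at h5
    have h7 := congrArg (stcoord hn hq i j ⟨m + 1, by omega⟩ ⟨0, by omega⟩) h5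
    rw [map_smul, map_add, map_smul, map_smul, stcoord_stm, stcoord_stm, map_zero] at h7
    simp only [zero_ne_one, if_false, mul_zero, zero_add, if_true, mul_one,
      smul_eq_mul, mul_eq_zero, hal, or_false] at h7
    rw [hm, h4, h7, zero_smul]
  · have h7 := congrArg (stcoord hn hq i j ⟨1, by omega⟩ ⟨0, by omega⟩) h0
    rw [hx, map_sub, map_smul, map_smul, stcoord_stm, stcoord_stm, map_zero] at h7
    simp [hal] at h7

theorem stm_zero_zero_ne_zero : stm hn hq i j 0 0 ≠ 0 := by
  intro h
  have := congrArg (stcoord hn hq i j ⟨0, i.1.2.1⟩ ⟨0, j.1.2.1⟩) h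
  rw [stcoord_stm, map_zero] at this
  simp at this

theorem exists_injective_of_mem_primSpace {X : Type*} [AddCommGroup X] [Module 𝕜 X]
    [Module (D 𝕜 n q) X] [IsScalarTower 𝕜 (D 𝕜 n q) X] (k : Idx n) {x : X}
    (hx : x ∈ primSpace n q X k.1 k.2.val) (hx0 : x ≠ 0) :
    ∃ f : simple hn hq k →ₗ[D 𝕜 n q] X, Function.Injective f := by
  obtain ⟨f, hf⟩ := exists_hom_simple hn hq k hx
  have := isSimpleModule_simple hn hq k
  refine ⟨f, LinearMap.injective_of_ne_zero ?_⟩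
  rintro rfl
  exact hx0 hf.symm

theorem bijective_of_injective {X Y : Type*} [AddCommGroup X] [Module 𝕜 X]
    [Module (D 𝕜 n q) X] [IsScalarTower 𝕜 (D 𝕜 n q) X] [AddCommGroup Y] [Module 𝕜 Y]
    [Module (D 𝕜 n q) Y] [IsScalarTower 𝕜 (D 𝕜 n q) Y] [Module.Finite 𝕜 X] [Module.Finite 𝕜 Y]
    (f : X →ₗ[D 𝕜 n q] Y) (hf : Function.Injective f)
    (h : Module.finrank 𝕜 X = Module.finrank 𝕜 Y) : Function.Bijective f :=
  ⟨hf, (LinearMap.injective_iff_surjective_of_finrank_eq_finrank (f := f.restrictScalars 𝕜) h).1 hf⟩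

theorem nonempty_simple_tensor_equiv_of_one (hi : (i.1 : ℕ) = 1) (hj : (j.1 : ℕ) = 2) :
    ∃ k : Idx n,
      Nonempty (DMod.tensor hq (simple hn hq i) (simple hn hq j) ≃ₗ[D 𝕜 n q] simple hn hq k) := by
  let k : Idx n := (⟨i.1 + 1, by rw [Set.mem_Icc]; omega⟩, i.2 + j.2)
  obtain ⟨f, hf⟩ := exists_injective_of_mem_primSpace hn hq k
    (stm_zero_zero_mem hn hq hj k rfl rfl) (stm_zero_zero_ne_zero hn hq)
  have hr : Module.finrank 𝕜 (simple hn hq k) =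
      Module.finrank 𝕜 (DMod.tensor hq (simple hn hq i) (simple hn hq j)) := by
    rw [finrank_tensor, finrank_simple, finrank_simple, finrank_simple, hi, hj]
    change (i.1 : ℕ) + 1 = _
    omega
  exact ⟨k, ⟨(LinearEquiv.ofBijective f (bijective_of_injective f hf hr)).symm⟩⟩

/-- The two primitive vectors embed V(ℓ+1,·) and V(ℓ-1,·). The first is simple and too large to lie
in the second, so the images are independent, and (ℓ+1) + (ℓ-1) = 2ℓ fills the product. -/
theorem nonempty_simple_tensor_equiv_prod (hi1 : 1 < (i.1 : ℕ)) (hi : (i.1 : ℕ) < n)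
    (hj : (j.1 : ℕ) = 2) : ∃ k k' : Idx n,
      Nonempty (DMod.tensor hq (simple hn hq i) (simple hn hq j) ≃ₗ[D 𝕜 n q]
        simple hn hq k × simple hn hq k') := by
  let k : Idx n := (⟨i.1 + 1, by rw [Set.mem_Icc]; omega⟩, i.2 + j.2)
  let k' : Idx n := (⟨i.1 - 1, by rw [Set.mem_Icc]; omega⟩, i.2 + j.2 + 1)
  have hk : (k.1 : ℕ) = i.1 + 1 := rfl
  have hk' : (k'.1 : ℕ) = i.1 - 1 := rfl
  obtain ⟨f, hf⟩ := exists_injective_of_mem_primSpace hn hq k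
    (stm_zero_zero_mem hn hq hj k rfl rfl) (stm_zero_zero_ne_zero hn hq)
  obtain ⟨x, hx, hx0⟩ := exists_ne_zero_mem_primSpace hn hq (i := i) hj k' (by omega) rfl
  obtain ⟨f', hf'⟩ := exists_injective_of_mem_primSpace hn hq k' hx hx0
  have hs := isSimpleModule_simple hn hq k
  have hbot : (LinearMap.range f').comap f = ⊥ := by
    refine (eq_bot_or_eq_top _).resolve_right fun htop => ?_
    have hle : (LinearMap.range (f.restrictScalars 𝕜)) ≤ LinearMap.range (f'.restrictScalars 𝕜) := by
      rintro _ ⟨y, rfl⟩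
      have : y ∈ (LinearMap.range f').comap f := by rw [htop]; trivial
      exact this
    have := Submodule.finrank_mono hle
    rw [LinearMap.finrank_range_of_inj (f := f.restrictScalars 𝕜) hf,
      LinearMap.finrank_range_of_inj (f := f'.restrictScalars 𝕜) hf', finrank_simple,
      finrank_simple] at this
    omega
  have hinj : Function.Injective (f.coprod f') := by
    rw [← LinearMap.ker_eq_bot, LinearMap.ker_eq_bot']
    rintro ⟨y, y'⟩ h
    rw [LinearMap.coprod_apply] at h
    have hy : y = 0 := by
      have : y ∈ (LinearMap.range f').comap f :=
        ⟨-y', by rw [map_neg]; exact (eq_neg_of_add_eq_zero_left h).symm⟩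
      rwa [hbot, Submodule.mem_bot] at this
    rw [hy, map_zero, zero_add] at h
    have hy' : y' = 0 := hf' (h.trans (map_zero f').symm)
    rw [hy, hy']
    rfl
  have hr : Module.finrank 𝕜 (simple hn hq k × simple hn hq k') =
      Module.finrank 𝕜 (DMod.tensor hq (simple hn hq i) (simple hn hq j)) := by
    rw [finrank_tensor, Module.finrank_prod, finrank_simple, finrank_simple, finrank_simple,
      finrank_simple, hj]
    omega
  exact ⟨k, k', ⟨(LinearEquiv.ofBijective _ (bijective_of_injective _ hinj hr)).symm⟩⟩

end TensorSimple

/-! ### Direct sums of V(i) and P(i), closed under tensoring with V(2, r) -/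

section Sums

variable {𝕜 : Type u} [Field 𝕜] {n : ℕ} {q : 𝕜} (hn : 2 ≤ n) (hq : IsPrimitiveRoot q n)

/-- The modules `V(i)` and `P(i)`. -/
def summand : Idx n ⊕ Idx n → DMod.{u, u} 𝕜 n q := Sum.elim (simple hn hq) (cover hn hq)

/-- `X` is isomorphic to a finite direct sum of modules `V(l, s)`, and `P(l, s)` with `l < n`. -/
def IsSum (X : Type*) [AddCommGroup X] [Module (D 𝕜 n q) X] : Prop :=
  ∃ (ι : Type) (_ : Fintype ι) (σ : ι → Idx n ⊕ Idx n),
    (∀ t j, σ t = Sum.inr j → (j.1 : ℕ) < n) ∧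
    Nonempty (X ≃ₗ[D 𝕜 n q] ∀ t, summand hn hq (σ t))

variable {hn hq}

theorem IsSum.of_equiv {X Y : Type*} [AddCommGroup X] [Module (D 𝕜 n q) X] [AddCommGroup Y]
    [Module (D 𝕜 n q) Y] (e : X ≃ₗ[D 𝕜 n q] Y) (h : IsSum hn hq Y) : IsSum hn hq X := by
  obtain ⟨ι, hι, σ, hσ, ⟨e'⟩⟩ := h
  exact ⟨ι, hι, σ, hσ, ⟨e.trans e'⟩⟩

theorem IsSum.pi {κ : Type} [Fintype κ] {X : κ → Type*} [∀ k, AddCommGroup (X k)]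
    [∀ k, Module (D 𝕜 n q) (X k)] (h : ∀ k, IsSum hn hq (X k)) : IsSum hn hq (∀ k, X k) := by
  choose ι hι σ hσ e using h
  refine ⟨Σ k, ι k, inferInstance, fun p => σ p.1 p.2, fun p j hp => hσ _ _ _ hp, ⟨?_⟩⟩
  exact (LinearEquiv.piCongrRight fun k => (e k).some).trans
    (LinearEquiv.piCurry (D 𝕜 n q) fun k t => summand hn hq (σ k t)).symm

theorem IsSum.prod {X Y : Type*} [AddCommGroup X] [Module (D 𝕜 n q) X] [AddCommGroup Y]
    [Module (D 𝕜 n q) Y] (hX : IsSum hn hq X) (hY : IsSum hn hq Y) : IsSum hn hq (X × Y) := by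
  obtain ⟨ι, hι, σ, hσ, ⟨e⟩⟩ := hX
  obtain ⟨ι', hι', σ', hσ', ⟨e'⟩⟩ := hY
  refine ⟨ι ⊕ ι', inferInstance, Sum.elim σ σ', ?_, ⟨?_⟩⟩
  · rintro (t | t) j h
    · exact hσ t j h
    · exact hσ' t j h
  · exact (e.prodCongr e').trans
      (LinearEquiv.sumPiEquivProdPi (D 𝕜 n q) ι ι' fun t => summand hn hq (Sum.elim σ σ' t)).symm

theorem isSum_simple (i : Idx n) : IsSum hn hq (simple hn hq i) :=
  ⟨Unit, inferInstance, fun _ => Sum.inl i, fun _ _ h => by simp at h,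
    ⟨(LinearEquiv.funUnique Unit (D 𝕜 n q) (simple hn hq i)).symm⟩⟩

theorem isSum_cover (i : Idx n) : IsSum hn hq (cover hn hq i) := by
  by_cases h : (i.1 : ℕ) < n
  · exact ⟨Unit, inferInstance, fun _ => Sum.inr i, fun _ _ h' => by
      rw [← Sum.inr_injective h']; exact h,
      ⟨(LinearEquiv.funUnique Unit (D 𝕜 n q) (cover hn hq i)).symm⟩⟩
  · rw [cover, dif_neg h]
    exact isSum_simple i

theorem isSum_of_subsingleton {X : Type*} [AddCommGroup X] [Module (D 𝕜 n q) X]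
    [Subsingleton X] : IsSum hn hq X :=
  ⟨Empty, inferInstance, Empty.elim, fun t => t.elim, ⟨0, 0, fun _ => Subsingleton.elim _ _,
    fun _ => Subsingleton.elim _ _⟩⟩

/-- A finite-dimensional projective module is a direct sum of projective covers. -/
theorem isSum_of_projective [CharZero 𝕜] [NeZero n] (d : ℕ) (X : Type u) [AddCommGroup X]
    [Module 𝕜 X]
    [Module (D 𝕜 n q) X] [IsScalarTower 𝕜 (D 𝕜 n q) X] [Module.Finite 𝕜 X]
    [hP : Module.Projective (D 𝕜 n q) X] (hd : Module.finrank 𝕜 X = d) : IsSum hn hq X := by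
  induction d using Nat.strong_induction_on generalizing X with
  | _ d ih =>
  rcases subsingleton_or_nontrivial X with h0 | h0
  · exact isSum_of_subsingleton
  have hfin : Module.Finite (D 𝕜 n q) X := Module.Finite.of_restrictScalars_finite 𝕜 _ _
  obtain ⟨N, hN, -⟩ := (eq_top_or_exists_le_coatom (⊥ : Submodule (D 𝕜 n q) X)).resolve_left
    bot_ne_top
  have hs : IsSimpleModule (D 𝕜 n q) (X ⧸ N) := isSimpleModule_iff_isCoatom.2 hN
  obtain ⟨j, ⟨e⟩⟩ := exists_equiv_simple hn hq (X ⧸ N)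
  obtain ⟨f, hf, hsf⟩ := exists_superfluous hn hq j
  -- The quotient map to V(j) lifts to g from X to the cover of V(j). The image of g together with
  -- the superfluous kernel of f is everything, so g is onto; it splits, and its kernel is a
  -- projective module of smaller dimension.
  let p : X →ₗ[D 𝕜 n q] simple hn hq j := e.symm.toLinearMap ∘ₗ N.mkQ
  have hp : Function.Surjective p := e.symm.surjective.comp N.mkQ_surjective
  obtain ⟨g, hg⟩ := Module.projective_lifting_property f p hf
  have hgs : Function.Surjective g := by
    rw [← LinearMap.range_eq_top]
    refine hsf _ ?_
    rw [eq_top_iff]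
    intro x _
    obtain ⟨y, hy⟩ := hp (f x)
    refine Submodule.mem_sup.2 ⟨g y, ⟨y, rfl⟩, x - g y, ?_, by abel⟩
    rw [LinearMap.mem_ker, map_sub, ← LinearMap.comp_apply, hg, hy, sub_self]
  have := projective_cover hn hq j
  obtain ⟨s, hs'⟩ := Module.projective_lifting_property g LinearMap.id hgs
  have hgsx : ∀ x, g (s x) = x := fun x => LinearMap.congr_fun hs' x
  let F : (LinearMap.ker g × cover hn hq j) →ₗ[D 𝕜 n q] X := (LinearMap.ker g).subtype.coprod s
  have hF : Function.Bijective F := by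
    constructor
    · rw [← LinearMap.ker_eq_bot, LinearMap.ker_eq_bot']
      rintro ⟨⟨x, hx⟩, y⟩ h
      have h : x + s y = 0 := h
      have hy := congrArg g h
      rw [map_add, LinearMap.mem_ker.1 hx, zero_add, hgsx, map_zero] at hy
      subst hy
      rw [map_zero, add_zero] at h
      subst h
      rfl
    · intro x
      refine ⟨(⟨x - s (g x), by rw [LinearMap.mem_ker, map_sub, hgsx, sub_self]⟩, g x), ?_⟩
      change x - s (g x) + s (g x) = x
      abel
  let E := LinearEquiv.ofBijective F hF
  have hproj : Module.Projective (D 𝕜 n q) (LinearMap.ker g) := by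
    refine Module.Projective.of_split (LinearMap.ker g).subtype
      (LinearMap.fst _ _ _ ∘ₗ E.symm.toLinearMap) ?_
    ext x
    have : E.symm x = (x, 0) := by
      rw [LinearEquiv.symm_apply_eq]
      simp [E, F]
    simp [this]
  have hfink : Module.Finite 𝕜 (LinearMap.ker g) :=
    inferInstanceAs (Module.Finite 𝕜 ((LinearMap.ker g).restrictScalars 𝕜))
  have hrank : Module.finrank 𝕜 (LinearMap.ker g) + Module.finrank 𝕜 (cover hn hq j) = d := by
    rw [← hd, ← Module.finrank_prod]
    exact (E.restrictScalars 𝕜).finrank_eq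
  have hpos : 0 < Module.finrank 𝕜 (cover hn hq j) := by
    have := isSimpleModule_simple hn hq j
    have : Nontrivial (simple hn hq j) := IsSimpleModule.nontrivial (D 𝕜 n q) _
    have : Nontrivial (cover hn hq j) := hf.nontrivial
    exact Module.finrank_pos
  have hker := ih _ (by omega) (LinearMap.ker g) rfl
  exact IsSum.of_equiv E.symm (hker.prod (isSum_cover j))

variable [CharZero 𝕜] [NeZero n]

/-- Summands V(ℓ,s) with ℓ < n are decomposed explicitly. All others, V(n,s) included, are covers,
so their products are projective. -/
theorem IsSum.tensor {j : Idx n} (hj : (j.1 : ℕ) = 2) {M : DMod.{u, u} 𝕜 n q}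
    (h : IsSum hn hq M) : IsSum hn hq (DMod.tensor hq M (simple hn hq j)) := by
  obtain ⟨ι, hι, σ, hσ, ⟨e⟩⟩ := h
  obtain ⟨e'⟩ := nonempty_tensor_pi_equiv hq (fun t => summand hn hq (σ t)) (simple hn hq j) e
  refine IsSum.of_equiv e' (IsSum.pi fun t => ?_)
  have hcover : ∀ i, IsSum hn hq (DMod.tensor hq (cover hn hq i) (simple hn hq j)) := fun i =>
    have := projective_cover_tensor hq hn i (simple hn hq j)
    isSum_of_projective _ _ rfl
  rcases σ t with i | i
  · change IsSum hn hq (DMod.tensor hq (simple hn hq i) (simple hn hq j))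
    have hi1 : 1 ≤ (i.1 : ℕ) := i.1.2.1
    by_cases hi : (i.1 : ℕ) < n
    · rcases hi1.eq_or_lt with h1 | h1
      · obtain ⟨k, ⟨e⟩⟩ := nonempty_simple_tensor_equiv_of_one hn hq h1.symm hj
        exact IsSum.of_equiv e (isSum_simple k)
      · obtain ⟨k, k', ⟨e⟩⟩ := nonempty_simple_tensor_equiv_prod hn hq h1 hi hj
        exact IsSum.of_equiv e ((isSum_simple k).prod (isSum_simple k'))
    · have := hcover i
      rwa [cover, dif_neg hi] at this
  · exact hcover i

theorem isSum_tensorPowSucc {j : Idx n} (hj : (j.1 : ℕ) = 2) (k : ℕ) :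
    IsSum hn hq (DMod.tensorPowSucc hq (simple hn hq j) k) := by
  induction k with
  | zero => exact isSum_simple j
  | succ k ih => exact ih.tensor hj

end Sums

/-! ### Collecting equal factors of a product -/

section Regroup

variable {R : Type*} [Semiring R] {ι κ : Type*} (σ : ι → κ) (F : κ → Type*)
  [∀ k, AddCommMonoid (F k)] [∀ k, Module R (F k)]

/-- Grouping the factors of a product according to their types. -/
def piFiberEquiv : (∀ t, F (σ t)) ≃ₗ[R] ∀ k, {t // σ t = k} → F k where
  toFun f k t := t.2 ▸ f t.1
  invFun g t := g (σ t) ⟨t, rfl⟩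
  map_add' f g := by ext k ⟨t, rfl⟩; rfl
  map_smul' r f := by ext k ⟨t, rfl⟩; rfl
  left_inv f := rfl
  right_inv g := by ext k ⟨t, rfl⟩; rfl

theorem nonempty_pi_equiv_pi_fin [Fintype ι] [DecidableEq κ] :
    Nonempty ((∀ t, F (σ t)) ≃ₗ[R] ∀ k, Fin (Fintype.card {t // σ t = k}) → F k) :=
  ⟨(piFiberEquiv σ F).trans <| LinearEquiv.piCongrRight fun k =>
    LinearEquiv.funCongrLeft R (F k) (Fintype.equivFin {t // σ t = k}).symm⟩

end Regroup

/-! ### Additivity of Hom dimensions -/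

section HomSums

variable {𝕜 : Type*} [Field 𝕜] {A : Type*} [Ring A] [Algebra 𝕜 A]

section Finite

variable (X Y : Type*) [AddCommGroup X] [Module 𝕜 X] [Module A X] [IsScalarTower 𝕜 A X]
  [Module.Finite 𝕜 X] [AddCommGroup Y] [Module 𝕜 Y] [Module A Y] [IsScalarTower 𝕜 A Y]
  [Module.Finite 𝕜 Y]

theorem finite_hom : Module.Finite 𝕜 (X →ₗ[A] Y) :=
  Module.Finite.of_injective (LinearMap.restrictScalarsₗ 𝕜 A X Y 𝕜)
    (LinearMap.restrictScalars_injective 𝕜)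

end Finite

section Congr

variable (C : Type*) {X Y : Type*} [AddCommGroup C] [Module 𝕜 C] [Module A C]
  [IsScalarTower 𝕜 A C] [AddCommGroup X] [Module 𝕜 X] [Module A X] [IsScalarTower 𝕜 A X]
  [AddCommGroup Y] [Module 𝕜 Y] [Module A Y] [IsScalarTower 𝕜 A Y]

theorem finrank_hom_congr_right (e : X ≃ₗ[A] Y) :
    Module.finrank 𝕜 (C →ₗ[A] X) = Module.finrank 𝕜 (C →ₗ[A] Y) :=
  LinearEquiv.finrank_eq
    { toFun := fun f => e.toLinearMap ∘ₗ f
      invFun := fun f => e.symm.toLinearMap ∘ₗ f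
      map_add' := fun f g => by ext; simp
      map_smul' := fun r f => by ext x; exact (e.restrictScalars 𝕜).map_smul r (f x)
      left_inv := fun f => by ext; simp
      right_inv := fun f => by ext; simp }

theorem finrank_hom_congr_left (e : X ≃ₗ[A] Y) :
    Module.finrank 𝕜 (X →ₗ[A] C) = Module.finrank 𝕜 (Y →ₗ[A] C) :=
  LinearEquiv.finrank_eq
    { toFun := fun f => f ∘ₗ e.symm.toLinearMap
      invFun := fun f => f ∘ₗ e.toLinearMap
      map_add' := fun _ _ => rfl
      map_smul' := fun _ _ => rfl
      left_inv := fun f => by ext; simp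
      right_inv := fun f => by ext; simp }

end Congr

variable {ι : Type*} [Fintype ι] (C X Y : Type*) (Z : ι → Type*)
  [AddCommGroup C] [Module 𝕜 C] [Module A C] [IsScalarTower 𝕜 A C] [Module.Finite 𝕜 C]
  [AddCommGroup X] [Module 𝕜 X] [Module A X] [IsScalarTower 𝕜 A X] [Module.Finite 𝕜 X]
  [AddCommGroup Y] [Module 𝕜 Y] [Module A Y] [IsScalarTower 𝕜 A Y] [Module.Finite 𝕜 Y]
  [∀ i, AddCommGroup (Z i)] [∀ i, Module 𝕜 (Z i)] [∀ i, Module A (Z i)]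
  [∀ i, IsScalarTower 𝕜 A (Z i)] [∀ i, Module.Finite 𝕜 (Z i)]

theorem finrank_hom_pi : Module.finrank 𝕜 (C →ₗ[A] ∀ i, Z i) =
    ∑ i, Module.finrank 𝕜 (C →ₗ[A] Z i) := by
  have := fun i => finite_hom (𝕜 := 𝕜) (A := A) C (Z i)
  let e : (C →ₗ[A] ∀ i, Z i) ≃ₗ[𝕜] ∀ i, C →ₗ[A] Z i :=
    { toFun := fun f i => LinearMap.proj i ∘ₗ f
      invFun := fun g => LinearMap.pi g
      map_add' := fun _ _ => rfl
      map_smul' := fun _ _ => rfl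
      left_inv := fun _ => rfl
      right_inv := fun _ => rfl }
  rw [e.finrank_eq, Module.finrank_pi_fintype]

theorem finrank_hom_prod : Module.finrank 𝕜 (C →ₗ[A] X × Y) =
    Module.finrank 𝕜 (C →ₗ[A] X) + Module.finrank 𝕜 (C →ₗ[A] Y) := by
  have := finite_hom (𝕜 := 𝕜) (A := A) C X
  have := finite_hom (𝕜 := 𝕜) (A := A) C Y
  rw [← (LinearMap.prodEquiv 𝕜 : ((C →ₗ[A] X) × (C →ₗ[A] Y)) ≃ₗ[𝕜] _).finrank_eq,
    Module.finrank_prod]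

theorem finrank_pi_hom : Module.finrank 𝕜 ((∀ i, Z i) →ₗ[A] C) =
    ∑ i, Module.finrank 𝕜 (Z i →ₗ[A] C) := by
  classical
  have := fun i => finite_hom (𝕜 := 𝕜) (A := A) (Z i) C
  rw [← (LinearMap.lsum A Z 𝕜 (M := C)).finrank_eq, Module.finrank_pi_fintype]

theorem finrank_prod_hom : Module.finrank 𝕜 (X × Y →ₗ[A] C) =
    Module.finrank 𝕜 (X →ₗ[A] C) + Module.finrank 𝕜 (Y →ₗ[A] C) := by
  have := finite_hom (𝕜 := 𝕜) (A := A) X C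
  have := finite_hom (𝕜 := 𝕜) (A := A) Y C
  rw [← (LinearMap.coprodEquiv 𝕜 : ((X →ₗ[A] C) × (Y →ₗ[A] C)) ≃ₗ[𝕜] _).finrank_eq,
    Module.finrank_prod]

end HomSums

/-! ### Multiplicities and the dimension of the endomorphism algebra -/

section Formula

variable {𝕜 : Type u} [Field 𝕜] {n : ℕ} {q : 𝕜} {hn : 2 ≤ n} {hq : IsPrimitiveRoot q n}

theorem IsSum.exists_areMultiplicities {M : DMod.{u, v} 𝕜 n q} (h : IsSum hn hq M) :
    ∃ s p, AreMultiplicities (simple hn hq) (cover hn hq) M s p := by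
  obtain ⟨ι, hι, σ, hσ, ⟨e⟩⟩ := h
  obtain ⟨e'⟩ := nonempty_pi_equiv_pi_fin (R := D 𝕜 n q) σ fun i => summand hn hq i
  refine ⟨fun i => Fintype.card {t // σ t = Sum.inl i},
    fun i => Fintype.card {t // σ t = Sum.inr i}, fun i hi => ?_, ?_⟩
  · rw [Fintype.card_eq_zero_iff]
    exact ⟨fun t => (hσ t.1 i t.2).ne hi⟩
  · exact ⟨(e.trans e').trans (LinearEquiv.sumPiEquivProdPi (D 𝕜 n q) (Idx n) (Idx n) fun k =>
      Fin (Fintype.card {t // σ t = k}) → summand hn hq k)⟩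

theorem AreMultiplicities.congr_right {S : Idx n → DMod.{u, u} 𝕜 n q}
    {P : Idx n → DMod.{u, v} 𝕜 n q} {P' : Idx n → DMod.{u, w} 𝕜 n q} {M : DMod 𝕜 n q}
    {s p : Idx n → ℕ} (hP : ∀ i, Nonempty (P i ≃ₗ[D 𝕜 n q] P' i))
    (h : AreMultiplicities S P M s p) : AreMultiplicities S P' M s p := by
  obtain ⟨h0, ⟨e⟩⟩ := h
  exact ⟨h0, ⟨e.trans <| (LinearEquiv.refl _ _).prodCongr <| LinearEquiv.piCongrRight fun i =>
    LinearEquiv.piCongrRight fun _ => (hP i).some⟩⟩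

variable [NeZero n]

theorem finrank_genSpace_cover (i j : Idx n) (hj : (j.1 : ℕ) < n) :
    Module.finrank 𝕜 (genSpace n q (cover hn hq j) i.1 i.2.val) =
      if i = j ∨ i = j.compl then 2 else 0 := by
  rw [cover, dif_pos hj, finrank_genSpace_qmod]

theorem finrank_primSpace_cover (i j : Idx n) (hj : (j.1 : ℕ) < n) :
    Module.finrank 𝕜 (primSpace n q (cover hn hq j) i.1 i.2.val) = if i = j then 1 else 0 := by
  rw [cover, dif_pos hj, finrank_primSpace_qmod]

variable {M : DMod.{u, v} 𝕜 n q} {s p : Idx n → ℕ}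

namespace AreMultiplicities

theorem finrank_hom (h : AreMultiplicities (simple hn hq) (cover hn hq) M s p)
    (C : DMod.{u, w} 𝕜 n q) [Module.Finite 𝕜 C] : Module.finrank 𝕜 (C →ₗ[D 𝕜 n q] M) =
      ∑ j, s j * Module.finrank 𝕜 (C →ₗ[D 𝕜 n q] simple hn hq j) +
      ∑ j, p j * Module.finrank 𝕜 (C →ₗ[D 𝕜 n q] cover hn hq j) := by
  obtain ⟨-, ⟨e⟩⟩ := h
  rw [finrank_hom_congr_right C e, finrank_hom_prod, finrank_hom_pi, finrank_hom_pi]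
  simp_rw [finrank_hom_pi, Finset.sum_const, Finset.card_univ, Fintype.card_fin, smul_eq_mul]

theorem finrank_end (h : AreMultiplicities (simple hn hq) (cover hn hq) M s p) :
    Module.finrank 𝕜 (Module.End (D 𝕜 n q) M) =
      ∑ j, s j * Module.finrank 𝕜 (simple hn hq j →ₗ[D 𝕜 n q] M) +
      ∑ j, p j * Module.finrank 𝕜 (cover hn hq j →ₗ[D 𝕜 n q] M) := by
  obtain ⟨-, ⟨e⟩⟩ := h
  have : Module.Finite 𝕜 M := Module.Finite.equiv (e.symm.restrictScalars 𝕜)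
  change Module.finrank 𝕜 (M →ₗ[D 𝕜 n q] M) = _
  rw [finrank_hom_congr_left M e, finrank_prod_hom, finrank_pi_hom, finrank_pi_hom]
  simp_rw [finrank_pi_hom, Finset.sum_const, Finset.card_univ, Fintype.card_fin, smul_eq_mul]

/-- Each V(i) and each P(i) with first index below n has socle V(i). A cover with first index n
never contributes, since its p is zero by convention. -/
theorem finrank_simple_hom (h : AreMultiplicities (simple hn hq) (cover hn hq) M s p)
    (i : Idx n) : Module.finrank 𝕜 (simple hn hq i →ₗ[D 𝕜 n q] M) = s i + p i := by
  rw [h.finrank_hom]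
  have e : ∀ j, p j * Module.finrank 𝕜 (simple hn hq i →ₗ[D 𝕜 n q] cover hn hq j) =
      p j * if i = j then 1 else 0 := fun j => by
    rcases j.1.2.2.eq_or_lt with hj | hj
    · rw [h.1 j hj, zero_mul, zero_mul]
    · rw [finrank_hom_simple, finrank_primSpace_cover _ _ hj]
  simp_rw [e, finrank_hom_simple, finrank_primSpace_simple]
  simp

theorem finrank_cover_hom (h : AreMultiplicities (simple hn hq) (cover hn hq) M s p)
    {i : Idx n} (hi : (i.1 : ℕ) < n) : Module.finrank 𝕜 (cover hn hq i →ₗ[D 𝕜 n q] M) =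
      s i + 2 * p i + 2 * p i.compl := by
  rw [h.finrank_hom]
  have e : ∀ j, p j * Module.finrank 𝕜 (cover hn hq i →ₗ[D 𝕜 n q] cover hn hq j) =
      -- The condition "i = j or i is the complement of j" becomes a sum of two indicators, which
      -- never overlap by `Idx.compl_ne`.
      (if i = j then 2 * p j else 0) + if i.compl = j then 2 * p j else 0 := fun j => by
    rcases j.1.2.2.eq_or_lt with hj | hj
    · rw [h.1 j hj]
      simp
    · have hc : i.compl = j ↔ i = j.compl :=
        ⟨fun h => by rw [← h, Idx.compl_compl hi], fun h => by rw [h, Idx.compl_compl hj]⟩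
      rw [finrank_hom_cover, finrank_genSpace_cover _ _ hj]
      simp only [hc]
      by_cases h1 : i = j
      · subst h1
        simp [(Idx.compl_ne hi).symm, mul_comm]
      · simp [h1, mul_comm]
  simp_rw [e, finrank_hom_cover, finrank_genSpace_simple, Finset.sum_add_distrib]
  simp [add_assoc]

/-- The sums s_i + p_i are determined, hence so are p_i + 2p_i' and, from the complementary pair,
p_i' + 2p_i. This linear system has determinant -3, so p and then s are determined. -/
theorem unique {s' p' : Idx n → ℕ} (h : AreMultiplicities (simple hn hq) (cover hn hq) M s p)
    (h' : AreMultiplicities (simple hn hq) (cover hn hq) M s' p') : s' = s ∧ p' = p := by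
  have h1 : ∀ i, s' i + p' i = s i + p i := fun i => by
    rw [← h.finrank_simple_hom, h'.finrank_simple_hom]
  have key : ∀ i, s' i = s i ∧ p' i = p i := fun i => by
    have h2 := h1 i
    rcases i.1.2.2.eq_or_lt with hi | hi
    · have := h.1 i hi
      have := h'.1 i hi
      omega
    · have h3 := h1 i.compl
      have h4 := (h'.finrank_cover_hom hi).symm.trans (h.finrank_cover_hom hi)
      have h5 := (h'.finrank_cover_hom (Idx.compl_fst_lt hi)).symm.trans
        (h.finrank_cover_hom (Idx.compl_fst_lt hi))
      rw [Idx.compl_compl hi] at h5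
      omega
  exact ⟨funext fun i => (key i).1, funext fun i => (key i).2⟩

theorem finrank_end_eq (h : AreMultiplicities (simple hn hq) (cover hn hq) M s p) :
    Module.finrank 𝕜 (Module.End (D 𝕜 n q) M) =
      (∑ i with s i ≠ 0 ∨ p i ≠ 0, p i ^ 2) +
      (∑ i with s i ≠ 0 ∨ p i ≠ 0, (s i + p i) ^ 2) +
      2 * ∑ i with s i ≠ 0 ∨ p i ≠ 0, p i * p i.compl := by
  -- Restricting the sums to the indices that occur is harmless: every term vanishes when s_i = p_i
  -- = 0.
  rw [h.finrank_end, Finset.sum_filter_of_ne, Finset.sum_filter_of_ne, Finset.sum_filter_of_ne,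
    Finset.mul_sum, ← Finset.sum_add_distrib, ← Finset.sum_add_distrib, ← Finset.sum_add_distrib]
  · refine Finset.sum_congr rfl fun i _ => ?_
    rw [h.finrank_simple_hom]
    rcases i.1.2.2.eq_or_lt with hi | hi
    · rw [h.1 i hi]
      ring
    · rw [h.finrank_cover_hom hi]
      ring
  all_goals
    intro i _ hi
    by_contra! hc
    exact hi (by simp [hc.1, hc.2])

end AreMultiplicities

end Formula

end TaftDouble

end

/-! ### The theorem -/

theorem theorem5p3 {𝕜 : Type u} [Field 𝕜] [IsAlgClosed 𝕜] [CharZero 𝕜]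
    (n : ℕ) [NeZero n] (hn : 2 ≤ n) (q : 𝕜) (hq : IsPrimitiveRoot q n)
    (V : TaftDouble.DMod.{u, v} 𝕜 n q) (hV : IsSimpleModule (TaftDouble.D 𝕜 n q) V)
    (hdim : Module.finrank 𝕜 V = 2) (k : ℕ) (hk : 1 ≤ k) :
    (∀ i : TaftDouble.Idx n, ∃ P : TaftDouble.DMod.{u, u} 𝕜 n q,
      TaftDouble.IsProjectiveCover P (TaftDouble.simple hn hq i)) ∧
    ∀ P : TaftDouble.Idx n → TaftDouble.DMod.{u, w} 𝕜 n q,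
      (∀ i, TaftDouble.IsProjectiveCover (P i) (TaftDouble.simple hn hq i)) →
      (∃! m : (TaftDouble.Idx n → ℕ) × (TaftDouble.Idx n → ℕ),
        TaftDouble.AreMultiplicities (TaftDouble.simple hn hq) P (V.tensorPow hq k) m.1 m.2) ∧
      ∀ s p : TaftDouble.Idx n → ℕ,
        TaftDouble.AreMultiplicities (TaftDouble.simple hn hq) P (V.tensorPow hq k) s p →
        Module.finrank 𝕜 (Module.End (TaftDouble.D 𝕜 n q) (V.tensorPow hq k)) =
          (∑ i with s i ≠ 0 ∨ p i ≠ 0, p i ^ 2) +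
          (∑ i with s i ≠ 0 ∨ p i ≠ 0, (s i + p i) ^ 2) +
          2 * ∑ i with s i ≠ 0 ∨ p i ≠ 0, p i * p i.compl := by
  open TaftDouble in
  refine ⟨fun i => ⟨_, isProjectiveCover_cover hn hq i⟩, fun P hP => ?_⟩
  -- Projective covers are unique up to isomorphism, so the given family may be replaced by the
  -- explicit covers.
  have hPc : ∀ i, Nonempty (P i ≃ₗ[D 𝕜 n q] cover hn hq i) := fun i =>
    (hP i).nonempty_equiv (isProjectiveCover_cover hn hq i)
  refine ⟨?_, fun s p h => (h.congr_right hPc).finrank_end_eq⟩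
  obtain ⟨j, ⟨e⟩⟩ := exists_equiv_simple hn hq V
  have hj : (j.1 : ℕ) = 2 := by
    rw [← finrank_simple hn hq j, ← hdim]
    exact (e.restrictScalars 𝕜).finrank_eq
  -- The k-th tensor power is by definition `tensorPowSucc` at k - 1.
  obtain ⟨e'⟩ := nonempty_tensorPowSucc_equiv hq e.symm (k - 1)
  obtain ⟨s, p, h⟩ := IsSum.exists_areMultiplicities (M := V.tensorPow hq k)
    (IsSum.of_equiv e' (isSum_tensorPowSucc (hn := hn) hj (k - 1)))
  exact ⟨(s, p), h.congr_right fun i => ⟨(hPc i).some.symm⟩,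
    fun m hm => Prod.ext_iff.2 (h.unique (hm.congr_right hPc))⟩
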